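/- **Theorem 3.3.** Let $0<\lambda<1$, $0<a<1$, and write $\bar\lambda=1-\lambda$, $\bar a=1-a$. Consider a slotted system with two queues (relays). In each slot, first, with probability $\lambda$, a packet arrives and joins the shorter queue (each queue with probability $1/2$ in case of a tie); then each non-empty relay independently transmits with probability $a$. If exactly one relay transmits, one packet leaves its queue; if both transmit, they collide and nothing leaves. Let $(Q_1(n),Q_2(n))$ be the queue lengths at the beginning of slot $n$, a Markov chain on $\mathbb{N}^2$ with an arbitrary initial distribution, and assume $$\rho=\frac{\lambda(\bar a^2+a^2)}{2\bar\lambda\bar a a}<1 .$$ Put $p=\lambda(\bar a^2+a^2)$, $q=\bar\lambda a\bar a$, $r=\lambda a\bar a$, $s=\bar\lambda(\bar a^2+a^2)$ and $$(1-s-r)\,\gamma\delta=(q\gamma+p)\,\delta^2+r\,\delta^3+q\,\gamma^2,\tag{K}$$ $$V(\gamma,\delta)=\delta(1-\bar\lambda\bar a-\lambda a\bar a)-\bar\lambda a\,\delta^2-\bar\lambda a\bar a\,\gamma,$$ $$A(\gamma,\delta)=\begin{bmatrix}\gamma(1-s-r)&-(\gamma\delta q+\delta p)\\-\gamma(p+2\gamma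 q)&\gamma\delta(1-s-2r)\\ \gamma^2 r&\gamma^2\delta q\end{bmatrix},\qquad B(\gamma,\delta)=\begin{bmatrix}-r\\-(\gamma q+p+\delta r)\\-\gamma(1-s-r)+\gamma\delta q+\delta p+\delta^2 r\end{bmatrix}.$$ (1) There is exactly one family of real sequences $(\gamma_i)_{i\ge0},(\delta_i)_{i\ge0},(c_i)_{i\ge1},(d_i)_{i\ge0},(e_{0,i})_{i\ge0},(e_{1,i})_{i\ge0}$ generated by the following recursion: $\gamma_0=\rho^2$ and $d_0=1$; for every $i\ge0$, $\delta_i$ is the unique complex root $\delta$ of (K) with $\gamma=\gamma_i$ and $0<|\delta|<|\gamma_i|$, and $\gamma_{i+1}$ is the unique complex root $\gamma$ of (K) with $\delta=\delta_i$ and $0<|\gamma|<|\delta_i|$; for every $i\ge 0$, $V(\gamma_{i+1},\delta_i)\neq0$ and $$c_{i+1}=-\frac{V(\gamma_i,\delta_i)}{V(\gamma_{i+1},\delta_i)}\,d_i ;$$ and $$A(\gamma_0,\delta_0)\begin{bmatrix}e_{0,0}\\e_{1,0}\end{bmatrix}+B(\gamma_0,\delta_0)\,d_0\delta_0^2=0,$$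 $$A(\gamma_i,\delta_i)\begin{bmatrix}e_{0,i}\\e_{1,i}\end{bmatrix}+B(\gamma_i,\delta_i)\,d_i\delta_i^2=-B(\gamma_i,\delta_{i-1})\,c_i\delta_{i-1}^2\qquad(i\ge1).$$ (2) For all $k,l\ge0$ the limits $$\pi_{k,l}=\lim_{n\to\infty}\mathbb{P}\big(\min\{Q_1(n),Q_2(n)\}=k,\ |Q_1(n)-Q_2(n)|=l\big)$$ exist, do not depend on the initial distribution, and sum to $1$. There is a constant $c>0$ (the normalisation constant) such that $$\pi_{k,l}=c\sum_{i=0}^\infty(d_i\gamma_i^k+c_{i+1}\gamma_{i+1}^k)\,\delta_i^l =c\Big(d_0\gamma_0^k\delta_0^l+\sum_{i=0}^\infty(c_{i+1}\delta_i^l+d_{i+1}\delta_{i+1}^l)\,\gamma_{i+1}^k\Big),\qquad k\ge0,\ l\ge2,$$ $$\pi_{k,l}=c\sum_{i=0}^\infty e_{l,i}\,\gamma_i^k\delta_i^l,\qquad k\ge1,\ l=0,1,$$ where the series $\sum_i d_i\gamma_i^k\delta_i^l$ and $\sum_i c_{i+1}\gamma_{i+1}^k\delta_i^l$ ($k\ge0$,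 $l\ge2$) and $\sum_i e_{l,i}\gamma_i^k\delta_i^l$ ($k\ge1$, $l=0,1$) converge absolutely. (3) $(\pi_{0,0},\pi_{0,1},\pi_{0,2})$ is the unique solution $(x_0,x_1,x_2)$ of the balance equations $$x_2=x_2(\bar\lambda\bar a+\lambda a\bar a)+\pi_{0,3}\bar\lambda a+\pi_{1,1}\bar\lambda a\bar a+\pi_{1,0}\lambda a\bar a,$$ $$x_1=x_1(\bar\lambda\bar a+2\lambda a\bar a)+x_2\bar\lambda a+2\pi_{1,0}\bar\lambda a\bar a+x_0\lambda\bar a,$$ $$x_0=x_0(\bar\lambda+\lambda a)+x_1\bar\lambda a .$$ -/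

import Mathlib

open Filter Topology MeasureTheory

noncomputable section

namespace RelayNetwork

/-! ### The two-relay network under join-the-shortest-relay-queue routing

`lam` is the arrival probability per slot and `a` the transmission probability of a relay.
A state `(i, j)` records the queue lengths of relay 1 and relay 2 at the beginning of a slot. -/

/-- Probability that an arriving packet is routed to a relay whose queue length is `own`, when the
other relay has queue length `other`: the shorter queue is joined, ties are broken evenly. -/
def routeProb (own other : ℕ) : ℝ :=
  if own < other then 1 else if own = other then 1 / 2 else 0

/-- Arrival at the beginning of a slot in state `s`: outcome `0` is no arrival, outcome `1` an
arrival routed to relay 1, outcome `2` an arrival routed to relay 2. -/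
def arrivalProb (lam : ℝ) (s : ℕ × ℕ) : Fin 3 → ℝ :=
  ![1 - lam, lam * routeProb s.1 s.2, lam * routeProb s.2 s.1]

/-- The queue lengths after the arrival. -/
def afterArrival (s : ℕ × ℕ) : Fin 3 → ℕ × ℕ :=
  ![s, (s.1 + 1, s.2), (s.1, s.2 + 1)]

/-- Probability that the transmission coin of a relay shows `t`. -/
def attemptProb (a : ℝ) (t : Bool) : ℝ := if t then a else 1 - a

/-- The queue lengths at the end of the slot, if the queue lengths after the arrival are `s` and the
transmission coins of the relays show `t₁` and `t₂`. Only a non-empty relay transmits. A packet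
leaves if exactly one relay transmits; simultaneous transmissions collide and both fail. -/
def afterTransmission (s : ℕ × ℕ) (t₁ t₂ : Bool) : ℕ × ℕ :=
  (if (t₁ = true ∧ 0 < s.1) ∧ ¬ (t₂ = true ∧ 0 < s.2) then s.1 - 1 else s.1,
   if (t₂ = true ∧ 0 < s.2) ∧ ¬ (t₁ = true ∧ 0 < s.1) then s.2 - 1 else s.2)

/-- One-step transition probabilities of the queue length process. -/
def transProb (lam a : ℝ) (s s' : ℕ × ℕ) : ℝ :=
  ∑ r : Fin 3, ∑ t₁ : Bool, ∑ t₂ : Bool,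
    if afterTransmission (afterArrival s r) t₁ t₂ = s' then
      arrivalProb lam s r * attemptProb a t₁ * attemptProb a t₂ else 0

/-- `Q` is a Markov chain on `ℕ × ℕ` with transition probabilities `transProb lam a`
(and an arbitrary initial distribution). -/
structure IsQueueChain (lam a : ℝ) {Ω : Type*} [MeasurableSpace Ω] (P : Measure Ω)
    (Q : ℕ → Ω → ℕ × ℕ) : Prop where
  measurable : ∀ n, Measurable (Q n)
  markov : ∀ (n : ℕ) (h : ℕ → ℕ × ℕ) (s' : ℕ × ℕ),
    P.real {ω | (∀ m ≤ n, Q m ω = h m) ∧ Q (n + 1) ω = s'} =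
      P.real {ω | ∀ m ≤ n, Q m ω = h m} * transProb lam a (h n) s'

/-- `π k l` is the limit of `ℙ(min(Q₁(n), Q₂(n)) = k, |Q₁(n) - Q₂(n)| = l)` as `n → ∞`, for every
version of the queue length chain and every initial distribution, and the limits sum to one. -/
def IsEquilibrium (lam a : ℝ) (π : ℕ → ℕ → ℝ) : Prop :=
  HasSum (fun s : ℕ × ℕ => π s.1 s.2) 1 ∧
    ∀ (Ω : Type*) [MeasurableSpace Ω] (P : Measure Ω) [IsProbabilityMeasure P]
      (Q : ℕ → Ω → ℕ × ℕ), IsQueueChain lam a P Q → ∀ k l : ℕ,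
        Tendsto (fun n => P.real {ω | min (Q n ω).1 (Q n ω).2 = k ∧
          |((Q n ω).1 : ℤ) - ((Q n ω).2 : ℤ)| = (l : ℤ)}) atTop (𝓝 (π k l))

/-- The system load `ρ`. -/
def load (lam a : ℝ) : ℝ :=
  lam * ((1 - a) ^ 2 + a ^ 2) / (2 * (1 - lam) * (1 - a) * a)

/-! ### The compensation procedure -/

/-- `λ (ā² + a²)`: an arrival and no departure. -/
def pUp (lam a : ℝ) : ℝ := lam * ((1 - a) ^ 2 + a ^ 2)

/-- `λ̄ a ā`: no arrival, and a departure from a given one of two non-empty relays. -/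
def pDown (lam a : ℝ) : ℝ := (1 - lam) * a * (1 - a)

/-- `λ a ā`: an arrival, and a departure from a given one of two non-empty relays. -/
def pSwap (lam a : ℝ) : ℝ := lam * a * (1 - a)

/-- `λ̄ (ā² + a²)`: neither an arrival nor a departure, when both relays are non-empty. -/
def pIdle (lam a : ℝ) : ℝ := (1 - lam) * ((1 - a) ^ 2 + a ^ 2)

/-- The kernel equation: `γ ^ k * δ ^ l` satisfies the balance equations in the interior. -/
def Kernel (lam a : ℝ) (γ δ : ℂ) : Prop :=
  (1 - ((pIdle lam a : ℂ) + (pSwap lam a : ℂ))) * γ * δ =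
    ((pDown lam a : ℂ) * γ + (pUp lam a : ℂ)) * δ ^ 2 + (pSwap lam a : ℂ) * δ ^ 3 +
      (pDown lam a : ℂ) * γ ^ 2

/-- The error (up to a power of `δ`) of `γ ^ k * δ ^ l` in the balance equations on the
vertical boundary. -/
def vertErr (lam a γ δ : ℝ) : ℝ :=
  δ * (1 - (1 - lam) * (1 - a) - lam * a * (1 - a)) - (1 - lam) * a * δ ^ 2 -
    (1 - lam) * a * (1 - a) * γ

/-- Coefficient matrix of the terms at `l = 0, 1` in the three horizontal boundary equations. -/
def matA (lam a γ δ : ℝ) : Matrix (Fin 3) (Fin 2) ℝ :=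
  !![γ * (1 - pIdle lam a - pSwap lam a), -(γ * δ * pDown lam a + δ * pUp lam a);
     -(γ * (pUp lam a + 2 * γ * pDown lam a)), γ * δ * (1 - pIdle lam a - 2 * pSwap lam a);
     γ ^ 2 * pSwap lam a, γ ^ 2 * δ * pDown lam a]

/-- Coefficient vector of the terms at `l ≥ 2` in the three horizontal boundary equations. -/
def vecB (lam a γ δ : ℝ) : Fin 3 → ℝ :=
  ![-(pSwap lam a),
    -(γ * pDown lam a + pUp lam a + δ * pSwap lam a),
    -(γ * (1 - pIdle lam a - pSwap lam a)) + γ * δ * pDown lam a + δ * pUp lam a +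
      δ ^ 2 * pSwap lam a]

/-- The roots `γ i`, `δ i` and the coefficients `c i`, `d i`, `e l i` (`l = 0, 1`). -/
structure CompSeq where
  γ : ℕ → ℝ
  δ : ℕ → ℝ
  c : ℕ → ℝ
  d : ℕ → ℝ
  e : Fin 2 → ℕ → ℝ

/-- The recursion of the compensation procedure. -/
structure CompSeq.IsGenerated (lam a : ℝ) (S : CompSeq) : Prop where
  γ_zero : S.γ 0 = load lam a ^ 2
  /-- `δ i` is the only complex root of the kernel equation for `γ i` with `0 < |δ| < |γ i|`. -/
  δ_root : ∀ (i : ℕ) (z : ℂ),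
    (0 < ‖z‖ ∧ ‖z‖ < ‖S.γ i‖ ∧ Kernel lam a (S.γ i : ℂ) z) ↔ z = (S.δ i : ℂ)
  /-- `γ (i + 1)` is the only complex root of the kernel equation for `δ i` with
  `0 < |γ| < |δ i|`. -/
  γ_root : ∀ (i : ℕ) (z : ℂ),
    (0 < ‖z‖ ∧ ‖z‖ < ‖S.δ i‖ ∧ Kernel lam a z (S.δ i : ℂ)) ↔ z = (S.γ (i + 1) : ℂ)
  /-- There is no coefficient `c 0`; it is set to zero by convention. -/
  c_zero : S.c 0 = 0
  d_zero : S.d 0 = 1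
  /-- Compensation on the vertical boundary; the division is by a non-zero number. -/
  vertErr_ne : ∀ i, vertErr lam a (S.γ (i + 1)) (S.δ i) ≠ 0
  c_succ : ∀ i, S.c (i + 1) =
    -(vertErr lam a (S.γ i) (S.δ i) / vertErr lam a (S.γ (i + 1)) (S.δ i)) * S.d i
  /-- The initial term satisfies the equations on the horizontal boundary. -/
  horizontal_zero :
    (matA lam a (S.γ 0) (S.δ 0)).mulVec (fun l => S.e l 0) +
      (S.d 0 * S.δ 0 ^ 2) • vecB lam a (S.γ 0) (S.δ 0) = 0
  /-- Compensation on the horizontal boundary. -/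
  horizontal_succ : ∀ i,
    (matA lam a (S.γ (i + 1)) (S.δ (i + 1))).mulVec (fun l => S.e l (i + 1)) +
      (S.d (i + 1) * S.δ (i + 1) ^ 2) • vecB lam a (S.γ (i + 1)) (S.δ (i + 1)) =
      -((S.c (i + 1) * S.δ i ^ 2) • vecB lam a (S.γ (i + 1)) (S.δ i))

/-- The balance equations in the states `(0, 2)`, `(0, 1)` and `(0, 0)`, with `x₀`, `x₁`, `x₂` in
the place of the probabilities of `(0, 0)`, `(0, 1)`, `(0, 2)`, and the other values given by `π`. -/
def OriginEquations (lam a : ℝ) (π : ℕ → ℕ → ℝ) (x₀ x₁ x₂ : ℝ) : Prop :=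
  x₂ = x₂ * ((1 - lam) * (1 - a) + lam * a * (1 - a)) + π 0 3 * ((1 - lam) * a) +
      π 1 1 * ((1 - lam) * a * (1 - a)) + π 1 0 * (lam * a * (1 - a)) ∧
  x₁ = x₁ * ((1 - lam) * (1 - a) + 2 * lam * a * (1 - a)) + x₂ * ((1 - lam) * a) +
      π 1 0 * (2 * (1 - lam) * a * (1 - a)) + x₀ * (lam * (1 - a)) ∧
  x₀ = x₀ * ((1 - lam) + lam * a) + x₁ * ((1 - lam) * a)

end RelayNetwork

end

/-! The process (minimum, absolute difference) is a countable Markov chain, a lumping of the queue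
length chain (`slotMean_foldState`). The plan is to write down a summable signed solution of its
balance equations as a series of products `γ ^ k * δ ^ l`, and to show that any such solution is, up
to a positive factor, the limit law.

Roots. A product solves the interior equations exactly when `(γ, δ)` lies on the kernel curve. With
`γ = y δ` the kernel is quadratic in `y`, with one root on either side of `1` for `δ < 1`
(`ratioLow_lt_one`); for fixed `γ` it is a real cubic in `δ` with a single root in the disc of
radius `γ` (`exists_kernel_delta_iff`). Hence `γ 0 > δ 0 > γ 1 > ...`, and the sequences tend to
`0`.

Coefficients. Two products with the same `δ` cancel their errors on the vertical boundary; this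
determines `c (i + 1)`, because the error of the smaller root is positive
(`vertRatio_ratioLow_pos`). On the horizontal boundary, three equations for the two unknowns `e l i`
leave one linear solvability condition with coefficients `horizCoef`. On the kernel curve
`horizCoef` shares a factor with `ρ ^ 2 - γ`: it vanishes at `γ 0 = ρ ^ 2`, so the initial term
needs no companion, and it is negative afterwards, so `d (i + 1)` is determined.

Convergence. The ratio of successive terms `d i * γ i ^ 2` tends to `termQuot lam a 0 0`, of modulus
below one (`abs_termQuot_zero_lt`). All series are dominated by the summable `weight`, geometrically
in the state, and the balance equations can be checked term by term. The equation in `(1, 0)` comes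
for free from conservation of mass.

Limit law. The modulus of a summable invariant measure is again invariant. The chain is irreducible
with positive holding probabilities, so an energy argument gives convergence to the normalised
modulus; conservation of the signed mean then shows that the solution has constant sign
(`IsInvariant.normalize`). The initial term dominates for large `k`, so this sign is positive and so
is the normalisation constant. -/

noncomputable section

/-! ### Countable Markov chains -/

namespace MarkovMatrix

variable {S : Type*}

/-- A row-stochastic matrix on a discrete state space. -/
structure IsStochastic (P : S → S → ℝ) : Prop where
  nonneg : ∀ x y, 0 ≤ P x y
  hasSum_one : ∀ x, HasSum (P x) 1

/-- The action of a transition matrix on functions. -/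
def avg (P : S → S → ℝ) (f : S → ℝ) (x : S) : ℝ := ∑' y, P x y * f y

/-- `x` is a (signed) invariant measure of `P`. -/
def IsInvariant (P : S → S → ℝ) (x : S → ℝ) : Prop := ∀ y, HasSum (fun s => x s * P s y) (x y)

theorem summable_mul_bounded {a f : S → ℝ} {C : ℝ} (ha : Summable fun s => |a s|)
    (hf : ∀ s, |f s| ≤ C) : Summable fun s => a s * f s := by
  refine Summable.of_norm_bounded (ha.mul_right C) fun s => ?_
  rw [Real.norm_eq_abs, abs_mul]
  exact mul_le_mul_of_nonneg_left (hf s) (abs_nonneg _)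

variable {P : S → S → ℝ}

theorem IsStochastic.summable_abs (hP : IsStochastic P) (x : S) : Summable fun y => |P x y| := by
  simpa [abs_of_nonneg (hP.nonneg x _)] using (hP.hasSum_one x).summable

/-- Absolute summability over pairs of states is what permits every later interchange of the sums
over source and target. -/
theorem IsStochastic.summable_flow (hP : IsStochastic P) {x f : S → ℝ} {C : ℝ}
    (hx : Summable fun s => |x s|) (hf : ∀ s, |f s| ≤ C) :
    Summable (Function.uncurry fun s y => x s * P s y * f y) := by
  have h : Summable (Function.uncurry fun s y => |x s| * P s y * C) := by
    -- The bound `C` is known to be nonnegative only if there is a state at which to evaluate `f`.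
    by_cases hS : Nonempty S
    · obtain ⟨s₀⟩ := hS
      have hC : 0 ≤ C := (abs_nonneg _).trans (hf s₀)
      refine (summable_prod_of_nonneg fun z =>
        mul_nonneg (mul_nonneg (abs_nonneg _) (hP.nonneg _ _)) hC).2 ?_
      refine ⟨fun s => ((hP.hasSum_one s).summable.mul_left |x s|).mul_right C, ?_⟩
      simp only [tsum_mul_right, tsum_mul_left, (hP.hasSum_one _).tsum_eq]
      simpa using hx.mul_right C
    · rw [not_nonempty_iff] at hS
      exact (hasSum_empty).summable
  refine Summable.of_norm_bounded h fun z => ?_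
  obtain ⟨s, y⟩ := z
  simp only [Function.uncurry_apply_pair, Real.norm_eq_abs, abs_mul, abs_of_nonneg (hP.nonneg s y)]
  exact mul_le_mul_of_nonneg_left (hf y) (mul_nonneg (abs_nonneg _) (hP.nonneg _ _))

theorem IsStochastic.tsum_mul_avg (hP : IsStochastic P) {x f : S → ℝ} {C : ℝ}
    (hx : Summable fun s => |x s|) (hf : ∀ s, |f s| ≤ C) :
    ∑' s, x s * avg P f s = ∑' y, (∑' s, x s * P s y) * f y := by
  have := (hP.summable_flow hx hf).tsum_comm
  simp only [tsum_mul_right] at this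
  rw [this]
  simp only [avg, ← tsum_mul_left, mul_assoc]

theorem IsInvariant.tsum_mul_avg (hP : IsStochastic P) {x f : S → ℝ} {C : ℝ}
    (hinv : IsInvariant P x) (hx : Summable fun s => |x s|) (hf : ∀ s, |f s| ≤ C) :
    ∑' s, x s * avg P f s = ∑' y, x y * f y := by
  rw [hP.tsum_mul_avg hx hf]
  simp only [(hinv _).tsum_eq]

/-- Conservation of mass: the total inflow equals the total mass. It makes one balance equation
redundant and forces equality in `IsInvariant.abs`. -/
theorem IsStochastic.hasSum_inflow (hP : IsStochastic P) {x : S → ℝ}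
    (hx : Summable fun s => |x s|) :
    HasSum (fun y => ∑' s, x s * P s y) (∑' s, x s) := by
  have hF := hP.summable_flow (f := fun _ => 1) (C := 1) hx (by simp)
  simp only [mul_one] at hF
  have h1 := hF.tsum_comm
  simp only [tsum_mul_left, (hP.hasSum_one _).tsum_eq, mul_one] at h1
  rw [← h1]
  exact hF.prod_symm.prod.hasSum

theorem IsStochastic.summable_inflow (hP : IsStochastic P) {x : S → ℝ}
    (hx : Summable fun s => |x s|) (y : S) : Summable fun s => x s * P s y := by
  have hF := hP.summable_flow (f := fun _ => 1) (C := 1) hx (by simp)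
  simp only [mul_one] at hF
  exact hF.prod_symm.prod_factor y

/-- The balance equation in one state follows from those in all other states. -/
theorem IsStochastic.isInvariant_of_ne (hP : IsStochastic P) {x : S → ℝ}
    (hx : Summable fun s => |x s|) (s₀ : S)
    (h : ∀ y, y ≠ s₀ → HasSum (fun s => x s * P s y) (x y)) : IsInvariant P x := by
  have hsum : HasSum (fun y => (∑' s, x s * P s y) - x y) (∑' s, x s - ∑' s, x s) :=
    (hP.hasSum_inflow hx).sub hx.of_abs.hasSum
  have h0 := hsum.unique (hasSum_single s₀ fun y hy => by rw [(h y hy).tsum_eq, sub_self])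
  intro y
  by_cases hy : y = s₀
  · subst hy
    have := (hP.summable_inflow hx y).hasSum
    rwa [show ∑' s, x s * P s y = x y by linarith] at this
  · exact h y hy

/-- The triangle inequality gives `|x| ≤ |x| P` in each state. Both sides have the same total mass,
so the nonnegative differences sum to zero and all vanish. -/
theorem IsInvariant.abs (hP : IsStochastic P) {x : S → ℝ} (hinv : IsInvariant P x)
    (hx : Summable fun s => |x s|) : IsInvariant P fun s => |x s| := by
  have hx' : Summable fun s => |(|x s|)| := by simpa using hx
  have hsum : HasSum (fun y => (∑' s, |x s| * P s y) - |x y|) 0 := by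
    simpa using (hP.hasSum_inflow hx').sub hx.hasSum
  have hle : ∀ y, |x y| ≤ ∑' s, |x s| * P s y := fun y => by
    have hs : Summable fun s => ‖x s * P s y‖ := by
      simpa [abs_of_nonneg (hP.nonneg _ _)] using hP.summable_inflow hx' y
    rw [← (hinv y).tsum_eq, ← Real.norm_eq_abs]
    refine (norm_tsum_le_tsum_norm hs).trans (le_of_eq ?_)
    simp [abs_of_nonneg (hP.nonneg _ _)]
  have h0 := (hasSum_zero_iff_of_nonneg fun y => sub_nonneg.2 (hle y)).1 hsum
  intro y
  have h1 : (∑' s, |x s| * P s y) = |x y| := sub_eq_zero.1 (congrFun h0 y)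
  have h2 := (hP.summable_inflow hx' y).hasSum
  rwa [h1] at h2

theorem IsStochastic.abs_avg_le (hP : IsStochastic P) {f : S → ℝ} {C : ℝ} (hf : ∀ s, |f s| ≤ C)
    (x : S) : |avg P f x| ≤ C := by
  have h := (hP.hasSum_one x).summable.mul_right C
  refine (tsum_of_norm_bounded (f := fun y => P x y * f y) h.hasSum fun y => ?_).trans (le_of_eq ?_)
  · rw [Real.norm_eq_abs, abs_mul, abs_of_nonneg (hP.nonneg x y)]
    exact mul_le_mul_of_nonneg_left (hf y) (hP.nonneg x y)
  · rw [tsum_mul_right, (hP.hasSum_one x).tsum_eq, one_mul]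

theorem IsStochastic.abs_iterate_avg_le (hP : IsStochastic P) {f : S → ℝ} {C : ℝ}
    (hf : ∀ s, |f s| ≤ C) (n : ℕ) : ∀ x, |(avg P)^[n] f x| ≤ C := by
  induction n with
  | zero => exact hf
  | succ n ih =>
    rw [Function.iterate_succ_apply']
    exact hP.abs_avg_le ih

/-! ### Energy dissipation and convergence of the iterates. -/

theorem abs_sq_le {f : S → ℝ} {C : ℝ} (hf : ∀ s, |f s| ≤ C) (s : S) : |f s ^ 2| ≤ C ^ 2 := by
  rw [abs_pow]
  exact pow_le_pow_left₀ (abs_nonneg _) (hf s) 2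

/-- The variance of `f` under the transition probabilities from `x`. -/
theorem IsStochastic.hasSum_variance (hP : IsStochastic P) {f : S → ℝ} {C : ℝ}
    (hf : ∀ s, |f s| ≤ C) (x : S) :
    HasSum (fun y => P x y * (f y - avg P f x) ^ 2) (avg P (fun y => f y ^ 2) x - avg P f x ^ 2) := by
  have h1 : HasSum (fun y => P x y * f y) (avg P f x) :=
    (summable_mul_bounded (hP.summable_abs x) hf).hasSum
  have h2 : HasSum (fun y => P x y * f y ^ 2) (avg P (fun y => f y ^ 2) x) :=
    (summable_mul_bounded (hP.summable_abs x) (abs_sq_le hf)).hasSum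
  have h3 := (h2.sub (h1.mul_left (2 * avg P f x))).add ((hP.hasSum_one x).mul_left (avg P f x ^ 2))
  have e1 : (fun y => P x y * (f y - avg P f x) ^ 2) = fun y =>
      P x y * f y ^ 2 - 2 * avg P f x * (P x y * f y) + avg P f x ^ 2 * P x y := by
    funext y; ring
  have e2 : avg P (fun y => f y ^ 2) x - avg P f x ^ 2 =
      avg P (fun y => f y ^ 2) x - 2 * avg P f x * avg P f x + avg P f x ^ 2 * 1 := by ring
  rw [e1, e2]
  exact h3

theorem IsStochastic.variance_nonneg (hP : IsStochastic P) {f : S → ℝ} {C : ℝ}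
    (hf : ∀ s, |f s| ≤ C) (x : S) : 0 ≤ avg P (fun y => f y ^ 2) x - avg P f x ^ 2 :=
  (hP.hasSum_variance hf x).nonneg fun y => mul_nonneg (hP.nonneg x y) (sq_nonneg _)

/-- Invariance replaces the mean of `avg P (f ^ 2)` by that of `f ^ 2`, so the averaged one-step
variance is exactly the energy lost when `f` is replaced by `avg P f`. -/
theorem IsInvariant.hasSum_energy (hP : IsStochastic P) {π f : S → ℝ} {C : ℝ}
    (hinv : IsInvariant P π) (hπ : Summable fun s => |π s|) (hf : ∀ s, |f s| ≤ C) :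
    HasSum (fun x => π x * (avg P (fun y => f y ^ 2) x - avg P f x ^ 2))
      (∑' x, π x * f x ^ 2 - ∑' x, π x * avg P f x ^ 2) := by
  rw [← hinv.tsum_mul_avg hP hπ (abs_sq_le hf)]
  have h1 := (summable_mul_bounded hπ (hP.abs_avg_le (abs_sq_le hf))).hasSum
  have h2 := (summable_mul_bounded hπ (abs_sq_le (hP.abs_avg_le hf))).hasSum
  simpa only [mul_sub] using h1.sub h2

/-- Every state can be reached from every other state. -/
def IsIrreducible (P : S → S → ℝ) : Prop :=
  ∀ x y, Relation.ReflTransGen (fun s t => 0 < P s t) x y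

theorem IsInvariant.pos (hP : IsStochastic P) (hirr : IsIrreducible P)
    {π : S → ℝ} (hinv : IsInvariant P π) (h0 : ∀ s, 0 ≤ π s) {s₀ : S}
    (hs₀ : 0 < π s₀) (s : S) : 0 < π s := by
  induction hirr s₀ s with
  | refl => exact hs₀
  | @tail b c _ hbc ih =>
    refine lt_of_lt_of_le (mul_pos ih hbc) ?_
    exact le_hasSum (hinv c) b fun j _ => mul_nonneg (h0 j) (hP.nonneg j c)

/-- Bounded harmonic functions of a positive recurrent chain are constant. -/
theorem IsInvariant.harmonic_const (hP : IsStochastic P) (hirr : IsIrreducible P)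
    {π g : S → ℝ} {C : ℝ} (hinv : IsInvariant P π)
    (hpos : ∀ s, 0 < π s) (hπ : Summable fun s => |π s|) (hg : ∀ s, |g s| ≤ C)
    (hh : ∀ s, avg P g s = g s) (x y : S) : g x = g y := by
  have hE := hinv.hasSum_energy hP hπ hg
  simp only [hh, sub_self] at hE
  -- A harmonic function loses no energy, so its variance vanishes in each state; it is therefore
  -- unchanged along every possible transition.
  have hE' := (hasSum_zero_iff_of_nonneg fun s => mul_nonneg (hpos s).le (by
    have := hP.variance_nonneg hg s; rwa [hh] at this)).1 hE
  have hvar : ∀ s t, 0 < P s t → g s = g t := fun s t hst => by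
    have h1 : avg P (fun y => g y ^ 2) s - g s ^ 2 = 0 := by
      have := congrFun hE' s
      simpa [(hpos s).ne'] using this
    have h2 := hP.hasSum_variance hg s
    rw [hh, h1, hasSum_zero_iff_of_nonneg fun y => mul_nonneg (hP.nonneg s y) (sq_nonneg _)] at h2
    have h3 := congrFun h2 t
    simp only [Pi.zero_apply, mul_eq_zero, hst.ne', false_or, pow_eq_zero_iff two_ne_zero] at h3
    linarith
  induction hirr x y with
  | refl => rfl
  | tail _ hbc ih => exact ih.trans (hvar _ _ hbc)

/-- The convergence theorem for irreducible, positive recurrent chains which may stay put in every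
state. -/
theorem IsInvariant.tendsto_iterate_avg (hP : IsStochastic P) (hirr : IsIrreducible P)
    {π f : S → ℝ} {C : ℝ} (hloop : ∀ x, 0 < P x x)
    (hinv : IsInvariant P π) (hpos : ∀ s, 0 < π s) (hsum : HasSum π 1) (hf : ∀ s, |f s| ≤ C)
    (x : S) : Tendsto (fun n => (avg P)^[n] f x) atTop (𝓝 (∑' y, π y * f y)) := by
  have hπ : Summable fun s => |π s| := hsum.summable.abs
  set h : ℕ → S → ℝ := fun n => (avg P)^[n] f with hh
  have hsucc : ∀ n, h (n + 1) = avg P (h n) := fun n => Function.iterate_succ_apply' _ _ _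
  have hb : ∀ n s, |h n s| ≤ C := fun n => hP.abs_iterate_avg_le hf n
  set e : ℕ → ℝ := fun n => ∑' s, π s * h n s ^ 2 with he
  -- The energy loss dominates its part in state `s`, and the variance there dominates the
  -- contribution of the transition from `s` to itself. This is where holding probabilities enter:
  -- consecutive iterates become asymptotically equal.
  have hdiff : ∀ n s, π s * (P s s * (h n s - h (n + 1) s) ^ 2) ≤ e n - e (n + 1) := fun n s => by
    have hE := hinv.hasSum_energy hP hπ (hb n)
    simp only [← hsucc] at hE
    refine le_trans ?_ (le_hasSum hE s fun j _ => mul_nonneg (hpos j).le (by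
      have := hP.variance_nonneg (hb n) j; rwa [← hsucc] at this))
    refine mul_le_mul_of_nonneg_left ?_ (hpos s).le
    have hV := hP.hasSum_variance (hb n) s
    rw [← hsucc] at hV
    exact le_hasSum hV s fun j _ => mul_nonneg (hP.nonneg s j) (sq_nonneg _)
  have hanti : Antitone e := antitone_nat_of_succ_le fun n => by
    have := (mul_nonneg (hpos x).le (mul_nonneg (hP.nonneg x x) (sq_nonneg _))).trans (hdiff n x)
    linarith
  have hlim := tendsto_atTop_ciInf hanti ⟨0, by
    rintro _ ⟨n, rfl⟩
    exact tsum_nonneg fun s => mul_nonneg (hpos s).le (sq_nonneg _)⟩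
  have hinc : Tendsto (fun n => e n - e (n + 1)) atTop (𝓝 0) := by
    simpa using hlim.sub (hlim.comp (tendsto_add_atTop_nat 1))
  have hasym : ∀ s, Tendsto (fun n => h (n + 1) s - h n s) atTop (𝓝 0) := fun s => by
    have h1 : Tendsto (fun n => (h (n + 1) s - h n s) ^ 2) atTop (𝓝 0) := by
      have hc := mul_pos (hpos s) (hloop s)
      refine squeeze_zero (fun n => sq_nonneg _) (fun n => ?_)
        (by simpa using hinc.div_const (π s * P s s))
      rw [le_div_iff₀ hc]
      nlinarith [hdiff n s]
    rw [tendsto_zero_iff_abs_tendsto_zero]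
    simpa [Function.comp_def, Real.sqrt_sq_eq_abs] using (Real.continuous_sqrt.tendsto 0).comp h1
  rw [tendsto_iff_ultrafilter]
  intro U hU
  -- Compactness gives pointwise limits along an ultrafilter. Since consecutive iterates merge, the
  -- limit is harmonic, hence constant, and the conserved `π`-mean identifies the constant
  -- independently of the ultrafilter.
  have hex : ∀ s, ∃ g ∈ Set.Icc (-C) C, Tendsto (fun n => h n s) U (𝓝 g) := fun s => by
    have := isCompact_Icc.ultrafilter_le_nhds (U.map fun n => h n s) (s := Set.Icc (-C) C) (by
      rw [Ultrafilter.coe_map, le_principal_iff, mem_map]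
      exact Filter.Eventually.of_forall fun n => abs_le.1 (hb n s))
    exact this
  choose g hgC hg using hex
  have hgb : ∀ s, |g s| ≤ C := fun s => abs_le.2 (hgC s)
  have hharm : ∀ s, avg P g s = g s := fun s => by
    have h1 : Tendsto (fun n => h (n + 1) s) U (𝓝 (g s)) := by
      simpa using ((hasym s).mono_left hU).add (hg s)
    refine tendsto_nhds_unique ?_ h1
    simp only [hsucc]
    refine tendsto_tsum_of_dominated_convergence
      ((hP.hasSum_one s).summable.mul_right C) (fun y => (hg y).const_mul _) ?_
    refine Filter.Eventually.of_forall fun n y => ?_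
    rw [Real.norm_eq_abs, abs_mul, abs_of_nonneg (hP.nonneg s y)]
    exact mul_le_mul_of_nonneg_left (hb n y) (hP.nonneg s y)
  have hconst := hinv.harmonic_const hP hirr hpos hπ hgb hharm
  have hmean : ∀ n, ∑' s, π s * h n s = ∑' s, π s * f s := fun n => by
    induction n with
    | zero => rfl
    | succ n ih => rw [hsucc, hinv.tsum_mul_avg hP hπ (hb n), ih]
  have hmlim : Tendsto (fun n => ∑' s, π s * h n s) U (𝓝 (∑' s, π s * g s)) := by
    refine tendsto_tsum_of_dominated_convergence (hsum.summable.mul_right C)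
      (fun y => (hg y).const_mul _) ?_
    refine Filter.Eventually.of_forall fun n y => ?_
    rw [Real.norm_eq_abs, abs_mul, abs_of_pos (hpos y)]
    exact mul_le_mul_of_nonneg_left (hb n y) (hpos y).le
  simp only [hmean] at hmlim
  have : ∑' s, π s * f s = g x := by
    rw [tendsto_nhds_unique tendsto_const_nhds hmlim]
    simp only [hconst _ x, tsum_mul_right, hsum.tsum_eq, one_mul]
  rw [this]
  exact hg x

/-- A non-zero summable invariant measure has non-zero mass, and normalised it is an invariant
probability. -/
theorem IsInvariant.normalize (hP : IsStochastic P) (hirr : IsIrreducible P)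
    {x : S → ℝ} (hloop : ∀ s, 0 < P s s) (hinv : IsInvariant P x)
    (hx : Summable fun s => |x s|) {s₀ : S} (hs₀ : 0 < x s₀) :
    ∃ π : S → ℝ, ∃ c : ℝ, 0 < c ∧ (∀ s, π s = c * x s) ∧ (∀ s, 0 < π s) ∧ HasSum π 1 ∧
      IsInvariant P π := by
  classical
  have habs := hinv.abs hP hx
  have hpos : ∀ s, 0 < |x s| := habs.pos hP hirr (fun s => abs_nonneg _) (abs_pos.2 hs₀.ne')
  set m := ∑' s, |x s| with hm
  have hm0 : 0 < m := hx.tsum_pos (fun s => abs_nonneg _) s₀ (hpos s₀)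
  have hμ : IsInvariant P fun s => |x s| / m := fun y => by
    simpa [div_mul_eq_mul_div] using (habs y).div_const m
  have hμ1 : HasSum (fun s => |x s| / m) 1 := by
    simpa [← hm, div_self hm0.ne'] using hx.hasSum.div_const m
  -- Test the convergence theorem for the probability `|x| / m` against the signed measure `x`: the
  -- `x`-mean of the iterates of an indicator is constantly `x y`, yet tends to the total mass of
  -- `x` times `|x y| / m`. Hence `x` is a multiple of `|x|`.
  have key : ∀ y, x y = (∑' s, x s) * (|x y| / m) := fun y => by
    set f : S → ℝ := Pi.single y 1 with hf
    have hfb : ∀ s, |f s| ≤ 1 := fun s => by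
      rw [hf, Pi.single_apply]; split_ifs <;> simp
    have hlim := hμ.tendsto_iterate_avg hP hirr hloop (fun s => div_pos (hpos s) hm0) hμ1 hfb
    have hval : ∀ z : S → ℝ, ∑' s, z s * f s = z y := fun z => by
      rw [tsum_eq_single y fun s hs => by rw [hf, Pi.single_eq_of_ne hs, mul_zero]]
      simp [hf]
    rw [hval] at hlim
    have hconst : ∀ n, ∑' s, x s * (avg P)^[n] f s = x y := fun n => by
      induction n with
      | zero => exact hval x
      | succ n ih =>
        rw [Function.iterate_succ_apply',
          hinv.tsum_mul_avg hP hx (hP.abs_iterate_avg_le hfb n), ih]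
    have hL : Tendsto (fun n => ∑' s, x s * (avg P)^[n] f s) atTop
        (𝓝 (∑' s, x s * (|x y| / m))) := by
      refine tendsto_tsum_of_dominated_convergence hx (fun s => (hlim s).const_mul _) ?_
      refine Filter.Eventually.of_forall fun n s => ?_
      rw [Real.norm_eq_abs, abs_mul]
      exact mul_le_of_le_one_right (abs_nonneg _) (hP.abs_iterate_avg_le hfb n s)
    simp only [hconst] at hL
    rw [← tsum_mul_right]
    exact tendsto_nhds_unique tendsto_const_nhds hL
  set M := ∑' s, x s with hM
  have hM0 : 0 < M := by
    have h1 := key s₀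
    by_contra hneg
    have := mul_nonpos_of_nonpos_of_nonneg (not_lt.1 hneg) (div_pos (hpos s₀) hm0).le
    linarith
  refine ⟨fun s => |x s| / m, M⁻¹, inv_pos.2 hM0, fun s => ?_, fun s => div_pos (hpos s) hm0, hμ1,
    hμ⟩
  conv_rhs => rw [key s]
  rw [inv_mul_cancel_left₀ hM0.ne']

end MarkovMatrix

namespace RelayNetwork

/-! ### The chain of the minimum and the absolute difference -/

/-- The minimum and the absolute difference of the queue lengths. -/
def foldState (s : ℕ × ℕ) : ℕ × ℕ := (min s.1 s.2, s.1 - s.2 + (s.2 - s.1))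

/-- The one-step mean of a function of the minimum and the absolute difference of the queue
lengths. -/
def foldStep (lam a : ℝ) (g : ℕ × ℕ → ℝ) : ℕ × ℕ → ℝ
  | (0, 0) => ((1 - lam) + lam * a) * g (0, 0) + lam * (1 - a) * g (0, 1)
  | (0, 1) => ((1 - lam) * (1 - a) + 2 * pSwap lam a) * g (0, 1) + (1 - lam) * a * g (0, 0) +
      pUp lam a * g (1, 0)
  | (0, l + 2) => ((1 - lam) * (1 - a) + pSwap lam a) * g (0, l + 2) +
      (1 - lam) * a * g (0, l + 1) + pUp lam a * g (1, l + 1) + pSwap lam a * g (1, l)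
  | (k + 1, 0) => (pIdle lam a + pSwap lam a) * g (k + 1, 0) + 2 * pDown lam a * g (k, 1) +
      pUp lam a * g (k + 1, 1) + pSwap lam a * g (k, 2)
  | (k + 1, 1) => (pIdle lam a + 2 * pSwap lam a) * g (k + 1, 1) + pDown lam a * g (k, 2) +
      pDown lam a * g (k + 1, 0) + pUp lam a * g (k + 2, 0)
  | (k + 1, l + 2) => (pIdle lam a + pSwap lam a) * g (k + 1, l + 2) +
      pDown lam a * g (k, l + 3) + pDown lam a * g (k + 1, l + 1) +
      pUp lam a * g (k + 2, l + 1) + pSwap lam a * g (k + 2, l)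

/-- The mean of `f` after one slot. -/
def slotMean (lam a : ℝ) (f : ℕ × ℕ → ℝ) (s : ℕ × ℕ) : ℝ :=
  ∑ r : Fin 3, ∑ t₁ : Bool, ∑ t₂ : Bool,
    arrivalProb lam s r * attemptProb a t₁ * attemptProb a t₂ *
      f (afterTransmission (afterArrival s r) t₁ t₂)

theorem hasSum_transProb_mul (lam a : ℝ) (f : ℕ × ℕ → ℝ) (s : ℕ × ℕ) :
    HasSum (fun s' => transProb lam a s s' * f s') (slotMean lam a f s) := by
  simp only [transProb, slotMean, Finset.sum_mul]
  refine hasSum_sum fun r _ => hasSum_sum fun t₁ _ => hasSum_sum fun t₂ _ => ?_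
  have := hasSum_single (f := fun s' => (if afterTransmission (afterArrival s r) t₁ t₂ = s' then
      arrivalProb lam s r * attemptProb a t₁ * attemptProb a t₂ else 0) * f s')
    (afterTransmission (afterArrival s r) t₁ t₂) fun s' hs' => by simp [hs'.symm]
  simpa using this

theorem foldState_eq {i j k l : ℕ} (h : i = k ∧ j = k + l ∨ j = k ∧ i = k + l) :
    foldState (i, j) = (k, l) := by
  simp only [foldState, Prod.mk.injEq]
  omega

theorem foldState_swap (i j : ℕ) : foldState (j, i) = foldState (i, j) := by
  simp only [foldState, Prod.mk.injEq]
  omega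

theorem slotMean_zero_zero (lam a : ℝ) (f : ℕ × ℕ → ℝ) :
    slotMean lam a f (0, 0) = ((1 - lam) + lam * a) * f (0, 0) +
      lam * (1 - a) * (1 / 2 * f (1, 0) + 1 / 2 * f (0, 1)) := by
  simp [slotMean, Fin.sum_univ_three, arrivalProb, afterArrival, routeProb, attemptProb,
    afterTransmission]
  ring

theorem slotMean_zero_succ (lam a : ℝ) (f : ℕ × ℕ → ℝ) (j : ℕ) :
    slotMean lam a f (0, j + 1) = (1 - lam) * ((1 - a) * f (0, j + 1) + a * f (0, j)) +
      lam * (((1 - a) ^ 2 + a ^ 2) * f (1, j + 1) + a * (1 - a) * (f (0, j + 1) + f (1, j))) := by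
  simp [slotMean, Fin.sum_univ_three, arrivalProb, afterArrival, routeProb, attemptProb,
    afterTransmission]
  ring

theorem slotMean_succ_succ (lam a : ℝ) (f : ℕ × ℕ → ℝ) (i j : ℕ) :
    slotMean lam a f (i + 1, j + 1) =
      (1 - lam) * (((1 - a) ^ 2 + a ^ 2) * f (i + 1, j + 1) +
        a * (1 - a) * (f (i, j + 1) + f (i + 1, j))) +
      lam * routeProb (i + 1) (j + 1) * (((1 - a) ^ 2 + a ^ 2) * f (i + 2, j + 1) +
        a * (1 - a) * (f (i + 1, j + 1) + f (i + 2, j))) +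
      lam * routeProb (j + 1) (i + 1) * (((1 - a) ^ 2 + a ^ 2) * f (i + 1, j + 2) +
        a * (1 - a) * (f (i, j + 2) + f (i + 1, j + 1))) := by
  simp [slotMean, Fin.sum_univ_three, arrivalProb, afterArrival, attemptProb, afterTransmission]
  ring

/-- The dynamics is symmetric in the two relays, so lumpability needs to be checked only when the
first queue is the shorter one. -/
theorem slotMean_swap (lam a : ℝ) (f : ℕ × ℕ → ℝ) (i j : ℕ) :
    slotMean lam a f (j, i) = slotMean lam a (fun s => f s.swap) (i, j) := by
  simp only [slotMean, Fin.sum_univ_three, arrivalProb, afterArrival, attemptProb,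
    afterTransmission, Fintype.sum_bool, Matrix.cons_val_zero, Matrix.cons_val_one,
    Matrix.cons_val, Prod.swap_prod_mk]
  simp
  ring

theorem slotMean_foldState_add (lam a : ℝ) (g : ℕ × ℕ → ℝ) (k l : ℕ) :
    slotMean lam a (fun s => g (foldState s)) (k, k + l) = foldStep lam a g (k, l) := by
  have e : ∀ {i j k l : ℕ}, (i = k ∧ j = k + l ∨ j = k ∧ i = k + l) →
    g (foldState (i, j)) = g (k, l) := fun h => by rw [foldState_eq h]
  rcases k with _ | k
  · rcases l with _ | _ | l
    · rw [slotMean_zero_zero, e (k := 0) (l := 0) (by omega), e (k := 0) (l := 1) (by omega),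
        e (k := 0) (l := 1) (by omega)]
      simp only [foldStep]
      ring
    · rw [Nat.zero_add, slotMean_zero_succ, e (i := 0) (j := 0 + 1) (k := 0) (l := 1) (by omega),
        e (i := 0) (j := 0) (k := 0) (l := 0) (by omega),
        e (i := 1) (j := 0 + 1) (k := 1) (l := 0) (by omega),
        e (i := 1) (j := 0) (k := 0) (l := 1) (by omega)]
      simp only [foldStep, pSwap, pUp]
      ring
    · rw [Nat.zero_add, slotMean_zero_succ,
        e (i := 0) (j := l + 1 + 1) (k := 0) (l := l + 2) (by omega),
        e (i := 0) (j := l + 1) (k := 0) (l := l + 1) (by omega),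
        e (i := 1) (j := l + 1 + 1) (k := 1) (l := l + 1) (by omega),
        e (i := 1) (j := l + 1) (k := 1) (l := l) (by omega)]
      simp only [foldStep, pSwap, pUp]
      ring
  · rw [show k + 1 + l = k + l + 1 by omega, slotMean_succ_succ]
    rcases l with _ | _ | l
    · simp only [Nat.add_zero]
      rw [e (i := k + 1) (j := k + 1) (k := k + 1) (l := 0) (by omega),
        e (i := k) (j := k + 1) (k := k) (l := 1) (by omega),
        e (i := k + 1) (j := k) (k := k) (l := 1) (by omega),
        e (i := k + 2) (j := k + 1) (k := k + 1) (l := 1) (by omega),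
        e (i := k + 2) (j := k) (k := k) (l := 2) (by omega),
        e (i := k + 1) (j := k + 2) (k := k + 1) (l := 1) (by omega),
        e (i := k) (j := k + 2) (k := k) (l := 2) (by omega)]
      simp only [foldStep, routeProb, lt_irrefl, if_true, if_false, pIdle, pDown, pSwap, pUp]
      ring
    all_goals simp only [routeProb]; rw [if_pos (by omega), if_neg (by omega), if_neg (by omega)]
    · rw [e (i := k + 1) (j := k + (0 + 1) + 1) (k := k + 1) (l := 1) (by omega),
        e (i := k) (j := k + (0 + 1) + 1) (k := k) (l := 2) (by omega),
        e (i := k + 1) (j := k + (0 + 1)) (k := k + 1) (l := 0) (by omega),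
        e (i := k + 2) (j := k + (0 + 1) + 1) (k := k + 2) (l := 0) (by omega),
        e (i := k + 2) (j := k + (0 + 1)) (k := k + 1) (l := 1) (by omega)]
      simp only [foldStep, pIdle, pDown, pSwap, pUp]
      ring
    · rw [e (i := k + 1) (j := k + (l + 1 + 1) + 1) (k := k + 1) (l := l + 2) (by omega),
        e (i := k) (j := k + (l + 1 + 1) + 1) (k := k) (l := l + 3) (by omega),
        e (i := k + 1) (j := k + (l + 1 + 1)) (k := k + 1) (l := l + 1) (by omega),
        e (i := k + 2) (j := k + (l + 1 + 1) + 1) (k := k + 2) (l := l + 1) (by omega),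
        e (i := k + 2) (j := k + (l + 1 + 1)) (k := k + 2) (l := l) (by omega)]
      simp only [foldStep, pIdle, pDown, pSwap, pUp]
      ring

/-- Lumpability: the one-step mean of a function of the folded state depends on the folded state
alone, so the law can be followed with `foldStep`. -/
theorem slotMean_foldState (lam a : ℝ) (g : ℕ × ℕ → ℝ) (s : ℕ × ℕ) :
    slotMean lam a (fun s => g (foldState s)) s = foldStep lam a g (foldState s) := by
  obtain ⟨i, j⟩ := s
  rcases le_total i j with h | h
  · obtain ⟨l, rfl⟩ := Nat.exists_eq_add_of_le h
    rw [slotMean_foldState_add, foldState_eq (k := i) (l := l) (by omega)]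
  · obtain ⟨l, rfl⟩ := Nat.exists_eq_add_of_le h
    rw [slotMean_swap, foldState_eq (k := j) (l := l) (by omega), ← slotMean_foldState_add]
    congr 1
    funext s
    exact congrArg g (foldState_swap s.1 s.2)

/-! The transition matrix. -/

/-- The transition probabilities of the minimum and the absolute difference. -/
def foldProb (lam a : ℝ) (s s' : ℕ × ℕ) : ℝ := foldStep lam a (Pi.single s' 1) s

theorem hasSum_foldProb_mul (lam a : ℝ) (g : ℕ × ℕ → ℝ) (s : ℕ × ℕ) :
    HasSum (fun s' => foldProb lam a s s' * g s') (foldStep lam a g s) := by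
  have e : ∀ (c : ℝ) (t : ℕ × ℕ),
      HasSum (fun s' => c * (Pi.single s' (1 : ℝ) : ℕ × ℕ → ℝ) t * g s') (c * g t) := fun c t => by
    have := hasSum_single (f := fun s' => c * (Pi.single s' (1 : ℝ) : ℕ × ℕ → ℝ) t * g s') t
      fun s' hs' => by simp [Pi.single_eq_of_ne hs'.symm]
    simpa using this
  rcases s with ⟨_ | k, _ | _ | l⟩ <;> simp only [foldProb, foldStep, add_mul]
  · simpa only [add_mul] using (e ((1 - lam) + lam * a) _).add (e _ _)
  · simpa only [add_mul] using ((e ((1 - lam) * (1 - a) + 2 * pSwap lam a) _).add (e _ _)).add (e _ _)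
  · simpa only [add_mul] using
      (((e ((1 - lam) * (1 - a) + pSwap lam a) _).add (e _ _)).add (e _ _)).add (e _ _)
  · simpa only [add_mul] using (((e (pIdle lam a + pSwap lam a) _).add (e _ _)).add (e _ _)).add (e _ _)
  · simpa only [add_mul] using (((e (pIdle lam a + 2 * pSwap lam a) _).add (e _ _)).add (e _ _)).add (e _ _)
  · simpa only [add_mul] using
      ((((e (pIdle lam a + pSwap lam a) _).add (e _ _)).add (e _ _)).add (e _ _)).add (e _ _)

theorem avg_foldProb (lam a : ℝ) : MarkovMatrix.avg (foldProb lam a) = foldStep lam a := by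
  funext g s
  exact (hasSum_foldProb_mul lam a g s).tsum_eq

theorem foldStep_nonneg {lam a : ℝ} (hlam₀ : 0 < lam) (hlam₁ : lam < 1) (ha₀ : 0 < a) (ha₁ : a < 1)
    {g : ℕ × ℕ → ℝ} (hg : ∀ s, 0 ≤ g s) (s : ℕ × ℕ) : 0 ≤ foldStep lam a g s := by
  have h1 : 0 < 1 - lam := sub_pos.2 hlam₁
  have h2 : 0 < 1 - a := sub_pos.2 ha₁
  rcases s with ⟨_ | k, _ | _ | l⟩ <;> simp only [foldStep, pIdle, pDown, pSwap, pUp]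
  · have := hg (0, 0); have := hg (0, 1); positivity
  · have := hg (0, 0); have := hg (0, 1); have := hg (1, 0); positivity
  · have := hg (0, l + 2); have := hg (0, l + 1); have := hg (1, l + 1); have := hg (1, l); positivity
  · have := hg (k + 1, 0); have := hg (k, 1); have := hg (k + 1, 1); have := hg (k, 2); positivity
  · have := hg (k + 1, 1); have := hg (k, 2); have := hg (k + 1, 0); have := hg (k + 2, 0)
    positivity
  · have := hg (k + 1, l + 2); have := hg (k, l + 3); have := hg (k + 1, l + 1)
    have := hg (k + 2, l + 1); have := hg (k + 2, l); positivity

theorem foldStep_one (lam a : ℝ) (s : ℕ × ℕ) : foldStep lam a (fun _ => 1) s = 1 := by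
  rcases s with ⟨_ | k, _ | _ | l⟩ <;> simp only [foldStep, pIdle, pDown, pSwap, pUp] <;> ring

theorem foldProb_isStochastic {lam a : ℝ} (hlam₀ : 0 < lam) (hlam₁ : lam < 1) (ha₀ : 0 < a)
    (ha₁ : a < 1) : MarkovMatrix.IsStochastic (foldProb lam a) where
  nonneg s s' := foldStep_nonneg hlam₀ hlam₁ ha₀ ha₁ (fun t => by
    rw [Pi.single_apply]; split_ifs <;> norm_num) s
  hasSum_one s := by simpa [foldStep_one] using hasSum_foldProb_mul lam a (fun _ => 1) s

theorem foldProb_self_pos {lam a : ℝ} (hlam₀ : 0 < lam) (hlam₁ : lam < 1) (ha₀ : 0 < a)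
    (ha₁ : a < 1) (s : ℕ × ℕ) : 0 < foldProb lam a s s := by
  have h1 : 0 < 1 - lam := sub_pos.2 hlam₁
  have h2 : 0 < 1 - a := sub_pos.2 ha₁
  rcases s with ⟨_ | k, _ | _ | l⟩ <;>
    simp [foldProb, foldStep, pIdle, pSwap] <;> positivity

/-- Every state leads to the origin by lowering first the difference and then the minimum. The
origin leads to each `(m, 0)` through `(k, 0)`, `(k, 1)`, `(k + 1, 0)`, and the antidiagonal from
`(k + l, 0)` reaches `(k, l)`. -/
theorem foldProb_isIrreducible {lam a : ℝ} (hlam₀ : 0 < lam) (hlam₁ : lam < 1) (ha₀ : 0 < a)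
    (ha₁ : a < 1) : MarkovMatrix.IsIrreducible (foldProb lam a) := by
  have h1 : 0 < 1 - lam := sub_pos.2 hlam₁
  have h2 : 0 < 1 - a := sub_pos.2 ha₁
  set R : ℕ × ℕ → ℕ × ℕ → Prop := fun s t => 0 < foldProb lam a s t with hR
  have hleft : ∀ k l, R (k, l + 1) (k, l) := fun k l => by
    rcases k with _ | k <;> rcases l with _ | l <;>
      simp [hR, foldProb, foldStep, pDown, Pi.single_apply] <;> positivity
  have hzero : ∀ k l, Relation.ReflTransGen R (k, l) (k, 0) := fun k l => by
    induction l with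
    | zero => exact .refl
    | succ l ih => exact .head (hleft k l) ih
  have hdiag : ∀ k l, R (k + 1, l) (k, l + 1) := fun k l => by
    rcases l with _ | _ | l <;>
      simp [hR, foldProb, foldStep, pDown, Pi.single_apply] <;> positivity
  have hdown : ∀ k, Relation.ReflTransGen R (k, 0) (0, 0) := fun k => by
    induction k with
    | zero => exact .refl
    | succ k ih => exact .head (hdiag k 0) ((hzero k 1).trans ih)
  have hstep : ∀ k, R (k, 0) (k, 1) := fun k => by
    rcases k with _ | k <;> simp [hR, foldProb, foldStep, pUp, Pi.single_apply] <;> positivity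
  have hstep' : ∀ k, R (k, 1) (k + 1, 0) := fun k => by
    rcases k with _ | k <;> simp [hR, foldProb, foldStep, pUp, Pi.single_apply] <;> positivity
  have hup : ∀ k, Relation.ReflTransGen R (0, 0) (k, 0) := fun k => by
    induction k with
    | zero => exact .refl
    | succ k ih => exact (ih.tail (hstep k)).tail (hstep' k)
  have hanti : ∀ l k, Relation.ReflTransGen R (k + l, 0) (k, l) := fun l => by
    induction l with
    | zero => exact fun k => .refl
    | succ l ih =>
      intro k
      have := ih (k + 1)
      rw [show k + 1 + l = k + (l + 1) by omega] at this
      exact this.tail (hdiag k l)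
  rintro ⟨k, l⟩ ⟨k', l'⟩
  exact (((hzero k l).trans (hdown k)).trans (hup _)).trans (hanti l' k')

/-- The balance equations, except for the one in state `(1, 0)`. -/
structure IsBalanced (lam a : ℝ) (x : ℕ → ℕ → ℝ) : Prop where
  interior : ∀ k l, x (k + 1) (l + 3) = (pIdle lam a + pSwap lam a) * x (k + 1) (l + 3) +
    pDown lam a * x (k + 2) (l + 2) + pDown lam a * x (k + 1) (l + 4) + pUp lam a * x k (l + 4) +
    pSwap lam a * x k (l + 5)
  two : ∀ k, x (k + 1) 2 = (pIdle lam a + pSwap lam a) * x (k + 1) 2 +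
    pDown lam a * x (k + 2) 1 + pDown lam a * x (k + 1) 3 + pUp lam a * x k 3 +
    pSwap lam a * x k 4 + pSwap lam a * x (k + 2) 0
  one : ∀ k, x (k + 1) 1 = (pIdle lam a + 2 * pSwap lam a) * x (k + 1) 1 +
    pDown lam a * x (k + 1) 2 + 2 * pDown lam a * x (k + 2) 0 + pUp lam a * x k 2 +
    pUp lam a * x (k + 1) 0 + pSwap lam a * x k 3
  zero : ∀ k, x (k + 2) 0 = (pIdle lam a + pSwap lam a) * x (k + 2) 0 +
    pDown lam a * x (k + 2) 1 + pUp lam a * x (k + 1) 1 + pSwap lam a * x (k + 1) 2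
  vertical : ∀ l, x 0 (l + 3) = ((1 - lam) * (1 - a) + pSwap lam a) * x 0 (l + 3) +
    (1 - lam) * a * x 0 (l + 4) + pDown lam a * x 1 (l + 2)
  origin : OriginEquations lam a x (x 0 0) (x 0 1) (x 0 2)

theorem IsBalanced.hasSum {lam a : ℝ} {x : ℕ → ℕ → ℝ} (h : IsBalanced lam a x) (y : ℕ × ℕ)
    (hy : y ≠ (1, 0)) :
    HasSum (fun s : ℕ × ℕ => x s.1 s.2 * foldProb lam a s y) (x y.1 y.2) := by
  -- Each state has finitely many predecessors; `F` lists them, and the inflow is a finite sum.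
  have key : ∀ (F : Finset (ℕ × ℕ)) (v : ℝ), (∀ s ∉ F, foldProb lam a s y = 0) →
      ∑ s ∈ F, x s.1 s.2 * foldProb lam a s y = v →
      HasSum (fun s : ℕ × ℕ => x s.1 s.2 * foldProb lam a s y) v := fun F v h0 hv =>
    hv ▸ hasSum_sum_of_ne_finset_zero fun s hs => by rw [h0 s hs, mul_zero]
  obtain ⟨o2, o1, o0⟩ := h.origin
  rcases y with ⟨_ | k, _ | _ | _ | l⟩
  · refine key {(0, 0), (0, 1)} _ ?_ ?_
    · rintro ⟨_ | m, _ | _ | n⟩ hs <;> simp [foldProb, foldStep] at hs ⊢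
    · simp [foldProb, foldStep]; linarith [o0]
  · refine key {(0, 1), (0, 2), (1, 0), (0, 0)} _ ?_ ?_
    · rintro ⟨_ | m, _ | _ | n⟩ hs <;> simp [foldProb, foldStep, Pi.single_apply] at hs ⊢ <;>
        try (intros; omega)
    · simp [foldProb, foldStep, Pi.single_apply]; simp only [pDown, pSwap]; linarith [o1]
  · refine key {(0, 2), (0, 3), (1, 1), (1, 0)} _ ?_ ?_
    · rintro ⟨_ | m, _ | _ | n⟩ hs <;> simp [foldProb, foldStep, Pi.single_apply] at hs ⊢ <;>
        try first | (split_ifs <;> first | omega | norm_num) | (intros; omega)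
    · simp [foldProb, foldStep, Pi.single_apply]; simp only [pDown, pSwap]; linarith [o2]
  · refine key {(0, l + 3), (0, l + 4), (1, l + 2)} _ ?_ ?_
    · rintro ⟨_ | m, _ | _ | n⟩ hs <;> simp [foldProb, foldStep, Pi.single_apply] at hs ⊢ <;>
        try first | (split_ifs <;> first | omega | norm_num) | (intros; omega)
    · simp [foldProb, foldStep, Pi.single_apply]; linarith [h.vertical l]
  · rcases k with _ | k
    · exact absurd rfl hy
    refine key {(k + 2, 0), (k + 2, 1), (k + 1, 1), (k + 1, 2)} _ ?_ ?_
    · rintro ⟨_ | m, _ | _ | n⟩ hs <;> simp [foldProb, foldStep, Pi.single_apply] at hs ⊢ <;>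
        try first | (split_ifs <;> first | omega | norm_num) | (intros; omega)
    · simp [foldProb, foldStep, Pi.single_apply]; linarith [h.zero k]
  · refine key {(k + 1, 1), (k + 1, 2), (k + 2, 0), (k, 2), (k + 1, 0), (k, 3)} _ ?_ ?_
    · rintro ⟨_ | m, _ | _ | n⟩ hs <;> simp [foldProb, foldStep, Pi.single_apply] at hs ⊢ <;>
        try first | (split_ifs <;> first | omega | norm_num) | (intros; omega)
    -- Predecessors with minimum `k` fall under the boundary clauses of `foldStep` when `k = 0`.
    · rcases k with _ | k
      · simp [foldProb, foldStep, Pi.single_apply]; linarith [h.one 0]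
      · simp [foldProb, foldStep, Pi.single_apply]; linarith [h.one (k + 1)]
  · refine key {(k + 1, 2), (k + 2, 1), (k + 1, 3), (k, 3), (k, 4), (k + 2, 0)} _ ?_ ?_
    · rintro ⟨_ | m, _ | _ | n⟩ hs <;> simp [foldProb, foldStep, Pi.single_apply] at hs ⊢ <;>
        try first | (split_ifs <;> first | omega | norm_num) | (intros; omega)
    · rcases k with _ | k
      · simp [foldProb, foldStep, Pi.single_apply]; linarith [h.two 0]
      · simp [foldProb, foldStep, Pi.single_apply]; linarith [h.two (k + 1)]
  · refine key {(k + 1, l + 3), (k + 2, l + 2), (k + 1, l + 4), (k, l + 4), (k, l + 5)} _ ?_ ?_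
    · rintro ⟨_ | m, _ | _ | n⟩ hs <;> simp [foldProb, foldStep, Pi.single_apply] at hs ⊢ <;>
        try (split_ifs <;> first | omega | norm_num)
    · rcases k with _ | k
      · simp [foldProb, foldStep, Pi.single_apply]; linarith [h.interior 0 l]
      · simp [foldProb, foldStep, Pi.single_apply]; linarith [h.interior (k + 1) l]

/-! ### The law of the queue length process -/

theorem hasSum_measureReal_inter_preimage {Ω ι : Type*} [MeasurableSpace Ω] [Countable ι]
    [MeasurableSpace ι] [MeasurableSingletonClass ι] (P : Measure Ω) [IsFiniteMeasure P]
    {X : Ω → ι} (hX : Measurable X) {A : Set Ω} (hA : MeasurableSet A) :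
    HasSum (fun i => P.real (A ∩ X ⁻¹' {i})) (P.real A) := by
  have h1 : P A = ∑' i, P (A ∩ X ⁻¹' {i}) := by
    rw [← measure_iUnion]
    · rw [← Set.inter_iUnion, ← Set.preimage_iUnion, Set.iUnion_of_singleton, Set.preimage_univ,
        Set.inter_univ]
    · intro i j hij
      refine Set.disjoint_left.2 fun ω hi hj => hij ?_
      rw [← hi.2, ← hj.2]
    · exact fun i => hA.inter (hX (measurableSet_singleton i))
  have h2 := ENNReal.hasSum_toReal (f := fun i => P (A ∩ X ⁻¹' {i})) (h1 ▸ measure_ne_top P A)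
  rw [← ENNReal.tsum_toReal_eq fun i => measure_ne_top P _, ← h1] at h2
  exact h2

theorem slotMean_one (lam a : ℝ) (s : ℕ × ℕ) : slotMean lam a (fun _ => 1) s = 1 := by
  have := slotMean_foldState lam a (fun _ => 1) s
  rwa [foldStep_one] at this

theorem transProb_isStochastic {lam a : ℝ} (hlam₀ : 0 < lam) (hlam₁ : lam < 1) (ha₀ : 0 < a)
    (ha₁ : a < 1) : MarkovMatrix.IsStochastic (transProb lam a) where
  nonneg s s' := by
    have hr : ∀ i j, 0 ≤ routeProb i j := fun i j => by
      unfold routeProb; split_ifs <;> norm_num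
    have h1 : ∀ r, 0 ≤ arrivalProb lam s r := fun r => by
      have := hr s.1 s.2
      have := hr s.2 s.1
      fin_cases r <;> simp [arrivalProb] <;> first | positivity | linarith
    have h2 : ∀ t, 0 ≤ attemptProb a t := fun t => by
      unfold attemptProb; split_ifs <;> linarith
    refine Finset.sum_nonneg fun r _ => Finset.sum_nonneg fun t₁ _ => Finset.sum_nonneg fun t₂ _ => ?_
    split_ifs
    · exact mul_nonneg (mul_nonneg (h1 r) (h2 t₁)) (h2 t₂)
    · exact le_rfl
  hasSum_one s := by simpa [slotMean_one] using hasSum_transProb_mul lam a (fun _ => 1) s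

theorem avg_transProb (lam a : ℝ) : MarkovMatrix.avg (transProb lam a) = slotMean lam a := by
  funext f s
  exact (hasSum_transProb_mul lam a f s).tsum_eq

section Chain

variable {lam a : ℝ} {Ω : Type*} [MeasurableSpace Ω] {P : Measure Ω} [IsProbabilityMeasure P]
  {Q : ℕ → Ω → ℕ × ℕ}

/-- The Markov property is stated for complete histories; summing over the countably many histories
up to time `n` gives the two-time law. -/
theorem IsQueueChain.measureReal_pair (hQ : IsQueueChain lam a P Q) (n : ℕ) (s s' : ℕ × ℕ) :
    P.real (Q (n + 1) ⁻¹' {s'} ∩ Q n ⁻¹' {s}) = P.real (Q n ⁻¹' {s}) * transProb lam a s s' := by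
  set X : Ω → Fin (n + 1) → ℕ × ℕ := fun ω m => Q m ω with hX
  have hXm : Measurable X := measurable_pi_lambda _ fun m => hQ.measurable m
  have hs : ∀ (m : ℕ) (t : ℕ × ℕ), MeasurableSet (Q m ⁻¹' {t}) := fun m t =>
    hQ.measurable m (measurableSet_singleton t)
  have h1 := hasSum_measureReal_inter_preimage P hXm ((hs (n + 1) s').inter (hs n s))
  have h2 := (hasSum_measureReal_inter_preimage P hXm (hs n s)).mul_right (transProb lam a s s')
  suffices e : ∀ h, P.real (Q (n + 1) ⁻¹' {s'} ∩ Q n ⁻¹' {s} ∩ X ⁻¹' {h}) =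
      P.real (Q n ⁻¹' {s} ∩ X ⁻¹' {h}) * transProb lam a s s' by
    simp only [e] at h1
    exact h1.unique h2
  intro h
  -- The values beyond time `n` are arbitrary, since the Markov property reads the history only up
  -- to `n`.
  set h' : ℕ → ℕ × ℕ := fun m => if hm : m < n + 1 then h ⟨m, hm⟩ else 0 with hh'
  have hset : X ⁻¹' {h} = {ω | ∀ m ≤ n, Q m ω = h' m} := by
    ext ω
    simp only [Set.mem_preimage, Set.mem_singleton_iff, Set.mem_ofPred_eq, hX, hh', funext_iff]
    constructor
    · intro H m hm
      rw [dif_pos (Nat.lt_succ_of_le hm)]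
      exact H ⟨m, _⟩
    · intro H m
      have := H m (Nat.lt_succ_iff.1 m.2)
      rwa [dif_pos m.2] at this
  by_cases hn : h' n = s
  · have e1 : Q (n + 1) ⁻¹' {s'} ∩ Q n ⁻¹' {s} ∩ X ⁻¹' {h} =
        {ω | (∀ m ≤ n, Q m ω = h' m) ∧ Q (n + 1) ω = s'} := by
      rw [hset]
      ext ω
      simp only [Set.mem_inter_iff, Set.mem_preimage, Set.mem_singleton_iff, Set.mem_ofPred_eq]
      exact ⟨fun H => ⟨H.2, H.1.1⟩, fun H => ⟨⟨H.2, (H.1 n le_rfl).trans hn⟩, H.1⟩⟩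
    have e2 : Q n ⁻¹' {s} ∩ X ⁻¹' {h} = {ω | ∀ m ≤ n, Q m ω = h' m} := by
      rw [hset]
      ext ω
      simp only [Set.mem_inter_iff, Set.mem_preimage, Set.mem_singleton_iff, Set.mem_ofPred_eq]
      exact ⟨fun H => H.2, fun H => ⟨(H n le_rfl).trans hn, H⟩⟩
    rw [e1, e2, hQ.markov n h' s', hn]
  · have e2 : Q n ⁻¹' {s} ∩ X ⁻¹' {h} = ∅ := by
      rw [hset, Set.eq_empty_iff_forall_notMem]
      rintro ω ⟨H1, H2⟩
      exact hn ((H2 n le_rfl).symm.trans H1)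
    rw [Set.inter_assoc, e2, Set.inter_empty, measureReal_empty, zero_mul]

theorem IsQueueChain.hasSum_prob_succ (hQ : IsQueueChain lam a P Q) (n : ℕ) (s' : ℕ × ℕ) :
    HasSum (fun s => P.real (Q n ⁻¹' {s}) * transProb lam a s s') (P.real (Q (n + 1) ⁻¹' {s'})) := by
  have := hasSum_measureReal_inter_preimage P (hQ.measurable n)
    (hQ.measurable (n + 1) (measurableSet_singleton s'))
  simpa only [hQ.measureReal_pair] using this

theorem IsQueueChain.hasSum_prob (hQ : IsQueueChain lam a P Q) (n : ℕ) :
    HasSum (fun s => P.real (Q n ⁻¹' {s})) 1 := by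
  simpa using hasSum_measureReal_inter_preimage P (hQ.measurable n) MeasurableSet.univ

/-- Duality moves the time evolution from the law to the function, and lumpability keeps the
function dependent on the folded state only. -/
theorem IsQueueChain.tsum_foldState (hQ : IsQueueChain lam a P Q) (hlam₀ : 0 < lam)
    (hlam₁ : lam < 1) (ha₀ : 0 < a) (ha₁ : a < 1) (n : ℕ) {g : ℕ × ℕ → ℝ} {C : ℝ}
    (hg : ∀ s, |g s| ≤ C) :
    ∑' s, P.real (Q n ⁻¹' {s}) * g (foldState s) =
      ∑' s, P.real (Q 0 ⁻¹' {s}) * (foldStep lam a)^[n] g (foldState s) := by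
  induction n generalizing g with
  | zero => rfl
  | succ n ih =>
    have hst := transProb_isStochastic hlam₀ hlam₁ ha₀ ha₁
    have hb := (foldProb_isStochastic hlam₀ hlam₁ ha₀ ha₁).abs_avg_le hg
    rw [avg_foldProb] at hb
    have h1 := hst.tsum_mul_avg (x := fun s => P.real (Q n ⁻¹' {s}))
      (f := fun s => g (foldState s)) (hQ.hasSum_prob n).summable.abs (fun s => hg _)
    rw [avg_transProb] at h1
    simp only [slotMean_foldState, (hQ.hasSum_prob_succ n _).tsum_eq] at h1
    rw [← h1, ih hb, Function.iterate_succ_apply]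

/-- The iterates converge from each starting state; dominated convergence integrates this over an
arbitrary initial law. -/
theorem IsQueueChain.tendsto_fold (hQ : IsQueueChain lam a P Q) (hlam₀ : 0 < lam)
    (hlam₁ : lam < 1) (ha₀ : 0 < a) (ha₁ : a < 1) {π : ℕ × ℕ → ℝ}
    (hinv : MarkovMatrix.IsInvariant (foldProb lam a) π) (hpos : ∀ s, 0 < π s) (hsum : HasSum π 1)
    (y : ℕ × ℕ) :
    Tendsto (fun n => ∑' s, P.real (Q n ⁻¹' {s}) * (Pi.single y 1 : ℕ × ℕ → ℝ) (foldState s)) atTop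
      (𝓝 (π y)) := by
  set g : ℕ × ℕ → ℝ := Pi.single y 1 with hg
  have hst := foldProb_isStochastic hlam₀ hlam₁ ha₀ ha₁
  have hgb : ∀ s, |g s| ≤ 1 := fun s => by
    rw [hg, Pi.single_apply]; split_ifs <;> simp
  have hlim := hinv.tendsto_iterate_avg hst (foldProb_isIrreducible hlam₀ hlam₁ ha₀ ha₁)
    (foldProb_self_pos hlam₀ hlam₁ ha₀ ha₁) hpos hsum hgb
  have hb := hst.abs_iterate_avg_le hgb
  rw [avg_foldProb] at hlim hb
  rw [tsum_eq_single y fun s hs => by rw [hg, Pi.single_eq_of_ne hs, mul_zero]] at hlim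
  simp only [hg, Pi.single_eq_same, mul_one] at hlim
  simp only [fun n => hQ.tsum_foldState hlam₀ hlam₁ ha₀ ha₁ n hgb]
  have h1 : ∑' s, P.real (Q 0 ⁻¹' {s}) * π y = π y := by
    rw [tsum_mul_right, (hQ.hasSum_prob 0).tsum_eq, one_mul]
  rw [← h1]
  refine tendsto_tsum_of_dominated_convergence (hQ.hasSum_prob 0).summable
    (fun s => (hlim (foldState s)).const_mul _) ?_
  refine Filter.Eventually.of_forall fun n s => ?_
  rw [Real.norm_eq_abs, abs_mul, abs_of_nonneg measureReal_nonneg]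
  exact mul_le_of_le_one_right measureReal_nonneg (hb n _)

theorem IsQueueChain.measureReal_fold (hQ : IsQueueChain lam a P Q) (n k l : ℕ) :
    P.real {ω | min (Q n ω).1 (Q n ω).2 = k ∧ |((Q n ω).1 : ℤ) - ((Q n ω).2 : ℤ)| = (l : ℤ)} =
      ∑' s, P.real (Q n ⁻¹' {s}) * (Pi.single (k, l) 1 : ℕ × ℕ → ℝ) (foldState s) := by
  have hset : {ω | min (Q n ω).1 (Q n ω).2 = k ∧ |((Q n ω).1 : ℤ) - ((Q n ω).2 : ℤ)| = (l : ℤ)} =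
      Q n ⁻¹' (foldState ⁻¹' {(k, l)}) := by
    ext ω
    simp only [Set.mem_ofPred_eq, Set.mem_preimage, Set.mem_singleton_iff, foldState, Prod.mk.injEq]
    rw [Int.abs_eq_natAbs]
    omega
  have hA : MeasurableSet (Q n ⁻¹' (foldState ⁻¹' {(k, l)})) :=
    hQ.measurable n (Set.to_countable _).measurableSet
  rw [hset, ← (hasSum_measureReal_inter_preimage P (hQ.measurable n) hA).tsum_eq]
  refine tsum_congr fun s => ?_
  rw [← Set.preimage_inter]
  by_cases hs : foldState s = (k, l)
  · rw [hs, Pi.single_eq_same, mul_one, Set.inter_eq_right.2]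
    rintro _ rfl
    exact hs
  · rw [Pi.single_eq_of_ne hs, mul_zero, Set.inter_singleton_eq_empty.2 (by exact hs),
      Set.preimage_empty, measureReal_empty]

end Chain

/-- A summable solution of the balance equations which is positive somewhere is, after
normalisation, the equilibrium. -/
theorem IsBalanced.exists_isEquilibrium {lam a : ℝ} (hlam₀ : 0 < lam) (hlam₁ : lam < 1) (ha₀ : 0 < a)
    (ha₁ : a < 1) {x : ℕ → ℕ → ℝ} (h : IsBalanced lam a x)
    (hx : Summable fun s : ℕ × ℕ => |x s.1 s.2|) {k₀ l₀ : ℕ} (h0 : 0 < x k₀ l₀) :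
    ∃ c : ℝ, 0 < c ∧ IsEquilibrium lam a fun k l => c * x k l := by
  have hst := foldProb_isStochastic hlam₀ hlam₁ ha₀ ha₁
  have hinv := hst.isInvariant_of_ne hx (1, 0) h.hasSum
  obtain ⟨π, c, hc, hπ, hpos, hsum, hπinv⟩ := hinv.normalize hst
    (foldProb_isIrreducible hlam₀ hlam₁ ha₀ ha₁) (foldProb_self_pos hlam₀ hlam₁ ha₀ ha₁) hx
    (s₀ := (k₀, l₀)) h0
  refine ⟨c, hc, ?_, ?_⟩
  · simpa only [← hπ] using hsum
  · intro Ω _ P _ Q hQ k l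
    simp only [hQ.measureReal_fold]
    have := hQ.tendsto_fold hlam₀ hlam₁ ha₀ ha₁ hπinv hpos hsum (k, l)
    rwa [hπ] at this

/-! ### The kernel curve

With `γ = y δ` the kernel equation reads `q y² - (p + r + 2q - q δ) y + p + r δ = 0`. -/

section Curve

variable {p q r : ℝ}

/-- The discriminant of the kernel equation as a quadratic equation for `γ / δ`. -/
def ratioDiscr (p q r δ : ℝ) : ℝ := (p + r + 2 * q - q * δ) ^ 2 - 4 * q * (p + r * δ)

/-- The smaller root `γ / δ`. -/
def ratioLow (p q r δ : ℝ) : ℝ := (p + r + 2 * q - q * δ - √(ratioDiscr p q r δ)) / (2 * q)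

/-- The larger root `γ / δ`. -/
def ratioHigh (p q r δ : ℝ) : ℝ := (p + r + 2 * q - q * δ + √(ratioDiscr p q r δ)) / (2 * q)

theorem ratioDiscr_pos (hq : 0 < q) (hr : 0 < r) {δ : ℝ} (hδ : δ < 1) : 0 < ratioDiscr p q r δ := by
  have h : ratioDiscr p q r δ = (p + r - q * δ) ^ 2 + 4 * q * (q + r) * (1 - δ) := by
    unfold ratioDiscr; ring
  have : 0 < 1 - δ := sub_pos.2 hδ
  rw [h]
  positivity

theorem ratio_add (hq : 0 < q) (δ : ℝ) :
    q * (ratioLow p q r δ + ratioHigh p q r δ) = p + r + 2 * q - q * δ := by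
  unfold ratioLow ratioHigh; field_simp; ring

theorem ratio_mul (hq : 0 < q) (hr : 0 < r) {δ : ℝ} (hδ : δ < 1) :
    q * (ratioLow p q r δ * ratioHigh p q r δ) = p + r * δ := by
  have h := Real.sq_sqrt (ratioDiscr_pos (p := p) hq hr hδ).le
  unfold ratioLow ratioHigh
  generalize √(ratioDiscr p q r δ) = s at *
  unfold ratioDiscr at h
  field_simp
  linear_combination -h

/-- The value of the quadratic at `1` is `q (1 - y) (1 - y') = -(q + r) (1 - δ) < 0`, so `1`
separates its roots. -/
theorem ratioLow_lt_one (hq : 0 < q) (hr : 0 < r) {δ : ℝ} (hδ : δ < 1) :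
    ratioLow p q r δ < 1 ∧ 1 < ratioHigh p q r δ := by
  have h1 := ratio_add (p := p) (r := r) hq δ
  have h2 := ratio_mul (p := p) hq hr hδ
  have hle : ratioLow p q r δ ≤ ratioHigh p q r δ := by
    unfold ratioLow ratioHigh
    have := Real.sqrt_nonneg (ratioDiscr p q r δ)
    gcongr
    linarith
  have h3 : (1 - ratioLow p q r δ) * (1 - ratioHigh p q r δ) < 0 := by
    have : q * ((1 - ratioLow p q r δ) * (1 - ratioHigh p q r δ)) = -((q + r) * (1 - δ)) := by
      linear_combination h2 - h1
    have h4 : 0 < (q + r) * (1 - δ) := mul_pos (by positivity) (sub_pos.2 hδ)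
    by_contra hneg
    have := mul_nonneg hq.le (not_lt.1 hneg)
    linarith
  rcases mul_neg_iff.1 h3 with h | h
  · constructor <;> linarith [h.1, h.2]
  · linarith [h.1, h.2]

theorem ratioLow_pos (hp : 0 < p) (hq : 0 < q) (hr : 0 < r) {δ : ℝ} (hδ₀ : 0 ≤ δ) (hδ : δ < 1) :
    0 < ratioLow p q r δ := by
  have h2 := ratio_mul (p := p) hq hr hδ
  have h3 : 0 < ratioLow p q r δ * ratioHigh p q r δ :=
    pos_of_mul_pos_right (h2 ▸ by positivity) hq.le
  exact pos_of_mul_pos_left h3 (by linarith [(ratioLow_lt_one (p := p) hq hr hδ).2])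

theorem continuous_ratioLow : Continuous (ratioLow p q r) := by
  unfold ratioLow ratioDiscr; fun_prop

theorem continuous_ratioHigh : Continuous (ratioHigh p q r) := by
  unfold ratioHigh ratioDiscr; fun_prop

theorem quadratic_ratioLow (hq : 0 < q) (hr : 0 < r) {δ : ℝ} (hδ : δ < 1) :
    q * ratioLow p q r δ ^ 2 - (p + r + 2 * q - q * δ) * ratioLow p q r δ + (p + r * δ) = 0 := by
  linear_combination ratioLow p q r δ * ratio_add (p := p) (r := r) hq δ -
    ratio_mul (p := p) hq hr hδ

theorem quadratic_ratioHigh (hq : 0 < q) (hr : 0 < r) {δ : ℝ} (hδ : δ < 1) :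
    q * ratioHigh p q r δ ^ 2 - (p + r + 2 * q - q * δ) * ratioHigh p q r δ + (p + r * δ) = 0 := by
  linear_combination ratioHigh p q r δ * ratio_add (p := p) (r := r) hq δ -
    ratio_mul (p := p) hq hr hδ

/-- The kernel equation as a quadratic equation for `γ`. -/
theorem kernel_gamma_iff (hp : 0 < p) (hq : 0 < q) (hr : 0 < r) {δ : ℝ} (hδ₀ : 0 < δ) (hδ : δ < 1)
    (z : ℂ) :
    (0 < ‖z‖ ∧ ‖z‖ < ‖δ‖ ∧
      ((p : ℂ) + r + 2 * q) * z * δ = (q * z + p) * δ ^ 2 + r * δ ^ 3 + q * z ^ 2) ↔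
      z = ((ratioLow p q r δ * δ : ℝ) : ℂ) := by
  have h1 := ratio_add (p := p) (r := r) hq δ
  have h2 := ratio_mul (p := p) hq hr hδ
  obtain ⟨h3, h4⟩ := ratioLow_lt_one (p := p) hq hr hδ
  have h5 := ratioLow_pos hp hq hr hδ₀.le hδ
  set y := ratioLow p q r δ
  set y' := ratioHigh p q r δ
  have h1' : (q : ℂ) * (y + y') = p + r + 2 * q - q * δ := by exact_mod_cast congrArg Complex.ofReal h1
  have h2' : (q : ℂ) * (y * y') = p + r * δ := by exact_mod_cast congrArg Complex.ofReal h2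
  have hq' : (q : ℂ) ≠ 0 := by exact_mod_cast hq.ne'
  have hfac : ((p : ℂ) + r + 2 * q) * z * δ = (q * z + p) * δ ^ 2 + r * δ ^ 3 + q * z ^ 2 ↔
      (z - y * δ) * (z - y' * δ) = 0 := by
    rw [← mul_eq_zero_iff_left hq', ← sub_eq_zero, ← neg_eq_zero]
    refine Eq.congr ?_ rfl
    linear_combination z * δ * h1' - δ ^ 2 * h2'
  rw [hfac, mul_eq_zero, sub_eq_zero, sub_eq_zero, Real.norm_eq_abs, abs_of_pos hδ₀]
  constructor
  · rintro ⟨-, hz, rfl | rfl⟩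
    · push_cast; rfl
    · exfalso
      rw [← Complex.ofReal_mul, Complex.norm_real, Real.norm_eq_abs,
        abs_of_pos (mul_pos (by linarith) hδ₀)] at hz
      nlinarith
  · rintro rfl
    rw [Complex.norm_real, Real.norm_eq_abs, abs_of_pos (mul_pos h5 hδ₀)]
    exact ⟨mul_pos h5 hδ₀, by nlinarith, .inl (by push_cast; rfl)⟩

/-- For `0 < γ < 1` the kernel equation has exactly one root `δ` in the punctured disc of radius
`γ`, and it is positive. -/
theorem exists_kernel_delta_iff (hp : 0 < p) (hq : 0 < q) (hr : 0 < r) {γ : ℝ} (hγ₀ : 0 < γ)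
    (hγ : γ < 1) : ∃ δ : ℝ, 0 < δ ∧ δ < γ ∧ ∀ z : ℂ, (0 < ‖z‖ ∧ ‖z‖ < ‖γ‖ ∧
      ((p : ℂ) + r + 2 * q) * γ * z = (q * γ + p) * z ^ 2 + r * z ^ 3 + q * γ ^ 2) ↔
      z = ((δ : ℝ) : ℂ) := by
  set N := p + q * γ with hN
  set K := (p + r + 2 * q) * γ with hK
  -- The signs `f (-L) < 0 < f (-γ)` and `f 0 > 0 > f γ`, with `f` positive again far to the right,
  -- locate three real roots of the cubic, of which only `x₁` lies in the open disc of radius `γ`.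
  set f : ℝ → ℝ := fun x => r * x ^ 3 + N * x ^ 2 - K * x + q * γ ^ 2 with hf
  have hN0 : 0 < N := by positivity
  have hK0 : 0 < K := by positivity
  have hcont : Continuous f := by fun_prop
  have f0 : 0 < f 0 := by simp only [hf]; ring_nf; positivity
  have fγ : f γ < 0 := by
    have : f γ = -(γ ^ 2 * ((q + r) * (1 - γ))) := by simp only [hf, hN, hK]; ring
    rw [this, neg_lt_zero]
    have : 0 < 1 - γ := sub_pos.2 hγ
    positivity
  have fγ' : 0 < f (-γ) := by
    have : f (-γ) = γ ^ 2 * (r * (1 - γ) + (2 * p + q * γ + 3 * q)) := by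
      simp only [hf, hN, hK]; ring
    rw [this]
    have : 0 < 1 - γ := sub_pos.2 hγ
    positivity
  obtain ⟨x₁, ⟨h10, h11⟩, h1⟩ := intermediate_value_Ioo' hγ₀.le hcont.continuousOn ⟨fγ, f0⟩
  -- At this point the quadratic term exceeds the linear one, since `N B = K + N γ`.
  have hB : γ < K / N + γ := by have := div_pos hK0 hN0; linarith
  have fB : 0 < f (K / N + γ) := by
    set B := K / N + γ with hB'
    have hB0 : 0 < B := hγ₀.trans hB
    have e : N * B = K + N * γ := by rw [hB']; field_simp
    have : f B = r * B ^ 3 + N * γ * B + q * γ ^ 2 := by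
      simp only [hf]; linear_combination B * e
    rw [this]; positivity
  obtain ⟨x₂, ⟨h20, h21⟩, h2⟩ := intermediate_value_Ioo hB.le hcont.continuousOn ⟨fγ, fB⟩
  -- Chosen so that the cubic term outweighs all the others at `-L`.
  set L := (N + K + q * γ ^ 2) / r + 1 with hL
  have hL1 : 1 < L := by
    have : 0 < (N + K + q * γ ^ 2) / r := by positivity
    linarith
  have fL : f (-L) < 0 := by
    have e : r * L = N + K + q * γ ^ 2 + r := by rw [hL]; field_simp
    have : f (-L) = -(K * L * (L - 1) + q * γ ^ 2 * (L ^ 2 - 1) + r * L ^ 2) := by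
      simp only [hf]; linear_combination -L ^ 2 * e
    rw [this, neg_lt_zero]
    have h1 : 0 < L - 1 := sub_pos.2 hL1
    have h2 : 0 < L ^ 2 - 1 := by nlinarith
    have h3 : 0 < L := by linarith
    positivity
  obtain ⟨x₃, ⟨h30, h31⟩, h3⟩ := intermediate_value_Ioo (show -L ≤ -γ by linarith)
    hcont.continuousOn ⟨fL, fγ'⟩
  simp only [hf] at h1 h2 h3
  -- Divided differences at the three distinct roots replace Vieta's formulas and give the complex
  -- factorisation.
  have e12 : r * (x₁ ^ 2 + x₁ * x₂ + x₂ ^ 2) + N * (x₁ + x₂) - K = 0 := by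
    have : x₁ - x₂ ≠ 0 := by linarith
    apply mul_left_cancel₀ this
    linear_combination h1 - h2
  have e13 : r * (x₁ ^ 2 + x₁ * x₃ + x₃ ^ 2) + N * (x₁ + x₃) - K = 0 := by
    have : x₁ - x₃ ≠ 0 := by linarith
    apply mul_left_cancel₀ this
    linear_combination h1 - h3
  have s1 : r * (x₁ + x₂ + x₃) + N = 0 := by
    have : x₂ - x₃ ≠ 0 := by linarith
    apply mul_left_cancel₀ this
    linear_combination e12 - e13
  have s1' : (r : ℂ) * (x₁ + x₂ + x₃) + N = 0 := by exact_mod_cast congrArg Complex.ofReal s1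
  have e12' : (r : ℂ) * (x₁ ^ 2 + x₁ * x₂ + x₂ ^ 2) + N * (x₁ + x₂) - K = 0 := by
    exact_mod_cast congrArg Complex.ofReal e12
  have h1' : (r : ℂ) * x₁ ^ 3 + N * x₁ ^ 2 - K * x₁ + q * γ ^ 2 = 0 := by
    exact_mod_cast congrArg Complex.ofReal h1
  have hr' : (r : ℂ) ≠ 0 := by exact_mod_cast hr.ne'
  have hfac : ∀ z : ℂ, ((p : ℂ) + r + 2 * q) * γ * z = (q * γ + p) * z ^ 2 + r * z ^ 3 + q * γ ^ 2 ↔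
      (z - x₁) * ((z - x₂) * (z - x₃)) = 0 := fun z => by
    rw [← mul_eq_zero_iff_left hr', ← sub_eq_zero, ← neg_eq_zero]
    refine Eq.congr ?_ rfl
    have hNc : (N : ℂ) = p + q * γ := by rw [hN]; push_cast; rfl
    have hKc : (K : ℂ) = (p + r + 2 * q) * γ := by rw [hK]; push_cast; rfl
    rw [hNc] at s1' e12' h1'
    rw [hKc] at e12' h1'
    linear_combination (z - x₁) * (z - x₂) * s1' + (z - x₁) * e12' + h1'
  refine ⟨x₁, h10, h11, fun z => ?_⟩
  rw [hfac, mul_eq_zero, mul_eq_zero, sub_eq_zero, sub_eq_zero, sub_eq_zero, Real.norm_eq_abs,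
    abs_of_pos hγ₀]
  constructor
  · rintro ⟨-, hz, rfl | rfl | rfl⟩
    · rfl
    · rw [Complex.norm_real, Real.norm_eq_abs, abs_of_pos (hγ₀.trans h20)] at hz
      linarith
    · rw [Complex.norm_real, Real.norm_eq_abs, abs_of_neg (by linarith)] at hz
      linarith
  · rintro rfl
    rw [Complex.norm_real, Real.norm_eq_abs, abs_of_pos h10]
    exact ⟨h10, h11, .inl rfl⟩

/-! ### The sign of the solvability coefficient along the kernel curve. -/

/-- The coefficient of a term in the solvability condition of the horizontal boundary equations. -/
def horizCoef (p q r γ δ : ℝ) : ℝ :=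
  q * γ * (q * γ * (p + r + 2 * q) + r * (p + q * γ)) -
    (p + 2 * q * γ) * (q * (p + q * γ) + r * (p + r + 2 * q)) * δ -
    r * (q * (p + 2 * q * γ) + r * (p + 2 * q)) * δ ^ 2

/-- The kernel equation is linear in `δ`; eliminating `δ` leaves a rational function of `y` that
factors. The first quadratic factor is the one that reappears in `kernel_sub_sq`. -/
theorem horizCoef_eq (hq : 0 < q) (hr : 0 < r) {y δ : ℝ} (hy : 1 < y)
    (h : q * y ^ 2 - (p + r + 2 * q - q * δ) * y + (p + r * δ) = 0) :
    (2 * q) * horizCoef p q r (y * δ) δ =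
      -(δ * (2 * q ^ 2 * y ^ 2 - q * (p + 4 * q + 2 * r) * y - r * p) *
        (2 * q ^ 2 * y ^ 2 - q * (p + 4 * q + 2 * r) * y - r * p + (2 * q - p) * (q * y - r))) := by
  have hne : 0 < q * y + r := by positivity
  have hδ : δ = ((p + r + 2 * q) * y - p - q * y ^ 2) / (q * y + r) := by
    field_simp; linear_combination h
  rw [hδ]
  unfold horizCoef
  field_simp
  ring

/-- Since `p = 2 q ρ`, the left side is a positive multiple of `ρ ^ 2 - γ`. It thus controls the
sign of the common quadratic factor. -/
theorem kernel_sub_sq {y δ : ℝ}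
    (h : q * y ^ 2 - (p + r + 2 * q - q * δ) * y + (p + r * δ) = 0) :
    (q * y + r) * (p ^ 2 - 4 * q ^ 2 * (y * δ)) =
      (2 * q * y - p) * (2 * q ^ 2 * y ^ 2 - q * (p + 4 * q + 2 * r) * y - r * p) := by
  linear_combination -4 * q ^ 2 * y * h

theorem horizCoef_neg (hp : 0 < p) (hq : 0 < q) (hr : 0 < r) (hpq : p < 2 * q) {y δ : ℝ} (hy : 1 < y)
    (hδ : 0 < δ) (h : q * y ^ 2 - (p + r + 2 * q - q * δ) * y + (p + r * δ) = 0)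
    (hlt : 4 * q ^ 2 * (y * δ) < p ^ 2) : horizCoef p q r (y * δ) δ < 0 := by
  have h1 := horizCoef_eq hq hr hy h
  have h2 := kernel_sub_sq h
  set E := 2 * q ^ 2 * y ^ 2 - q * (p + 4 * q + 2 * r) * y - r * p with hE
  have hqy : q < q * y := by nlinarith
  -- Here `2 q y > 2 q > p`, so the other factor in `kernel_sub_sq` is positive.
  have hE0 : 0 < E := by
    have h3 : 0 < (2 * q * y - p) * E := by
      rw [← h2]
      exact mul_pos (by positivity) (by linarith)
    exact pos_of_mul_pos_right h3 (by linarith)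
  -- Positivity of `E` forces `2 q y > p + 4 q + 2 r`.
  have hry : 0 < q * y - r := by
    have : 0 < q * y * (2 * q * y - (p + 4 * q + 2 * r)) := by
      have := mul_pos hr hp
      have e : q * y * (2 * q * y - (p + 4 * q + 2 * r)) = E + r * p := by rw [hE]; ring
      rw [e]; positivity
    have := pos_of_mul_pos_right this (by positivity)
    linarith
  have h4 : 0 < δ * E * (E + (2 * q - p) * (q * y - r)) := by
    have : 0 < 2 * q - p := by linarith
    positivity
  by_contra hneg
  have := mul_nonneg (by positivity : (0 : ℝ) ≤ 2 * q) (not_lt.1 hneg)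
  linarith

theorem horizCoef_eq_zero (hq : 0 < q) (hr : 0 < r) (hpq : p < 2 * q) {y δ : ℝ}
    (hy : 1 < y) (h : q * y ^ 2 - (p + r + 2 * q - q * δ) * y + (p + r * δ) = 0)
    (heq : 4 * q ^ 2 * (y * δ) = p ^ 2) : horizCoef p q r (y * δ) δ = 0 := by
  have h1 := horizCoef_eq hq hr hy h
  have h2 := kernel_sub_sq h
  rw [heq, sub_self, mul_zero] at h2
  have h3 : 0 < 2 * q * y - p := by nlinarith
  rw [(mul_eq_zero.1 h2.symm).resolve_left h3.ne', mul_zero, zero_mul, neg_zero] at h1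
  exact (mul_eq_zero.1 h1).resolve_left (by positivity)

end Curve

/-! ### The model parameters and the vertical boundary error. -/

section Parameters

variable {lam a : ℝ}

theorem pUp_pos (hlam₀ : 0 < lam) (ha₀ : 0 < a) : 0 < pUp lam a := by
  unfold pUp; positivity

theorem pDown_pos (hlam₁ : lam < 1) (ha₀ : 0 < a) (ha₁ : a < 1) : 0 < pDown lam a := by
  have := sub_pos.2 hlam₁
  have := sub_pos.2 ha₁
  unfold pDown; positivity

theorem pSwap_pos (hlam₀ : 0 < lam) (ha₀ : 0 < a) (ha₁ : a < 1) : 0 < pSwap lam a := by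
  have := sub_pos.2 ha₁
  unfold pSwap; positivity

/-- The probability of leaving an interior state of the folded chain with difference at least two.
-/
theorem one_sub_pIdle_add_pSwap (lam a : ℝ) :
    1 - (pIdle lam a + pSwap lam a) = pUp lam a + pSwap lam a + 2 * pDown lam a := by
  unfold pIdle pUp pSwap pDown; ring

theorem load_eq (hlam₁ : lam < 1) (ha₀ : 0 < a) (ha₁ : a < 1) :
    load lam a * (2 * pDown lam a) = pUp lam a := by
  have := sub_pos.2 hlam₁
  have := sub_pos.2 ha₁
  unfold load pUp pDown
  field_simp

theorem load_pos (hlam₀ : 0 < lam) (hlam₁ : lam < 1) (ha₀ : 0 < a) (ha₁ : a < 1) :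
    0 < load lam a := by
  have := sub_pos.2 hlam₁
  have := sub_pos.2 ha₁
  unfold load
  positivity

theorem pUp_lt (hlam₁ : lam < 1) (ha₀ : 0 < a) (ha₁ : a < 1) (hload : load lam a < 1) :
    pUp lam a < 2 * pDown lam a := by
  have := pDown_pos hlam₁ ha₀ ha₁
  rw [← load_eq hlam₁ ha₀ ha₁]
  nlinarith

/-- The vertical boundary error of `γ = y δ`, divided by `δ`. -/
def vertRatio (lam a y δ : ℝ) : ℝ :=
  pUp lam a + pSwap lam a + (1 - lam) * a * (1 - δ) - pDown lam a * y

theorem vertErr_eq (lam a y δ : ℝ) : vertErr lam a (y * δ) δ = δ * vertRatio lam a y δ := by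
  unfold vertErr vertRatio pUp pSwap pDown; ring

/-- The error is `z - q y` with `z` common to both roots. If it were nonpositive at the smaller
root, it would be so at both: their product would be nonnegative and their sum nonpositive. The
explicit product and sum contradict this. -/
theorem vertRatio_ratioLow_pos (hlam₀ : 0 < lam) (hlam₁ : lam < 1) (ha₀ : 0 < a) (ha₁ : a < 1)
    {δ : ℝ} (hδ : δ < 1) :
    0 < vertRatio lam a (ratioLow (pUp lam a) (pDown lam a) (pSwap lam a) δ) δ := by
  have hq := pDown_pos hlam₁ ha₀ ha₁
  have hr := pSwap_pos hlam₀ ha₀ ha₁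
  have h1 := ratio_add (p := pUp lam a) (r := pSwap lam a) hq δ
  have h2 := ratio_mul (p := pUp lam a) hq hr hδ
  obtain ⟨h3, h4⟩ := ratioLow_lt_one (p := pUp lam a) hq hr hδ
  set y := ratioLow (pUp lam a) (pDown lam a) (pSwap lam a) δ
  set y' := ratioHigh (pUp lam a) (pDown lam a) (pSwap lam a) δ
  by_contra hneg
  unfold vertRatio at hneg
  set q := pDown lam a with hq'
  set z := pUp lam a + pSwap lam a + (1 - lam) * a * (1 - δ) with hz
  have hlt : q * y < q * y' := mul_lt_mul_of_pos_left (h3.trans h4) hq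
  have h5 : 0 ≤ (z - q * y) * (z - q * y') :=
    mul_nonneg_of_nonpos_of_nonpos (by linarith) (by linarith)
  have hl := sub_pos.2 hlam₁
  have hδ' := sub_pos.2 hδ
  have ha' := sub_pos.2 ha₁
  -- The product is a positive factor times an expression `F`, while the sum `h8` is a positive
  -- quantity plus `a F`. So `F ≥ 0` makes the sum positive.
  have h6 : (z - q * y) * (z - q * y') =
      (1 - lam) * a ^ 2 * (1 - δ) * (lam * a + (1 - lam) * (2 * a - 1 - a * δ)) := by
    have : (z - q * y) * (z - q * y') = z ^ 2 - z * (q * (y + y')) + q * (q * (y * y')) := by ring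
    rw [this, h1, h2, hz, hq']
    unfold pUp pSwap pDown
    ring
  rw [h6] at h5
  have h7 : 0 ≤ lam * a + (1 - lam) * (2 * a - 1 - a * δ) := nonneg_of_mul_nonneg_right h5 (by positivity)
  have h8 : 2 * z - q * (y + y') = lam * (1 - a) + (1 - lam) * a * (1 - δ) +
      a * (lam * a + (1 - lam) * (2 * a - 1 - a * δ)) := by
    rw [h1, hz, hq']
    unfold pUp pSwap pDown
    ring
  have h9 : 0 < lam * (1 - a) + (1 - lam) * a * (1 - δ) := by positivity
  have h10 := mul_nonneg ha₀.le h7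
  linarith

end Parameters

/-! ### The overdetermined system on the horizontal boundary. -/

section Horizontal

/-- The solution of the first and the third horizontal boundary equation. -/
def horizSol (p q r γ D₁ D₂ : ℝ) : Fin 2 → ℝ :=
  ![q * (r * D₂ + (p + q * γ) * D₁) / (q * γ * (p + r + 2 * q) + r * (p + q * γ)),
    (γ * (p + r + 2 * q) * q * D₁ - r ^ 2 * D₂) / (q * γ * (p + r + 2 * q) + r * (p + q * γ))]

/-- Here `Dⱼ` is the combined amplitude at exponent `j` of `δ`, `u` is the amplitude at difference
`0` and `w` that at difference `1`. The first and third equations have positive determinant;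
inserting their solution in the second, with `D₃` eliminated by the kernel, gives the solvability
condition. -/
theorem horizontal_scalar_iff {p q r γ : ℝ} (hp : 0 < p) (hq : 0 < q) (hr : 0 < r) (hγ : 0 < γ)
    (D₀ D₁ D₂ D₃ u w : ℝ)
    (h : (p + r + 2 * q) * γ * D₁ = (q * γ + p) * D₂ + r * D₃ + q * γ ^ 2 * D₀) :
    (γ * (p + r + 2 * q) * u - (p + q * γ) * w = r * D₂ ∧
      γ * (p + 2 * q) * w - γ * (p + 2 * q * γ) * u = (p + q * γ) * D₂ + r * D₃ ∧
      r * u + q * w = q * D₁) ↔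
      q * γ * (q * γ * (p + r + 2 * q) + r * (p + q * γ)) * D₀ -
          (p + 2 * q * γ) * (q * (p + q * γ) + r * (p + r + 2 * q)) * D₁ -
          r * (q * (p + 2 * q * γ) + r * (p + 2 * q)) * D₂ = 0 ∧
        u = q * (r * D₂ + (p + q * γ) * D₁) / (q * γ * (p + r + 2 * q) + r * (p + q * γ)) ∧
        w = (γ * (p + r + 2 * q) * q * D₁ - r ^ 2 * D₂) /
          (q * γ * (p + r + 2 * q) + r * (p + q * γ)) := by
  have hΔ : 0 < q * γ * (p + r + 2 * q) + r * (p + q * γ) := by positivity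
  rw [eq_div_iff hΔ.ne', eq_div_iff hΔ.ne']
  constructor
  · rintro ⟨h1, h2, h3⟩
    have hu : u * (q * γ * (p + r + 2 * q) + r * (p + q * γ)) =
        q * (r * D₂ + (p + q * γ) * D₁) := by
      linear_combination q * h1 + (p + q * γ) * h3
    have hw : w * (q * γ * (p + r + 2 * q) + r * (p + q * γ)) =
        γ * (p + r + 2 * q) * q * D₁ - r ^ 2 * D₂ := by
      linear_combination γ * (p + r + 2 * q) * h3 - r * h1
    refine ⟨?_, hu, hw⟩
    apply mul_left_cancel₀ hγ.ne'
    linear_combination (q * γ * (p + r + 2 * q) + r * (p + q * γ)) * (h2 - h) -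
      γ * (p + 2 * q) * hw + γ * (p + 2 * q * γ) * hu
  · rintro ⟨h0, hu, hw⟩
    refine ⟨?_, ?_, ?_⟩ <;> apply mul_left_cancel₀ hΔ.ne'
    · linear_combination γ * (p + r + 2 * q) * hu - (p + q * γ) * hw
    · linear_combination γ * h0 + γ * (p + 2 * q) * hw - γ * (p + 2 * q * γ) * hu +
        (q * γ * (p + r + 2 * q) + r * (p + q * γ)) * h
    · linear_combination r * hu + q * hw

theorem horizontal_iff {lam a : ℝ} (hlam₀ : 0 < lam) (hlam₁ : lam < 1) (ha₀ : 0 < a) (ha₁ : a < 1)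
    {γ δ δ' : ℝ} (hγ : 0 < γ) (c d : ℝ) (e : Fin 2 → ℝ)
    (h : (pUp lam a + pSwap lam a + 2 * pDown lam a) * γ * δ =
      (pDown lam a * γ + pUp lam a) * δ ^ 2 + pSwap lam a * δ ^ 3 + pDown lam a * γ ^ 2)
    (h' : (pUp lam a + pSwap lam a + 2 * pDown lam a) * γ * δ' =
      (pDown lam a * γ + pUp lam a) * δ' ^ 2 + pSwap lam a * δ' ^ 3 + pDown lam a * γ ^ 2) :
    ((matA lam a γ δ).mulVec e + (d * δ ^ 2) • vecB lam a γ δ = -((c * δ' ^ 2) • vecB lam a γ δ')) ↔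
      d * horizCoef (pUp lam a) (pDown lam a) (pSwap lam a) γ δ +
          c * horizCoef (pUp lam a) (pDown lam a) (pSwap lam a) γ δ' = 0 ∧
        ∀ l : Fin 2, e l * δ ^ (l : ℕ) = horizSol (pUp lam a) (pDown lam a) (pSwap lam a) γ
          (d * δ + c * δ') (d * δ ^ 2 + c * δ' ^ 2) l := by
  have hp := pUp_pos hlam₀ ha₀
  have hq := pDown_pos hlam₁ ha₀ ha₁
  have hr := pSwap_pos hlam₀ ha₀ ha₁
  have hM : 1 - pIdle lam a - pSwap lam a = pUp lam a + pSwap lam a + 2 * pDown lam a := by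
    rw [← one_sub_pIdle_add_pSwap]; ring
  have hM' : 1 - pIdle lam a - 2 * pSwap lam a = pUp lam a + 2 * pDown lam a := by
    linear_combination hM
  simp only [funext_iff, Fin.forall_fin_succ, matA, vecB, horizSol, hM, hM']
  simp [Matrix.vecHead, Matrix.vecTail]
  have key := horizontal_scalar_iff hp hq hr hγ (d + c) (d * δ + c * δ')
    (d * δ ^ 2 + c * δ' ^ 2) (d * δ ^ 3 + c * δ' ^ 3) (e 0) (e 1 * δ)
    (by linear_combination d * h + c * h')
  unfold horizCoef
  constructor
  · rintro ⟨h1, h2, h3⟩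
    -- By the kernel equation the last entry of `vecB` times `δ ^ 2` equals `-q γ ^ 2 δ`, so the
    -- third row is divisible by `γ ^ 2`.
    obtain ⟨k1, k2, k3⟩ := key.1 ⟨by linear_combination h1, by linear_combination h2, by
      apply mul_left_cancel₀ (pow_ne_zero 2 hγ.ne')
      linear_combination h3 + d * δ * h + c * δ' * h'⟩
    exact ⟨by linear_combination k1, k2, k3⟩
  · rintro ⟨k1, k2, k3⟩
    obtain ⟨h1, h2, h3⟩ := key.2 ⟨by linear_combination k1, k2, k3⟩
    exact ⟨by linear_combination h1, by linear_combination h2, by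
      linear_combination γ ^ 2 * h3 - d * δ * h - c * δ' * h'⟩

end Horizontal

/-! ### The explicit form of the recursion -/

section Recursion

variable {lam a : ℝ}

theorem kernel_iff (lam a : ℝ) (γ δ : ℂ) : Kernel lam a γ δ ↔
    ((pUp lam a : ℂ) + pSwap lam a + 2 * pDown lam a) * γ * δ =
      (pDown lam a * γ + pUp lam a) * δ ^ 2 + pSwap lam a * δ ^ 3 + pDown lam a * γ ^ 2 := by
  have h : (1 : ℂ) - ((pIdle lam a : ℂ) + (pSwap lam a : ℂ)) =
      (pUp lam a : ℂ) + pSwap lam a + 2 * pDown lam a := by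
    exact_mod_cast congrArg Complex.ofReal (one_sub_pIdle_add_pSwap lam a)
  rw [Kernel, h]

/-- The property which determines `δ i` in terms of `γ i`. -/
def IsDeltaRoot (lam a γ δ : ℝ) : Prop :=
  ∀ z : ℂ, (0 < ‖z‖ ∧ ‖z‖ < ‖γ‖ ∧ Kernel lam a (γ : ℂ) z) ↔ z = (δ : ℂ)

open Classical in
/-- The root `δ` of the kernel equation for `γ` with `0 < δ < γ`. -/
def deltaRoot (lam a γ : ℝ) : ℝ := if h : ∃ δ, IsDeltaRoot lam a γ δ then h.choose else 0

theorem IsDeltaRoot.unique {γ δ δ' : ℝ} (h : IsDeltaRoot lam a γ δ) (h' : IsDeltaRoot lam a γ δ') :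
    δ = δ' := by
  exact_mod_cast (h' δ).1 ((h δ).2 rfl)

theorem deltaRoot_spec (hlam₀ : 0 < lam) (hlam₁ : lam < 1) (ha₀ : 0 < a) (ha₁ : a < 1) {γ : ℝ}
    (hγ₀ : 0 < γ) (hγ : γ < 1) :
    0 < deltaRoot lam a γ ∧ deltaRoot lam a γ < γ ∧ IsDeltaRoot lam a γ (deltaRoot lam a γ) := by
  obtain ⟨δ, h1, h2, h3⟩ := exists_kernel_delta_iff (pUp_pos hlam₀ ha₀) (pDown_pos hlam₁ ha₀ ha₁)
    (pSwap_pos hlam₀ ha₀ ha₁) hγ₀ hγ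
  simp only [← kernel_iff] at h3
  have hex : ∃ δ, IsDeltaRoot lam a γ δ := ⟨δ, h3⟩
  have hspec : IsDeltaRoot lam a γ (deltaRoot lam a γ) := by
    rw [deltaRoot, dif_pos hex]; exact hex.choose_spec
  rw [hspec.unique h3]
  exact ⟨h1, h2, h3⟩

/-- The relations between the successive roots. -/
structure IsRootSeq (lam a : ℝ) (γ δ : ℕ → ℝ) : Prop where
  γ_zero : γ 0 = load lam a ^ 2
  δ_pos : ∀ i, 0 < δ i
  δ_lt : ∀ i, δ i < 1
  γ_high : ∀ i, γ i = ratioHigh (pUp lam a) (pDown lam a) (pSwap lam a) (δ i) * δ i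
  γ_low : ∀ i, γ (i + 1) = ratioLow (pUp lam a) (pDown lam a) (pSwap lam a) (δ i) * δ i

theorem eq_ratioHigh_mul {p q r γ δ : ℝ} (hq : 0 < q) (hr : 0 < r) (hδ₀ : 0 < δ) (hδ : δ < γ)
    (hγ : γ < 1)
    (h : (p + r + 2 * q) * γ * δ = (q * γ + p) * δ ^ 2 + r * δ ^ 3 + q * γ ^ 2) :
    γ = ratioHigh p q r δ * δ := by
  have h1 := ratio_add (p := p) (r := r) hq δ
  have h2 := ratio_mul (p := p) hq hr (hδ.trans hγ)
  obtain ⟨h3, h4⟩ := ratioLow_lt_one (p := p) hq hr (hδ.trans hγ)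
  have h5 : q * ((γ - ratioLow p q r δ * δ) * (γ - ratioHigh p q r δ * δ)) = 0 := by
    linear_combination -γ * δ * h1 + δ ^ 2 * h2 - h
  have h6 : γ - ratioLow p q r δ * δ ≠ 0 := by nlinarith
  exact sub_eq_zero.1 ((mul_eq_zero.1 ((mul_eq_zero.1 h5).resolve_left hq.ne')).resolve_left h6)

/-- The hypotheses are required only inside the unit interval, so both forms of the recursion supply
them; the induction shows that the roots never leave it. -/
theorem isRootSeq_of_explicit (hlam₀ : 0 < lam) (hlam₁ : lam < 1) (ha₀ : 0 < a) (ha₁ : a < 1)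
    (hload : load lam a < 1) {γ δ : ℕ → ℝ} (h0 : γ 0 = load lam a ^ 2)
    (hδ : ∀ i, 0 < γ i → γ i < 1 → δ i = deltaRoot lam a (γ i))
    (hγ : ∀ i, 0 < δ i → δ i < 1 →
      γ (i + 1) = ratioLow (pUp lam a) (pDown lam a) (pSwap lam a) (δ i) * δ i) :
    IsRootSeq lam a γ δ := by
  have hp := pUp_pos hlam₀ ha₀
  have hq := pDown_pos hlam₁ ha₀ ha₁
  have hr := pSwap_pos hlam₀ ha₀ ha₁
  have hstep : ∀ i, 0 < γ i → γ i < 1 → 0 < δ i ∧ δ i < γ i := fun i h1 h2 => by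
    have := deltaRoot_spec hlam₀ hlam₁ ha₀ ha₁ h1 h2
    rw [hδ i h1 h2]
    exact ⟨this.1, this.2.1⟩
  have hpos : ∀ i, 0 < γ i ∧ γ i < 1 := fun i => by
    induction i with
    | zero =>
      have := load_pos hlam₀ hlam₁ ha₀ ha₁
      rw [h0]
      exact ⟨by positivity, by nlinarith⟩
    | succ i ih =>
      obtain ⟨h1, h2⟩ := hstep i ih.1 ih.2
      have h3 := h2.trans ih.2
      rw [hγ i h1 h3]
      have h4 := ratioLow_pos hp hq hr h1.le h3
      have h5 := (ratioLow_lt_one (p := pUp lam a) hq hr h3).1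
      exact ⟨mul_pos h4 h1, by nlinarith⟩
  have hδ' : ∀ i, 0 < δ i ∧ δ i < γ i := fun i => hstep i (hpos i).1 (hpos i).2
  refine ⟨h0, fun i => (hδ' i).1, fun i => (hδ' i).2.trans (hpos i).2, fun i => ?_,
    fun i => hγ i (hδ' i).1 ((hδ' i).2.trans (hpos i).2)⟩
  refine eq_ratioHigh_mul hq hr (hδ' i).1 (hδ' i).2 (hpos i).2 ?_
  have h1 := (deltaRoot_spec hlam₀ hlam₁ ha₀ ha₁ (hpos i).1 (hpos i).2).2.2
  rw [← hδ i (hpos i).1 (hpos i).2] at h1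
  have h2 := (kernel_iff _ _ _ _).1 ((h1 (δ i)).2 rfl).2.2
  exact_mod_cast h2

namespace IsRootSeq

variable {γ δ : ℕ → ℝ}

theorem δ_lt_γ (h : IsRootSeq lam a γ δ) (hq : 0 < pDown lam a) (hr : 0 < pSwap lam a) (i : ℕ) :
    δ i < γ i := by
  have := (ratioLow_lt_one (p := pUp lam a) hq hr (h.δ_lt i)).2
  have := h.δ_pos i
  rw [h.γ_high]
  nlinarith

theorem γ_pos (h : IsRootSeq lam a γ δ) (hq : 0 < pDown lam a) (hr : 0 < pSwap lam a) (i : ℕ) :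
    0 < γ i :=
  (h.δ_pos i).trans (h.δ_lt_γ hq hr i)

theorem γ_succ_lt (h : IsRootSeq lam a γ δ) (hq : 0 < pDown lam a) (hr : 0 < pSwap lam a) (i : ℕ) :
    γ (i + 1) < δ i := by
  have := (ratioLow_lt_one (p := pUp lam a) hq hr (h.δ_lt i)).1
  have := h.δ_pos i
  rw [h.γ_low]
  nlinarith

theorem γ_strictAnti (h : IsRootSeq lam a γ δ) (hq : 0 < pDown lam a) (hr : 0 < pSwap lam a) :
    StrictAnti γ :=
  strictAnti_nat_of_succ_lt fun i => (h.γ_succ_lt hq hr i).trans (h.δ_lt_γ hq hr i)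

theorem kernel_high (h : IsRootSeq lam a γ δ) (hq : 0 < pDown lam a) (hr : 0 < pSwap lam a) (i : ℕ) :
    (pUp lam a + pSwap lam a + 2 * pDown lam a) * γ i * δ i =
      (pDown lam a * γ i + pUp lam a) * δ i ^ 2 + pSwap lam a * δ i ^ 3 +
        pDown lam a * γ i ^ 2 := by
  rw [h.γ_high]
  linear_combination -δ i ^ 2 * quadratic_ratioHigh (p := pUp lam a) hq hr (h.δ_lt i)

theorem kernel_low (h : IsRootSeq lam a γ δ) (hq : 0 < pDown lam a) (hr : 0 < pSwap lam a) (i : ℕ) :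
    (pUp lam a + pSwap lam a + 2 * pDown lam a) * γ (i + 1) * δ i =
      (pDown lam a * γ (i + 1) + pUp lam a) * δ i ^ 2 + pSwap lam a * δ i ^ 3 +
        pDown lam a * γ (i + 1) ^ 2 := by
  rw [h.γ_low]
  linear_combination -δ i ^ 2 * quadratic_ratioLow (p := pUp lam a) hq hr (h.δ_lt i)

theorem vertErr_low_pos (h : IsRootSeq lam a γ δ) (hlam₀ : 0 < lam) (hlam₁ : lam < 1) (ha₀ : 0 < a)
    (ha₁ : a < 1) (i : ℕ) : 0 < vertErr lam a (γ (i + 1)) (δ i) := by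
  rw [h.γ_low, vertErr_eq]
  exact mul_pos (h.δ_pos i) (vertRatio_ratioLow_pos hlam₀ hlam₁ ha₀ ha₁ (h.δ_lt i))

theorem four_mul_γ_zero (h : IsRootSeq lam a γ δ) (hlam₁ : lam < 1) (ha₀ : 0 < a) (ha₁ : a < 1) :
    4 * pDown lam a ^ 2 * γ 0 = pUp lam a ^ 2 := by
  rw [h.γ_zero, ← load_eq hlam₁ ha₀ ha₁]; ring

theorem horizCoef_zero (h : IsRootSeq lam a γ δ) (hlam₀ : 0 < lam) (hlam₁ : lam < 1) (ha₀ : 0 < a)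
    (ha₁ : a < 1) (hload : load lam a < 1) :
    horizCoef (pUp lam a) (pDown lam a) (pSwap lam a) (γ 0) (δ 0) = 0 := by
  have hq := pDown_pos hlam₁ ha₀ ha₁
  have hr := pSwap_pos hlam₀ ha₀ ha₁
  have h1 := h.four_mul_γ_zero hlam₁ ha₀ ha₁
  rw [h.γ_high] at h1 ⊢
  exact horizCoef_eq_zero hq hr (pUp_lt hlam₁ ha₀ ha₁ hload)
    (ratioLow_lt_one hq hr (h.δ_lt 0)).2 (quadratic_ratioHigh hq hr (h.δ_lt 0)) h1

theorem horizCoef_succ_neg (h : IsRootSeq lam a γ δ) (hlam₀ : 0 < lam) (hlam₁ : lam < 1)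
    (ha₀ : 0 < a) (ha₁ : a < 1) (hload : load lam a < 1) (i : ℕ) :
    horizCoef (pUp lam a) (pDown lam a) (pSwap lam a) (γ (i + 1)) (δ (i + 1)) < 0 := by
  have hq := pDown_pos hlam₁ ha₀ ha₁
  have hr := pSwap_pos hlam₀ ha₀ ha₁
  have h1 : 4 * pDown lam a ^ 2 * γ (i + 1) < pUp lam a ^ 2 := by
    rw [← h.four_mul_γ_zero hlam₁ ha₀ ha₁]
    exact mul_lt_mul_of_pos_left (h.γ_strictAnti hq hr (Nat.succ_pos i)) (by positivity)
  rw [h.γ_high] at h1 ⊢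
  exact horizCoef_neg (pUp_pos hlam₀ ha₀) hq hr (pUp_lt hlam₁ ha₀ ha₁ hload)
    (ratioLow_lt_one hq hr (h.δ_lt _)).2 (h.δ_pos _) (quadratic_ratioHigh hq hr (h.δ_lt _)) h1

end IsRootSeq

/-- The sum of the contributions of the terms with factor `γ i ^ k` at difference `l`. -/
def CompSeq.layer (S : CompSeq) (l i : ℕ) : ℝ := S.d i * S.δ i ^ l + S.c i * S.δ (i - 1) ^ l

/-- The recursion in explicit form. -/
structure CompSeq.IsExplicit (lam a : ℝ) (S : CompSeq) : Prop where
  γ_zero : S.γ 0 = load lam a ^ 2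
  δ_eq : ∀ i, S.δ i = deltaRoot lam a (S.γ i)
  γ_succ : ∀ i, S.γ (i + 1) = ratioLow (pUp lam a) (pDown lam a) (pSwap lam a) (S.δ i) * S.δ i
  c_zero : S.c 0 = 0
  d_zero : S.d 0 = 1
  c_succ : ∀ i, S.c (i + 1) =
    -(vertErr lam a (S.γ i) (S.δ i) / vertErr lam a (S.γ (i + 1)) (S.δ i)) * S.d i
  d_succ : ∀ i, S.d (i + 1) =
    -(horizCoef (pUp lam a) (pDown lam a) (pSwap lam a) (S.γ (i + 1)) (S.δ i) /
      horizCoef (pUp lam a) (pDown lam a) (pSwap lam a) (S.γ (i + 1)) (S.δ (i + 1))) * S.c (i + 1)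
  e_eq : ∀ l i, S.e l i = horizSol (pUp lam a) (pDown lam a) (pSwap lam a) (S.γ i) (S.layer 1 i)
    (S.layer 2 i) l / S.δ i ^ (l : ℕ)

theorem CompSeq.IsExplicit.isRootSeq {S : CompSeq} (h : S.IsExplicit lam a) (hlam₀ : 0 < lam)
    (hlam₁ : lam < 1) (ha₀ : 0 < a) (ha₁ : a < 1) (hload : load lam a < 1) :
    IsRootSeq lam a S.γ S.δ :=
  isRootSeq_of_explicit hlam₀ hlam₁ ha₀ ha₁ hload h.γ_zero (fun i _ _ => h.δ_eq i)
    fun i _ _ => h.γ_succ i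

theorem gammaRoot_iff (hlam₀ : 0 < lam) (hlam₁ : lam < 1) (ha₀ : 0 < a) (ha₁ : a < 1) {δ : ℝ}
    (hδ₀ : 0 < δ) (hδ : δ < 1) (z : ℂ) : (0 < ‖z‖ ∧ ‖z‖ < ‖δ‖ ∧ Kernel lam a z (δ : ℂ)) ↔
      z = ((ratioLow (pUp lam a) (pDown lam a) (pSwap lam a) δ * δ : ℝ) : ℂ) := by
  rw [kernel_iff]
  exact kernel_gamma_iff (pUp_pos hlam₀ ha₀) (pDown_pos hlam₁ ha₀ ha₁) (pSwap_pos hlam₀ ha₀ ha₁)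
    hδ₀ hδ z

theorem CompSeq.IsGenerated.isRootSeq {S : CompSeq} (h : S.IsGenerated lam a) (hlam₀ : 0 < lam)
    (hlam₁ : lam < 1) (ha₀ : 0 < a) (ha₁ : a < 1) (hload : load lam a < 1) :
    IsRootSeq lam a S.γ S.δ := by
  refine isRootSeq_of_explicit hlam₀ hlam₁ ha₀ ha₁ hload h.γ_zero (fun i h1 h2 => ?_)
    fun i h1 h2 => ?_
  · exact IsDeltaRoot.unique (h.δ_root i) (deltaRoot_spec hlam₀ hlam₁ ha₀ ha₁ h1 h2).2.2
  · have := (gammaRoot_iff hlam₀ hlam₁ ha₀ ha₁ h1 h2 _).1 ((h.γ_root i (S.γ (i + 1))).2 rfl)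
    exact_mod_cast this

/-- Both `δ i` and `δ (i + 1)` are kernel roots for `γ (i + 1)`, so the solvability criterion
applies; its coefficient of `d (i + 1)` is nonzero. -/
theorem CompSeq.horizontal_iff_explicit {S : CompSeq} (h : IsRootSeq lam a S.γ S.δ) (hlam₀ : 0 < lam)
    (hlam₁ : lam < 1) (ha₀ : 0 < a) (ha₁ : a < 1) (hload : load lam a < 1) (i : ℕ) :
    ((matA lam a (S.γ (i + 1)) (S.δ (i + 1))).mulVec (fun l => S.e l (i + 1)) +
      (S.d (i + 1) * S.δ (i + 1) ^ 2) • vecB lam a (S.γ (i + 1)) (S.δ (i + 1)) =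
      -((S.c (i + 1) * S.δ i ^ 2) • vecB lam a (S.γ (i + 1)) (S.δ i))) ↔
    S.d (i + 1) =
      -(horizCoef (pUp lam a) (pDown lam a) (pSwap lam a) (S.γ (i + 1)) (S.δ i) /
        horizCoef (pUp lam a) (pDown lam a) (pSwap lam a) (S.γ (i + 1)) (S.δ (i + 1))) *
          S.c (i + 1) ∧
    ∀ l, S.e l (i + 1) = horizSol (pUp lam a) (pDown lam a) (pSwap lam a) (S.γ (i + 1))
      (S.layer 1 (i + 1)) (S.layer 2 (i + 1)) l / S.δ (i + 1) ^ (l : ℕ) := by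
  have hq := pDown_pos hlam₁ ha₀ ha₁
  have hr := pSwap_pos hlam₀ ha₀ ha₁
  rw [horizontal_iff hlam₀ hlam₁ ha₀ ha₁ (h.γ_pos hq hr _) _ _ _ (h.kernel_high hq hr _)
    (h.kernel_low hq hr _)]
  refine and_congr ?_ (forall_congr' fun l => ?_)
  · have := (h.horizCoef_succ_neg hlam₀ hlam₁ ha₀ ha₁ hload i).ne
    field_simp
    constructor <;> intro h <;> linear_combination h
  · rw [eq_div_iff (pow_ne_zero _ (h.δ_pos _).ne')]
    simp [CompSeq.layer]

theorem CompSeq.horizontal_zero_iff_explicit {S : CompSeq} (h : IsRootSeq lam a S.γ S.δ)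
    (hlam₀ : 0 < lam) (hlam₁ : lam < 1) (ha₀ : 0 < a) (ha₁ : a < 1) (hload : load lam a < 1)
    (hc : S.c 0 = 0) :
    ((matA lam a (S.γ 0) (S.δ 0)).mulVec (fun l => S.e l 0) +
      (S.d 0 * S.δ 0 ^ 2) • vecB lam a (S.γ 0) (S.δ 0) = 0) ↔
    ∀ l, S.e l 0 = horizSol (pUp lam a) (pDown lam a) (pSwap lam a) (S.γ 0)
      (S.layer 1 0) (S.layer 2 0) l / S.δ 0 ^ (l : ℕ) := by
  have hq := pDown_pos hlam₁ ha₀ ha₁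
  have hr := pSwap_pos hlam₀ ha₀ ha₁
  -- The companion term is absent: coefficient zero, with `δ 0` as a dummy second root. In `layer`
  -- the index `0 - 1 = 0` is likewise harmless because `c 0 = 0`.
  have key := horizontal_iff hlam₀ hlam₁ ha₀ ha₁ (h.γ_pos hq hr 0) 0 (S.d 0) (fun l => S.e l 0)
    (h.kernel_high hq hr 0) (h.kernel_high hq hr 0)
  rw [zero_mul, zero_smul, neg_zero] at key
  rw [key, h.horizCoef_zero hlam₀ hlam₁ ha₀ ha₁ hload]
  simp only [mul_zero, add_zero, true_and]
  refine forall_congr' fun l => ?_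
  rw [eq_div_iff (pow_ne_zero _ (h.δ_pos _).ne')]
  simp [CompSeq.layer, hc]

theorem CompSeq.isGenerated_iff (hlam₀ : 0 < lam) (hlam₁ : lam < 1) (ha₀ : 0 < a) (ha₁ : a < 1)
    (hload : load lam a < 1) (S : CompSeq) : S.IsGenerated lam a ↔ S.IsExplicit lam a := by
  have hq := pDown_pos hlam₁ ha₀ ha₁
  have hr := pSwap_pos hlam₀ ha₀ ha₁
  constructor
  · intro h
    have hR := h.isRootSeq hlam₀ hlam₁ ha₀ ha₁ hload
    have hγ1 : ∀ i, S.γ i < 1 := fun i => by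
      refine lt_of_le_of_lt ((hR.γ_strictAnti hq hr).antitone (Nat.zero_le i)) ?_
      have := load_pos hlam₀ hlam₁ ha₀ ha₁
      rw [hR.γ_zero]; nlinarith
    have hH := fun i => (CompSeq.horizontal_iff_explicit hR hlam₀ hlam₁ ha₀ ha₁ hload i).1
      (h.horizontal_succ i)
    refine ⟨h.γ_zero, fun i => ?_, hR.γ_low, h.c_zero, h.d_zero, h.c_succ, fun i => (hH i).1, ?_⟩
    · exact IsDeltaRoot.unique (h.δ_root i)
        (deltaRoot_spec hlam₀ hlam₁ ha₀ ha₁ (hR.γ_pos hq hr i) (hγ1 i)).2.2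
    · intro l i
      cases i with
      | zero => exact (CompSeq.horizontal_zero_iff_explicit hR hlam₀ hlam₁ ha₀ ha₁ hload
          h.c_zero).1 h.horizontal_zero l
      | succ i => exact (hH i).2 l
  · intro h
    have hR := h.isRootSeq hlam₀ hlam₁ ha₀ ha₁ hload
    have hγ1 : ∀ i, S.γ i < 1 := fun i => by
      refine lt_of_le_of_lt ((hR.γ_strictAnti hq hr).antitone (Nat.zero_le i)) ?_
      have := load_pos hlam₀ hlam₁ ha₀ ha₁
      rw [hR.γ_zero]; nlinarith
    refine ⟨h.γ_zero, fun i z => ?_, fun i z => ?_, h.c_zero, h.d_zero,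
      fun i => (hR.vertErr_low_pos hlam₀ hlam₁ ha₀ ha₁ i).ne', h.c_succ, ?_, fun i => ?_⟩
    · rw [h.δ_eq]
      exact (deltaRoot_spec hlam₀ hlam₁ ha₀ ha₁ (hR.γ_pos hq hr i) (hγ1 i)).2.2 z
    · rw [h.γ_succ]
      exact gammaRoot_iff hlam₀ hlam₁ ha₀ ha₁ (hR.δ_pos i) (hR.δ_lt i) z
    · exact (CompSeq.horizontal_zero_iff_explicit hR hlam₀ hlam₁ ha₀ ha₁ hload h.c_zero).2
        fun l => h.e_eq l 0
    · exact (CompSeq.horizontal_iff_explicit hR hlam₀ hlam₁ ha₀ ha₁ hload i).2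
        ⟨h.d_succ i, fun l => h.e_eq l (i + 1)⟩

/-- In explicit form each entry is a total function of earlier data, so existence and uniqueness are
formal and need no condition on the parameters. -/
theorem CompSeq.existsUnique_isExplicit (lam a : ℝ) : ∃! S : CompSeq, S.IsExplicit lam a := by
  set γ : ℕ → ℝ := Nat.rec (load lam a ^ 2) fun _ g =>
    ratioLow (pUp lam a) (pDown lam a) (pSwap lam a) (deltaRoot lam a g) * deltaRoot lam a g with hγ
  set δ : ℕ → ℝ := fun i => deltaRoot lam a (γ i) with hδ
  set C : ℕ → ℝ := fun i =>
    -(vertErr lam a (γ i) (δ i) / vertErr lam a (γ (i + 1)) (δ i)) with hC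
  set d : ℕ → ℝ := Nat.rec 1 fun i x =>
    -(horizCoef (pUp lam a) (pDown lam a) (pSwap lam a) (γ (i + 1)) (δ i) /
      horizCoef (pUp lam a) (pDown lam a) (pSwap lam a) (γ (i + 1)) (δ (i + 1))) * (C i * x) with hd
  set c : ℕ → ℝ := fun i => Nat.casesOn i 0 fun i => C i * d i with hc
  refine ⟨⟨γ, δ, c, d, fun l i => horizSol (pUp lam a) (pDown lam a) (pSwap lam a) (γ i)
    (d i * δ i ^ 1 + c i * δ (i - 1) ^ 1) (d i * δ i ^ 2 + c i * δ (i - 1) ^ 2) l / δ i ^ (l : ℕ)⟩,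
    ⟨rfl, fun _ => rfl, fun _ => rfl, rfl, rfl, fun _ => rfl, fun _ => rfl, fun _ _ => rfl⟩, ?_⟩
  intro S h
  have h1 : S.γ = γ := by
    funext i
    induction i with
    | zero => exact h.γ_zero
    | succ i ih => rw [h.γ_succ, h.δ_eq, ih]
  have h2 : S.δ = δ := by
    funext i
    rw [h.δ_eq, h1]
  have h3 : S.d = d := by
    funext i
    induction i with
    | zero => exact h.d_zero
    | succ i ih => rw [h.d_succ, h.c_succ, h1, h2, ih]
  have h4 : S.c = c := by
    funext i
    cases i with
    | zero => exact h.c_zero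
    | succ i => rw [h.c_succ, h1, h2, h3]
  have h5 : S.e = fun l i => horizSol (pUp lam a) (pDown lam a) (pSwap lam a) (γ i)
    (d i * δ i ^ 1 + c i * δ (i - 1) ^ 1) (d i * δ i ^ 2 + c i * δ (i - 1) ^ 2) l /
      δ i ^ (l : ℕ) := by
    funext l i
    rw [h.e_eq, CompSeq.layer, CompSeq.layer, h1, h2, h3, h4]
  cases S
  simp only at h1 h2 h3 h4 h5
  subst h5
  simp only [h1, h2, h3, h4]

end Recursion

/-! ### Convergence of the series -/

section Asymptotics

variable {lam a : ℝ}

/-- The monotone limit `L` is shared by the interlacing `γ (i + 1)`, so `L = ratioLow L * L`. As the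
ratio is below one, `L = 0`. -/
theorem IsRootSeq.tendsto_δ {γ δ : ℕ → ℝ} (h : IsRootSeq lam a γ δ) (hq : 0 < pDown lam a)
    (hr : 0 < pSwap lam a) : Tendsto δ atTop (𝓝 0) := by
  have hanti : Antitone δ := antitone_nat_of_succ_le fun i =>
    ((h.δ_lt_γ hq hr (i + 1)).trans (h.γ_succ_lt hq hr i)).le
  have hbdd : BddBelow (Set.range δ) := ⟨0, by rintro _ ⟨i, rfl⟩; exact (h.δ_pos i).le⟩
  have hlim := tendsto_atTop_ciInf hanti hbdd
  set L := ⨅ i, δ i with hL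
  have hL1 : L < 1 := (ciInf_le hbdd 0).trans_lt (h.δ_lt 0)
  have h1 : Tendsto (fun i => γ (i + 1)) atTop (𝓝 L) :=
    tendsto_of_tendsto_of_tendsto_of_le_of_le (hlim.comp (tendsto_add_atTop_nat 1)) hlim
      (fun i => (h.δ_lt_γ hq hr (i + 1)).le) fun i => (h.γ_succ_lt hq hr i).le
  have h2 : Tendsto (fun i => γ (i + 1)) atTop
      (𝓝 (ratioLow (pUp lam a) (pDown lam a) (pSwap lam a) L * L)) := by
    simp only [h.γ_low]
    exact ((continuous_ratioLow.tendsto L).comp hlim).mul hlim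
  have h3 := tendsto_nhds_unique h1 h2
  have h4 := (ratioLow_lt_one (p := pUp lam a) hq hr hL1).1
  have h5 : L = 0 := by
    have : (1 - ratioLow (pUp lam a) (pDown lam a) (pSwap lam a) L) * L = 0 := by linarith
    exact (mul_eq_zero.1 this).resolve_left (by linarith)
  rwa [h5] at hlim

/-- `horizCoef p q r (y * δ) δ / δ`. -/
def horizRatio (p q r y δ : ℝ) : ℝ :=
  q * y * (q * (y * δ) * (p + r + 2 * q) + r * (p + q * (y * δ))) -
    (p + 2 * q * (y * δ)) * (q * (p + q * (y * δ)) + r * (p + r + 2 * q)) -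
    r * (q * (p + 2 * q * (y * δ)) + r * (p + 2 * q)) * δ

theorem horizCoef_mul (p q r y δ : ℝ) :
    horizCoef p q r (y * δ) δ = δ * horizRatio p q r y δ := by
  unfold horizCoef horizRatio; ring

variable (lam a) in
/-- The quotient `c (i + 1) / d i`. -/
def vertQuot (δ : ℝ) : ℝ :=
  -(vertRatio lam a (ratioHigh (pUp lam a) (pDown lam a) (pSwap lam a) δ) δ /
    vertRatio lam a (ratioLow (pUp lam a) (pDown lam a) (pSwap lam a) δ) δ)

variable (lam a) in
/-- The quotient `d (i + 1) γ (i + 1) ^ 2 / (d i γ i ^ 2)` as a function of `δ i` and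
`δ (i + 1)`. -/
def termQuot (δ δ' : ℝ) : ℝ :=
  -(horizRatio (pUp lam a) (pDown lam a) (pSwap lam a)
        (ratioLow (pUp lam a) (pDown lam a) (pSwap lam a) δ) δ /
      horizRatio (pUp lam a) (pDown lam a) (pSwap lam a)
        (ratioHigh (pUp lam a) (pDown lam a) (pSwap lam a) δ') δ' *
      (ratioHigh (pUp lam a) (pDown lam a) (pSwap lam a) δ' /
        ratioLow (pUp lam a) (pDown lam a) (pSwap lam a) δ)) * vertQuot lam a δ *
    (ratioLow (pUp lam a) (pDown lam a) (pSwap lam a) δ /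
      ratioHigh (pUp lam a) (pDown lam a) (pSwap lam a) δ) ^ 2

theorem CompSeq.IsExplicit.c_succ_eq {S : CompSeq} (h : S.IsExplicit lam a)
    (hR : IsRootSeq lam a S.γ S.δ) (i : ℕ) : S.c (i + 1) = vertQuot lam a (S.δ i) * S.d i := by
  have := (hR.δ_pos i).ne'
  rw [h.c_succ, hR.γ_high i, hR.γ_low i, vertErr_eq, vertErr_eq, vertQuot,
    mul_div_mul_left _ _ this]

theorem CompSeq.IsExplicit.d_succ_eq {S : CompSeq} (h : S.IsExplicit lam a)
    (hR : IsRootSeq lam a S.γ S.δ) (hp : 0 < pUp lam a) (hq : 0 < pDown lam a)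
    (hr : 0 < pSwap lam a) (i : ℕ) :
    S.d (i + 1) * S.γ (i + 1) ^ 2 = termQuot lam a (S.δ i) (S.δ (i + 1)) * (S.d i * S.γ i ^ 2) := by
  have h1 := hR.δ_pos i
  have h2 := hR.δ_pos (i + 1)
  have h3 := ratioLow_pos hp hq hr h1.le (hR.δ_lt i)
  have h4 := (ratioLow_lt_one (p := pUp lam a) hq hr (hR.δ_lt i)).2
  have h5 := (ratioLow_lt_one (p := pUp lam a) hq hr (hR.δ_lt (i + 1))).2
  have e1 : horizCoef (pUp lam a) (pDown lam a) (pSwap lam a) (S.γ (i + 1)) (S.δ i) =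
      S.δ i * horizRatio (pUp lam a) (pDown lam a) (pSwap lam a)
        (ratioLow (pUp lam a) (pDown lam a) (pSwap lam a) (S.δ i)) (S.δ i) := by
    rw [hR.γ_low, horizCoef_mul]
  have e2 : horizCoef (pUp lam a) (pDown lam a) (pSwap lam a) (S.γ (i + 1)) (S.δ (i + 1)) =
      S.δ (i + 1) * horizRatio (pUp lam a) (pDown lam a) (pSwap lam a)
        (ratioHigh (pUp lam a) (pDown lam a) (pSwap lam a) (S.δ (i + 1))) (S.δ (i + 1)) := by
    rw [hR.γ_high (i + 1), horizCoef_mul]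
  -- Both ratios come from writing `γ (i + 1)` in terms of `δ i` and of `δ (i + 1)`.
  have e3 : S.δ i / S.δ (i + 1) = ratioHigh (pUp lam a) (pDown lam a) (pSwap lam a) (S.δ (i + 1)) /
      ratioLow (pUp lam a) (pDown lam a) (pSwap lam a) (S.δ i) := by
    rw [div_eq_div_iff h2.ne' h3.ne', ← hR.γ_high, mul_comm, ← hR.γ_low]
  have e4 : S.γ (i + 1) = ratioLow (pUp lam a) (pDown lam a) (pSwap lam a) (S.δ i) /
      ratioHigh (pUp lam a) (pDown lam a) (pSwap lam a) (S.δ i) * S.γ i := by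
    rw [hR.γ_high i, hR.γ_low i]
    field_simp
  rw [h.d_succ, h.c_succ_eq hR, e1, e2, mul_div_mul_comm, e3, e4, termQuot]
  ring

/-- In the limit `δ → 0`, the larger root has the smaller vertical boundary error. -/
theorem vertRatio_zero_bounds (hlam₀ : 0 < lam) (hlam₁ : lam < 1) (ha₀ : 0 < a) (ha₁ : a < 1) :
    |vertRatio lam a (ratioHigh (pUp lam a) (pDown lam a) (pSwap lam a) 0) 0| <
      vertRatio lam a (ratioLow (pUp lam a) (pDown lam a) (pSwap lam a) 0) 0 := by
  have hq := pDown_pos hlam₁ ha₀ ha₁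
  have hr := pSwap_pos hlam₀ ha₀ ha₁
  have h1 := ratio_add (p := pUp lam a) (r := pSwap lam a) hq 0
  obtain ⟨h3, h4⟩ := ratioLow_lt_one (p := pUp lam a) hq hr one_pos
  have hp := pUp_pos hlam₀ ha₀
  -- The two errors at `δ = 0` sum to `p + r + 2 ((1 - lam) a - q)`, so this inequality yields the
  -- lower bound; the upper bound is the order of the roots.
  have hA : pDown lam a < (1 - lam) * a := by
    have : 0 < (1 - lam) * a := mul_pos (sub_pos.2 hlam₁) ha₀
    unfold pDown; nlinarith
  have hlt := mul_lt_mul_of_pos_left (h3.trans h4) hq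
  unfold vertRatio
  rw [abs_lt]
  constructor <;> linarith

/-- At `δ = 0`, the sum of the roots reduces the quotient to `v' / v` times `(p + r y') y / ((p + r
y) y')`. The first factor has modulus below one by `vertRatio_zero_bounds`, the second because `y <
y'`. -/
theorem abs_termQuot_zero_lt (hlam₀ : 0 < lam) (hlam₁ : lam < 1) (ha₀ : 0 < a) (ha₁ : a < 1) :
    |termQuot lam a 0 0| < 1 := by
  have hp := pUp_pos hlam₀ ha₀
  have hq := pDown_pos hlam₁ ha₀ ha₁
  have hr := pSwap_pos hlam₀ ha₀ ha₁
  have h1 := ratio_add (p := pUp lam a) (r := pSwap lam a) hq 0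
  obtain ⟨h3, h4⟩ := ratioLow_lt_one (p := pUp lam a) hq hr one_pos
  have h5 := ratioLow_pos hp hq hr le_rfl one_pos
  have hv := vertRatio_zero_bounds hlam₀ hlam₁ ha₀ ha₁
  unfold termQuot vertQuot
  set y := ratioLow (pUp lam a) (pDown lam a) (pSwap lam a) 0
  set y' := ratioHigh (pUp lam a) (pDown lam a) (pSwap lam a) 0
  set v := vertRatio lam a y 0
  set v' := vertRatio lam a y' 0
  set p := pUp lam a
  set q := pDown lam a
  set r := pSwap lam a
  have hv0 : 0 < v := (abs_nonneg _).trans_lt hv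
  have hy' : 0 < y' := by linarith
  have g1 : horizRatio p q r y 0 = -(p * q * (p + r * y')) := by
    unfold horizRatio; linear_combination p * r * h1
  have g2 : horizRatio p q r y' 0 = -(p * q * (p + r * y)) := by
    unfold horizRatio; linear_combination p * r * h1
  rw [g1, g2]
  have e : -(-(p * q * (p + r * y')) / -(p * q * (p + r * y)) * (y' / y)) * -(v' / v) *
      (y / y') ^ 2 = v' / v * ((p + r * y') * y / ((p + r * y) * y')) := by
    field_simp
  rw [e, abs_mul, abs_div, abs_of_pos hv0,
    abs_of_pos (show 0 < (p + r * y') * y / ((p + r * y) * y') by positivity)]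
  have i1 : |v'| / v < 1 := (div_lt_one hv0).2 hv
  have i2 : (p + r * y') * y / ((p + r * y) * y') < 1 := by
    rw [div_lt_one (by positivity)]
    nlinarith
  calc |v'| / v * ((p + r * y') * y / ((p + r * y) * y'))
      ≤ 1 * ((p + r * y') * y / ((p + r * y) * y')) :=
        mul_le_mul_of_nonneg_right i1.le (by positivity)
    _ < 1 := by rwa [one_mul]

theorem continuous_vertRatio : Continuous fun z : ℝ × ℝ => vertRatio lam a z.1 z.2 := by
  unfold vertRatio; fun_prop

theorem continuous_horizRatio {p q r : ℝ} :
    Continuous fun z : ℝ × ℝ => horizRatio p q r z.1 z.2 := by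
  unfold horizRatio; fun_prop

theorem tendsto_vertQuot (hlam₀ : 0 < lam) (hlam₁ : lam < 1) (ha₀ : 0 < a) (ha₁ : a < 1) {δ : ℕ → ℝ}
    (hδ : Tendsto δ atTop (𝓝 0)) :
    Tendsto (fun i => vertQuot lam a (δ i)) atTop (𝓝 (vertQuot lam a 0)) := by
  have hv := (abs_nonneg _).trans_lt (vertRatio_zero_bounds hlam₀ hlam₁ ha₀ ha₁)
  have h1 := ((continuous_ratioLow (p := pUp lam a) (q := pDown lam a)
    (r := pSwap lam a)).tendsto 0).comp hδ
  have h2 := ((continuous_ratioHigh (p := pUp lam a) (q := pDown lam a)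
    (r := pSwap lam a)).tendsto 0).comp hδ
  exact (((continuous_vertRatio.tendsto _).comp (h2.prodMk_nhds hδ)).div
    ((continuous_vertRatio.tendsto _).comp (h1.prodMk_nhds hδ)) hv.ne').neg

theorem tendsto_termQuot (hlam₀ : 0 < lam) (hlam₁ : lam < 1) (ha₀ : 0 < a) (ha₁ : a < 1) {δ : ℕ → ℝ}
    (hδ : Tendsto δ atTop (𝓝 0)) :
    Tendsto (fun i => termQuot lam a (δ i) (δ (i + 1))) atTop (𝓝 (termQuot lam a 0 0)) := by
  have hp := pUp_pos hlam₀ ha₀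
  have hq := pDown_pos hlam₁ ha₀ ha₁
  have hr := pSwap_pos hlam₀ ha₀ ha₁
  have hδ' := hδ.comp (tendsto_add_atTop_nat 1)
  have h1 := ((continuous_ratioLow (p := pUp lam a) (q := pDown lam a)
    (r := pSwap lam a)).tendsto 0).comp hδ
  have h2 := ((continuous_ratioHigh (p := pUp lam a) (q := pDown lam a)
    (r := pSwap lam a)).tendsto 0).comp hδ
  have h3 := ((continuous_ratioHigh (p := pUp lam a) (q := pDown lam a)
    (r := pSwap lam a)).tendsto 0).comp hδ'
  have hlow := (ratioLow_pos hp hq hr le_rfl one_pos)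
  have hhigh := (ratioLow_lt_one (p := pUp lam a) hq hr one_pos).2
  have hadd := ratio_add (p := pUp lam a) (r := pSwap lam a) hq 0
  have hne : horizRatio (pUp lam a) (pDown lam a) (pSwap lam a)
      (ratioHigh (pUp lam a) (pDown lam a) (pSwap lam a) 0) 0 ≠ 0 := by
    have : horizRatio (pUp lam a) (pDown lam a) (pSwap lam a)
        (ratioHigh (pUp lam a) (pDown lam a) (pSwap lam a) 0) 0 =
        -(pUp lam a * pDown lam a * (pUp lam a + pSwap lam a *
          ratioLow (pUp lam a) (pDown lam a) (pSwap lam a) 0)) := by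
      unfold horizRatio; linear_combination pUp lam a * pSwap lam a * hadd
    rw [this, neg_ne_zero]
    positivity
  exact (((((continuous_horizRatio.tendsto _).comp (h1.prodMk_nhds hδ)).div
    ((continuous_horizRatio.tendsto _).comp (h3.prodMk_nhds hδ')) hne).mul
      (h3.div h1 hlow.ne')).neg.mul (tendsto_vertQuot hlam₀ hlam₁ ha₀ ha₁ hδ)).mul
        ((h1.div h2 (by linarith)).pow 2)

/-- A summable sequence which dominates all terms of the series. -/
def CompSeq.weight (S : CompSeq) (i : ℕ) : ℝ :=
  |S.d i| * S.γ i ^ 2 + |S.c i| * S.δ (i - 1) ^ 2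

/-- The ratio test handles the `d` terms; the `c` terms are comparable to them, because the
quotients `vertQuot` converge and `δ i < γ i`. -/
theorem CompSeq.IsExplicit.summable_weight {S : CompSeq} (h : S.IsExplicit lam a) (hlam₀ : 0 < lam)
    (hlam₁ : lam < 1) (ha₀ : 0 < a) (ha₁ : a < 1) (hload : load lam a < 1) :
    Summable S.weight := by
  have hp := pUp_pos hlam₀ ha₀
  have hq := pDown_pos hlam₁ ha₀ ha₁
  have hr := pSwap_pos hlam₀ ha₀ ha₁
  have hR := h.isRootSeq hlam₀ hlam₁ ha₀ ha₁ hload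
  have hδ := hR.tendsto_δ hq hr
  obtain ⟨L, hL0, hL1⟩ := exists_between (abs_termQuot_zero_lt hlam₀ hlam₁ ha₀ ha₁)
  have hd : Summable fun i => |S.d i| * S.γ i ^ 2 := by
    have : Summable fun i => S.d i * S.γ i ^ 2 := by
      refine summable_of_ratio_norm_eventually_le hL1 ?_
      filter_upwards [(tendsto_termQuot hlam₀ hlam₁ ha₀ ha₁ hδ).abs.eventually_le_const hL0] with i hi
      rw [h.d_succ_eq hR hp hq hr, norm_mul]
      exact mul_le_mul_of_nonneg_right hi (norm_nonneg _)
    simpa [abs_mul] using this.abs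
  refine hd.add ?_
  rw [← summable_nat_add_iff 1]
  obtain ⟨C, hC⟩ := (tendsto_vertQuot hlam₀ hlam₁ ha₀ ha₁ hδ).abs.bddAbove_range
  refine Summable.of_nonneg_of_le (fun i => by positivity) (fun i => ?_) (hd.mul_left C)
  rw [h.c_succ_eq hR, abs_mul, Nat.add_sub_cancel, ← mul_assoc]
  have h1 : |vertQuot lam a (S.δ i)| ≤ C := hC ⟨i, rfl⟩
  have h2 : S.δ i ^ 2 ≤ S.γ i ^ 2 :=
    pow_le_pow_left₀ (hR.δ_pos i).le (hR.δ_lt_γ hq hr i).le 2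
  exact mul_le_mul (mul_le_mul_of_nonneg_right h1 (abs_nonneg _)) h2 (by positivity)
    (mul_nonneg ((abs_nonneg _).trans h1) (abs_nonneg _))

end Asymptotics

/-! ### The series solve the balance equations -/

namespace CompSeq

variable {lam a : ℝ} {S : CompSeq}

/-- The amplitude of `γ i ^ k` in the states with difference `l`. -/
def amp (S : CompSeq) : ℕ → ℕ → ℝ
  | 0, i => S.e 0 i
  | 1, i => S.e 1 i * S.δ i
  | l + 2, i => S.layer (l + 2) i

/-- Both roots in a layer lie on the kernel curve over the same `γ i`, and the relation is linear in
the coefficients. -/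
theorem layer_kernel (hR : IsRootSeq lam a S.γ S.δ) (hq : 0 < pDown lam a) (hr : 0 < pSwap lam a)
    (hc : S.c 0 = 0) (l i : ℕ) :
    (pUp lam a + pSwap lam a + 2 * pDown lam a) * S.γ i * S.layer (l + 1) i =
      (pDown lam a * S.γ i + pUp lam a) * S.layer (l + 2) i + pSwap lam a * S.layer (l + 3) i +
        pDown lam a * S.γ i ^ 2 * S.layer l i := by
  have h1 := hR.kernel_high hq hr i
  unfold layer
  cases i with
  | zero =>
    rw [hc]
    linear_combination S.d 0 * S.δ 0 ^ l * h1
  | succ i =>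
    have h2 := hR.kernel_low hq hr i
    rw [Nat.add_sub_cancel]
    linear_combination S.d (i + 1) * S.δ (i + 1) ^ l * h1 + S.c (i + 1) * S.δ i ^ l * h2

theorem IsExplicit.amp_rows (h : S.IsExplicit lam a) (hlam₀ : 0 < lam)
    (hlam₁ : lam < 1) (ha₀ : 0 < a) (ha₁ : a < 1) (hload : load lam a < 1) (i : ℕ) :
    S.γ i * (pUp lam a + pSwap lam a + 2 * pDown lam a) * S.amp 0 i -
        (pUp lam a + pDown lam a * S.γ i) * S.amp 1 i = pSwap lam a * S.layer 2 i ∧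
      S.γ i * (pUp lam a + 2 * pDown lam a) * S.amp 1 i -
          S.γ i * (pUp lam a + 2 * pDown lam a * S.γ i) * S.amp 0 i =
        (pUp lam a + pDown lam a * S.γ i) * S.layer 2 i + pSwap lam a * S.layer 3 i ∧
      pSwap lam a * S.amp 0 i + pDown lam a * S.amp 1 i = pDown lam a * S.layer 1 i := by
  have hq := pDown_pos hlam₁ ha₀ ha₁
  have hr := pSwap_pos hlam₀ ha₀ ha₁
  have hR := h.isRootSeq hlam₀ hlam₁ ha₀ ha₁ hload
  refine (horizontal_scalar_iff (pUp_pos hlam₀ ha₀) hq hr (hR.γ_pos hq hr i) (S.layer 0 i)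
    (S.layer 1 i) (S.layer 2 i) (S.layer 3 i) (S.amp 0 i) (S.amp 1 i)
    (layer_kernel hR hq hr h.c_zero 0 i)).2 ⟨?_, ?_, ?_⟩
  · cases i with
    | zero =>
      have h1 := hR.horizCoef_zero hlam₀ hlam₁ ha₀ ha₁ hload
      unfold horizCoef at h1
      unfold layer
      rw [h.c_zero]
      linear_combination S.d 0 * h1
    | succ i =>
      have h1 := (hR.horizCoef_succ_neg hlam₀ hlam₁ ha₀ ha₁ hload i).ne
      have h2 := h.d_succ i
      rw [← neg_div, div_mul_eq_mul_div, eq_div_iff h1] at h2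
      unfold horizCoef at h2
      unfold layer
      rw [Nat.add_sub_cancel]
      linear_combination h2
  · have := h.e_eq 0 i
    simpa [horizSol, amp] using this
  · have := h.e_eq 1 i
    rw [eq_div_iff (pow_ne_zero _ (hR.δ_pos i).ne')] at this
    simpa [horizSol, amp] using this

theorem weight_nonneg (S : CompSeq) (i : ℕ) : 0 ≤ S.weight i := by unfold weight; positivity

/-- Splitting off two powers for the weight leaves a geometric factor in the state, which later
gives summability over all states. -/
theorem abs_d_le (hR : IsRootSeq lam a S.γ S.δ) (hq : 0 < pDown lam a) (hr : 0 < pSwap lam a)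
    (k l i : ℕ) : |S.d i * S.γ i ^ k * S.δ i ^ (l + 2)| ≤
      S.γ 0 ^ k * S.γ 0 ^ l * (|S.d i| * S.γ i ^ 2) := by
  have h1 := (hR.γ_strictAnti hq hr).antitone (Nat.zero_le i)
  have h2 := (hR.δ_lt_γ hq hr i).le
  have h3 := hR.δ_pos i
  have h4 := hR.γ_pos hq hr i
  have h5 := hR.γ_pos hq hr 0
  rw [abs_mul, abs_mul, abs_of_pos (pow_pos h4 k), abs_of_pos (pow_pos h3 _), pow_add]
  calc |S.d i| * S.γ i ^ k * (S.δ i ^ l * S.δ i ^ 2)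
      ≤ |S.d i| * S.γ 0 ^ k * (S.γ 0 ^ l * S.γ i ^ 2) := by
        gcongr; exact h2.trans h1
    _ = _ := by ring

theorem abs_c_le (hR : IsRootSeq lam a S.γ S.δ) (hq : 0 < pDown lam a) (hr : 0 < pSwap lam a)
    (k l i : ℕ) : |S.c i * S.γ i ^ k * S.δ (i - 1) ^ (l + 2)| ≤
      S.γ 0 ^ k * S.γ 0 ^ l * (|S.c i| * S.δ (i - 1) ^ 2) := by
  have h1 := (hR.γ_strictAnti hq hr).antitone (Nat.zero_le i)
  have h2 := ((hR.δ_lt_γ hq hr (i - 1)).le.trans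
    ((hR.γ_strictAnti hq hr).antitone (Nat.zero_le (i - 1))))
  have h3 := hR.δ_pos (i - 1)
  have h4 := hR.γ_pos hq hr i
  have h5 := hR.γ_pos hq hr 0
  rw [abs_mul, abs_mul, abs_of_pos (pow_pos h4 k), abs_of_pos (pow_pos h3 _), pow_add]
  calc |S.c i| * S.γ i ^ k * (S.δ (i - 1) ^ l * S.δ (i - 1) ^ 2)
      ≤ |S.c i| * S.γ 0 ^ k * (S.γ 0 ^ l * S.δ (i - 1) ^ 2) := by gcongr
    _ = _ := by ring

theorem abs_layer_le (hR : IsRootSeq lam a S.γ S.δ) (hq : 0 < pDown lam a) (hr : 0 < pSwap lam a)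
    (k l i : ℕ) : |S.layer (l + 2) i * S.γ i ^ k| ≤ S.γ 0 ^ k * S.γ 0 ^ l * S.weight i := by
  have e : S.layer (l + 2) i * S.γ i ^ k =
    S.d i * S.γ i ^ k * S.δ i ^ (l + 2) + S.c i * S.γ i ^ k * S.δ (i - 1) ^ (l + 2) := by
    unfold layer; ring
  rw [e, weight, mul_add]
  exact (abs_add_le _ _).trans (add_le_add (abs_d_le hR hq hr k l i) (abs_c_le hR hq hr k l i))

theorem abs_d_one_le (hR : IsRootSeq lam a S.γ S.δ) (hq : 0 < pDown lam a) (hr : 0 < pSwap lam a)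
    (i : ℕ) : |S.d i * S.γ i ^ 1 * S.δ i ^ 1| ≤ |S.d i| * S.γ i ^ 2 := by
  have h2 := (hR.δ_lt_γ hq hr i).le
  have h3 := hR.δ_pos i
  have h4 := hR.γ_pos hq hr i
  rw [abs_mul, abs_mul, abs_of_pos (pow_pos h4 _), abs_of_pos (pow_pos h3 _), mul_assoc]
  refine mul_le_mul_of_nonneg_left ?_ (abs_nonneg _)
  nlinarith

theorem abs_c_one_le (hR : IsRootSeq lam a S.γ S.δ) (hq : 0 < pDown lam a) (hr : 0 < pSwap lam a)
    (hc : S.c 0 = 0) (i : ℕ) :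
    |S.c i * S.γ i ^ 1 * S.δ (i - 1) ^ 1| ≤ |S.c i| * S.δ (i - 1) ^ 2 := by
  cases i with
  -- Here `i - 1 = 0`, and `γ 0` exceeds `δ 0`: the general comparison fails, but the coefficient is
  -- zero.
  | zero => simp [hc]
  | succ i =>
    rw [Nat.add_sub_cancel]
    have h2 := (hR.γ_succ_lt hq hr i).le
    have h3 := hR.δ_pos i
    have h4 := hR.γ_pos hq hr (i + 1)
    rw [abs_mul, abs_mul, abs_of_pos (pow_pos h4 _), abs_of_pos (pow_pos h3 _), mul_assoc]
    refine mul_le_mul_of_nonneg_left ?_ (abs_nonneg _)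
    nlinarith

theorem abs_layer_one_le (hR : IsRootSeq lam a S.γ S.δ) (hq : 0 < pDown lam a)
    (hr : 0 < pSwap lam a) (hc : S.c 0 = 0) (i : ℕ) : |S.layer 1 i * S.γ i| ≤ S.weight i := by
  have e : S.layer 1 i * S.γ i =
    S.d i * S.γ i ^ 1 * S.δ i ^ 1 + S.c i * S.γ i ^ 1 * S.δ (i - 1) ^ 1 := by
    unfold layer; ring
  rw [e, weight]
  exact (abs_add_le _ _).trans (add_le_add (abs_d_one_le hR hq hr i) (abs_c_one_le hR hq hr hc i))

theorem IsExplicit.summable_d (h : S.IsExplicit lam a) (hlam₀ : 0 < lam) (hlam₁ : lam < 1)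
    (ha₀ : 0 < a) (ha₁ : a < 1) (hload : load lam a < 1) :
    Summable (fun i => |S.d i| * S.γ i ^ 2) ∧ Summable (fun i => |S.c i| * S.δ (i - 1) ^ 2) := by
  have hw := h.summable_weight hlam₀ hlam₁ ha₀ ha₁ hload
  constructor <;> refine Summable.of_nonneg_of_le (fun i => by positivity) (fun i => ?_) hw <;>
    unfold weight
  · exact le_add_of_nonneg_right (by positivity)
  · exact le_add_of_nonneg_left (by positivity)

/-- A bound for the amplitudes at differences `0` and `1`. -/
def ampBound (lam a : ℝ) : ℝ :=
  (pDown lam a * (pSwap lam a + pUp lam a + pDown lam a) +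
    (pUp lam a + pSwap lam a + 2 * pDown lam a) * pDown lam a + pSwap lam a ^ 2) /
    (pSwap lam a * pUp lam a)

theorem IsExplicit.abs_amp_le (h : S.IsExplicit lam a) (hlam₀ : 0 < lam)
    (hlam₁ : lam < 1) (ha₀ : 0 < a) (ha₁ : a < 1) (hload : load lam a < 1) (l : Fin 2) (i : ℕ) :
    |S.amp l i * S.γ i| ≤ ampBound lam a * S.weight i := by
  have hp := pUp_pos hlam₀ ha₀
  have hq := pDown_pos hlam₁ ha₀ ha₁
  have hr := pSwap_pos hlam₀ ha₀ ha₁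
  have hR := h.isRootSeq hlam₀ hlam₁ ha₀ ha₁ hload
  obtain ⟨h1, -, h3⟩ := h.amp_rows hlam₀ hlam₁ ha₀ ha₁ hload i
  have hγ := hR.γ_pos hq hr i
  have hγ1 : S.γ i < 1 := by
    refine lt_of_le_of_lt ((hR.γ_strictAnti hq hr).antitone (Nat.zero_le i)) ?_
    have := load_pos hlam₀ hlam₁ ha₀ ha₁
    rw [hR.γ_zero]; nlinarith
  have hW := S.weight_nonneg i
  have hD1 := abs_layer_one_le hR hq hr h.c_zero i
  have hD2 : |S.layer 2 i * S.γ i| ≤ S.weight i := by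
    refine (abs_layer_le hR hq hr 1 0 i |>.trans ?_) |> (by simpa using ·)
    have : S.γ 0 ≤ 1 := by
      have := load_pos hlam₀ hlam₁ ha₀ ha₁
      rw [hR.γ_zero]; nlinarith
    simpa using mul_le_of_le_one_left hW this
  rw [ampBound, div_mul_eq_mul_div, le_div_iff₀ (by positivity)]
  set Δ := pDown lam a * S.γ i * (pUp lam a + pSwap lam a + 2 * pDown lam a) +
    pSwap lam a * (pUp lam a + pDown lam a * S.γ i) with hΔ
  -- The determinant stays away from zero as `γ i` tends to `0`, so Cramer's rule bounds both
  -- amplitudes uniformly in `i`.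
  have hΔ0 : pSwap lam a * pUp lam a ≤ Δ := by
    have : 0 ≤ pDown lam a * S.γ i * (pUp lam a + pSwap lam a + 2 * pDown lam a) +
      pSwap lam a * (pDown lam a * S.γ i) := by positivity
    rw [hΔ]; linarith
  refine (mul_le_mul_of_nonneg_left hΔ0 (abs_nonneg _)).trans ?_
  rw [← abs_of_pos ((mul_pos hr hp).trans_le hΔ0), ← abs_mul]
  generalize pUp lam a = p at *
  generalize pDown lam a = q at *
  generalize pSwap lam a = r at *
  fin_cases l
  · have e : S.amp 0 i * S.γ i * Δ =
        q * r * (S.layer 2 i * S.γ i) + q * (p + q * S.γ i) * (S.layer 1 i * S.γ i) := by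
      rw [hΔ]; linear_combination S.γ i * q * h1 + S.γ i * (p + q * S.γ i) * h3
    have b1 : |q * r * (S.layer 2 i * S.γ i)| ≤ q * r * S.weight i := by
      rw [abs_mul, abs_of_pos (by positivity : 0 < q * r)]
      exact mul_le_mul_of_nonneg_left hD2 (by positivity)
    have b2 : |q * (p + q * S.γ i) * (S.layer 1 i * S.γ i)| ≤ q * (p + q) * S.weight i := by
      rw [abs_mul, abs_of_pos (by positivity : 0 < q * (p + q * S.γ i))]
      exact mul_le_mul (by gcongr; nlinarith) hD1 (abs_nonneg _) (by positivity)
    refine (le_of_eq (congrArg abs e)).trans ((abs_add_le _ _).trans ((add_le_add b1 b2).trans ?_))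
    have : 0 ≤ ((p + r + 2 * q) * q + r ^ 2) * S.weight i := by positivity
    linarith
  · have e : S.amp 1 i * S.γ i * Δ =
        S.γ i * (p + r + 2 * q) * q * (S.layer 1 i * S.γ i) + -(r ^ 2 * (S.layer 2 i * S.γ i)) := by
      rw [hΔ]; linear_combination S.γ i * (S.γ i * (p + r + 2 * q)) * h3 - S.γ i * r * h1
    have b1 : |S.γ i * (p + r + 2 * q) * q * (S.layer 1 i * S.γ i)| ≤
        1 * (p + r + 2 * q) * q * S.weight i := by
      rw [abs_mul, abs_of_pos (by positivity : 0 < S.γ i * (p + r + 2 * q) * q)]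
      exact mul_le_mul (by gcongr) hD1 (abs_nonneg _) (by positivity)
    have b2 : |-(r ^ 2 * (S.layer 2 i * S.γ i))| ≤ r ^ 2 * S.weight i := by
      rw [abs_neg, abs_mul, abs_of_pos (by positivity : 0 < r ^ 2)]
      exact mul_le_mul_of_nonneg_left hD2 (by positivity)
    refine (le_of_eq (congrArg abs e)).trans ((abs_add_le _ _).trans ((add_le_add b1 b2).trans ?_))
    have : 0 ≤ (q * (r + p + q)) * S.weight i := by positivity
    linarith

end CompSeq

/-- The system is triangular: the first equation gives `x₂`, adding the other two eliminates `x₀`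
and gives `x₁`, and the last gives `x₀`. -/
theorem OriginEquations.unique {lam a : ℝ} (hlam₀ : 0 < lam) (hlam₁ : lam < 1) (ha₀ : 0 < a)
    (ha₁ : a < 1) {π : ℕ → ℕ → ℝ} {x₀ x₁ x₂ y₀ y₁ y₂ : ℝ} (hx : OriginEquations lam a π x₀ x₁ x₂)
    (hy : OriginEquations lam a π y₀ y₁ y₂) : x₀ = y₀ ∧ x₁ = y₁ ∧ x₂ = y₂ := by
  obtain ⟨h2, h1, h0⟩ := hx
  obtain ⟨k2, k1, k0⟩ := hy
  have hl := sub_pos.2 hlam₁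
  have ha := sub_pos.2 ha₁
  have e2 : (lam * ((1 - a) ^ 2 + a) + (1 - lam) * a) * (x₂ - y₂) = 0 := by
    linear_combination h2 - k2
  have f2 : x₂ = y₂ := sub_eq_zero.1 ((mul_eq_zero.1 e2).resolve_left (by positivity))
  subst f2
  have e1 : (lam * ((1 - a) ^ 2 + a ^ 2)) * (x₁ - y₁) = 0 := by
    linear_combination h1 - k1 + h0 - k0
  have f1 : x₁ = y₁ := sub_eq_zero.1 ((mul_eq_zero.1 e1).resolve_left (by positivity))
  subst f1
  have e0 : (lam * (1 - a)) * (x₀ - y₀) = 0 := by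
    linear_combination h0 - k0
  exact ⟨sub_eq_zero.1 ((mul_eq_zero.1 e0).resolve_left (by positivity)), rfl, rfl⟩

theorem hasSum_eq_of_forall {f g : ℕ → ℝ} {x y : ℝ} (hf : HasSum f x) (hg : HasSum g y)
    (e : ∀ i, f i = g i) : x = y := by
  rw [funext e] at hf
  exact hf.unique hg

/-! ### The candidate solution and the convergence of its series. -/

namespace CompSeq

variable {lam a : ℝ} {S : CompSeq}

/-- The series outside the states `(0, 0)` and `(0, 1)`. -/
def series (S : CompSeq) (k l : ℕ) : ℝ := ∑' i, S.amp l i * S.γ i ^ k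

variable (lam a) in
/-- The unnormalised solution of the balance equations. -/
def solution (S : CompSeq) : ℕ → ℕ → ℝ
  -- The values at `(0, 0)` and `(0, 1)` are those forced by the origin equations.
  | 0, 0 => (S.series 0 2 * ((1 - lam) * a) + 2 * pDown lam a * S.series 1 0) / pUp lam a *
      ((1 - lam) * a) / (lam * (1 - a))
  | 0, 1 => (S.series 0 2 * ((1 - lam) * a) + 2 * pDown lam a * S.series 1 0) / pUp lam a
  | 0, l + 2 => S.series 0 (l + 2)
  | k + 1, l => S.series (k + 1) l

theorem solution_add_two (S : CompSeq) (k l : ℕ) :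
    S.solution lam a k (l + 2) = S.series k (l + 2) := by
  cases k <;> rfl

/-- The standing assumptions on the parameters and the sequences. -/
structure IsStable (lam a : ℝ) (S : CompSeq) : Prop where
  lam_pos : 0 < lam
  lam_lt : lam < 1
  a_pos : 0 < a
  a_lt : a < 1
  load_lt : load lam a < 1
  explicit : S.IsExplicit lam a

namespace IsStable

theorem up (h : IsStable lam a S) : 0 < pUp lam a := pUp_pos h.lam_pos h.a_pos

theorem down (h : IsStable lam a S) : 0 < pDown lam a := pDown_pos h.lam_lt h.a_pos h.a_lt

theorem swap (h : IsStable lam a S) : 0 < pSwap lam a := pSwap_pos h.lam_pos h.a_pos h.a_lt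

theorem isRootSeq (h : IsStable lam a S) : IsRootSeq lam a S.γ S.δ :=
  h.explicit.isRootSeq h.lam_pos h.lam_lt h.a_pos h.a_lt h.load_lt

theorem summable_weight (h : IsStable lam a S) : Summable S.weight :=
  h.explicit.summable_weight h.lam_pos h.lam_lt h.a_pos h.a_lt h.load_lt

theorem γ_zero_pos (h : IsStable lam a S) : 0 < S.γ 0 := h.isRootSeq.γ_pos h.down h.swap 0

theorem γ_zero_lt (h : IsStable lam a S) : S.γ 0 < 1 := by
  have h0 := load_pos h.lam_pos h.lam_lt h.a_pos h.a_lt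
  have h1 := h.load_lt
  rw [h.isRootSeq.γ_zero]
  nlinarith

theorem abs_amp_le (h : IsStable lam a S) (k : ℕ) (l : Fin 2) (i : ℕ) :
    |S.amp l i * S.γ i ^ (k + 1)| ≤ S.γ 0 ^ k * (ampBound lam a * S.weight i) := by
  have h1 := h.explicit.abs_amp_le h.lam_pos h.lam_lt h.a_pos h.a_lt h.load_lt l i
  have h2 := h.isRootSeq.γ_pos h.down h.swap i
  have h3 := (h.isRootSeq.γ_strictAnti h.down h.swap).antitone (Nat.zero_le i)
  have h4 := h.γ_zero_pos
  have e : S.amp l i * S.γ i ^ (k + 1) = S.γ i ^ k * (S.amp l i * S.γ i) := by ring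
  rw [e, abs_mul, abs_of_pos (pow_pos h2 k)]
  gcongr

theorem summable_amp_add_two (h : IsStable lam a S) (k l : ℕ) :
    Summable fun i => S.amp (l + 2) i * S.γ i ^ k :=
  Summable.of_norm_bounded (h.summable_weight.mul_left _)
    fun i => abs_layer_le h.isRootSeq h.down h.swap k l i

theorem summable_amp_succ (h : IsStable lam a S) (k : ℕ) (l : Fin 2) :
    Summable fun i => S.amp l i * S.γ i ^ (k + 1) :=
  Summable.of_norm_bounded ((h.summable_weight.mul_left _).mul_left _)
    fun i => h.abs_amp_le k l i

theorem hasSum_add_two (h : IsStable lam a S) (k l : ℕ) :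
    HasSum (fun i => S.amp (l + 2) i * S.γ i ^ k) (S.series k (l + 2)) :=
  (h.summable_amp_add_two k l).hasSum

theorem hasSum_succ_zero (h : IsStable lam a S) (k : ℕ) :
    HasSum (fun i => S.amp 0 i * S.γ i ^ (k + 1)) (S.series (k + 1) 0) :=
  (h.summable_amp_succ k 0).hasSum

theorem hasSum_succ_one (h : IsStable lam a S) (k : ℕ) :
    HasSum (fun i => S.amp 1 i * S.γ i ^ (k + 1)) (S.series (k + 1) 1) :=
  (h.summable_amp_succ k 1).hasSum

theorem summable_d (h : IsStable lam a S) (k l : ℕ) :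
    Summable fun i => |S.d i * S.γ i ^ k * S.δ i ^ (l + 2)| :=
  Summable.of_nonneg_of_le (fun _ => abs_nonneg _)
    (fun i => abs_d_le h.isRootSeq h.down h.swap k l i)
    ((h.explicit.summable_d h.lam_pos h.lam_lt h.a_pos h.a_lt h.load_lt).1.mul_left _)

theorem summable_c (h : IsStable lam a S) (k l : ℕ) :
    Summable fun i => |S.c i * S.γ i ^ k * S.δ (i - 1) ^ (l + 2)| :=
  Summable.of_nonneg_of_le (fun _ => abs_nonneg _)
    (fun i => abs_c_le h.isRootSeq h.down h.swap k l i)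
    ((h.explicit.summable_d h.lam_pos h.lam_lt h.a_pos h.a_lt h.load_lt).2.mul_left _)

/-- Pairing the terms with the same `γ` and pairing those with the same `δ` give the same sum. -/
theorem _root_.RelayNetwork.CompSeq.hasSum_pair (hc : S.c 0 = 0) {k l : ℕ} {x : ℝ}
    (h1 : Summable fun i => S.d i * S.γ i ^ k * S.δ i ^ l)
    (h2 : Summable fun i => S.c i * S.γ i ^ k * S.δ (i - 1) ^ l)
    (hx : HasSum (fun i => S.layer l i * S.γ i ^ k) x) :
    HasSum (fun i => (S.d i * S.γ i ^ k + S.c (i + 1) * S.γ (i + 1) ^ k) * S.δ i ^ l) x := by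
  have e : (fun i => S.layer l i * S.γ i ^ k) = fun i =>
      S.d i * S.γ i ^ k * S.δ i ^ l + S.c i * S.γ i ^ k * S.δ (i - 1) ^ l := by
    funext i; unfold layer; ring
  rw [e] at hx
  have hx' := hx.unique (h1.hasSum.add h2.hasSum)
  -- The index of the `c` terms is shifted by one; nothing is lost because `c 0 = 0`.
  rw [h2.tsum_eq_zero_add, hc, zero_mul, zero_mul, zero_add] at hx'
  rw [hx']
  have h3 := h1.hasSum.add ((summable_nat_add_iff 1).2 h2).hasSum
  simpa only [add_mul, Nat.add_sub_cancel] using h3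

theorem hasSum_pair_add_two (h : IsStable lam a S) (k l : ℕ) :
    HasSum (fun i => (S.d i * S.γ i ^ k + S.c (i + 1) * S.γ (i + 1) ^ k) * S.δ i ^ (l + 2))
      (S.series k (l + 2)) :=
  hasSum_pair h.explicit.c_zero (h.summable_d k l).of_abs (h.summable_c k l).of_abs
    (h.hasSum_add_two k l)

theorem summable_layer_one (h : IsStable lam a S) : Summable fun i => S.layer 1 i * S.γ i ^ 1 := by
  refine Summable.of_norm_bounded h.summable_weight fun i => ?_
  rw [pow_one]
  exact abs_layer_one_le h.isRootSeq h.down h.swap h.explicit.c_zero i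

theorem hasSum_pair_one_one (h : IsStable lam a S) :
    HasSum (fun i => (S.d i * S.γ i ^ 1 + S.c (i + 1) * S.γ (i + 1) ^ 1) * S.δ i ^ 1)
      (∑' i, S.layer 1 i * S.γ i ^ 1) := by
  have hs := h.explicit.summable_d h.lam_pos h.lam_lt h.a_pos h.a_lt h.load_lt
  exact hasSum_pair h.explicit.c_zero
    (Summable.of_norm_bounded hs.1 fun i => abs_d_one_le h.isRootSeq h.down h.swap i)
    (Summable.of_norm_bounded hs.2 fun i =>
      abs_c_one_le h.isRootSeq h.down h.swap h.explicit.c_zero i) h.summable_layer_one.hasSum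

theorem amp_rows (h : IsStable lam a S) (i : ℕ) :
    S.γ i * (pUp lam a + pSwap lam a + 2 * pDown lam a) * S.amp 0 i -
        (pUp lam a + pDown lam a * S.γ i) * S.amp 1 i = pSwap lam a * S.amp 2 i ∧
      S.γ i * (pUp lam a + 2 * pDown lam a) * S.amp 1 i -
          S.γ i * (pUp lam a + 2 * pDown lam a * S.γ i) * S.amp 0 i =
        (pUp lam a + pDown lam a * S.γ i) * S.amp 2 i + pSwap lam a * S.amp 3 i ∧
      pSwap lam a * S.amp 0 i + pDown lam a * S.amp 1 i = pDown lam a * S.layer 1 i :=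
  h.explicit.amp_rows h.lam_pos h.lam_lt h.a_pos h.a_lt h.load_lt i

theorem amp_kernel (h : IsStable lam a S) (l i : ℕ) :
    (pUp lam a + pSwap lam a + 2 * pDown lam a) * S.γ i * S.amp (l + 3) i =
      (pDown lam a * S.γ i + pUp lam a) * S.amp (l + 4) i + pSwap lam a * S.amp (l + 5) i +
        pDown lam a * S.γ i ^ 2 * S.amp (l + 2) i :=
  layer_kernel h.isRootSeq h.down h.swap h.explicit.c_zero (l + 2) i

theorem amp_kernel_two (h : IsStable lam a S) (i : ℕ) :
    (pUp lam a + pSwap lam a + 2 * pDown lam a) * S.γ i * S.amp 2 i =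
      (pDown lam a * S.γ i + pUp lam a) * S.amp 3 i + pSwap lam a * S.amp 4 i +
        pDown lam a * S.γ i ^ 2 * S.layer 1 i :=
  layer_kernel h.isRootSeq h.down h.swap h.explicit.c_zero 1 i

theorem vertErr_add (h : IsStable lam a S) (i : ℕ) :
    S.d i * vertErr lam a (S.γ i) (S.δ i) + S.c (i + 1) * vertErr lam a (S.γ (i + 1)) (S.δ i) = 0 := by
  have := (h.isRootSeq.vertErr_low_pos h.lam_pos h.lam_lt h.a_pos h.a_lt i).ne'
  rw [h.explicit.c_succ]
  field_simp
  ring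

/-! ### Verification of the balance equations, term by term. -/

theorem balance_interior (h : IsStable lam a S) (k l : ℕ) :
    (pUp lam a + pSwap lam a + 2 * pDown lam a) * S.series (k + 1) (l + 3) =
      pDown lam a * S.series (k + 2) (l + 2) + pDown lam a * S.series (k + 1) (l + 4) +
        pUp lam a * S.series k (l + 4) + pSwap lam a * S.series k (l + 5) := by
  have h0 := h.hasSum_add_two (k + 1) (l + 1)
  have h1 := h.hasSum_add_two (k + 2) l
  have h2 := h.hasSum_add_two (k + 1) (l + 2)
  have h3 := h.hasSum_add_two k (l + 2)
  have h4 := h.hasSum_add_two k (l + 3)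
  refine hasSum_eq_of_forall (h0.mul_left _) ((((h1.mul_left (pDown lam a)).add
    (h2.mul_left (pDown lam a))).add (h3.mul_left (pUp lam a))).add (h4.mul_left (pSwap lam a)))
    fun i => ?_
  have e := h.amp_kernel l i
  linear_combination S.γ i ^ k * e

/-- The kernel relation involves `layer 1`, which is not the amplitude used at difference one; the
third row of `amp_rows` converts it into the amplitudes at differences zero and one. -/
theorem balance_two (h : IsStable lam a S) (k : ℕ) :
    (pUp lam a + pSwap lam a + 2 * pDown lam a) * S.series (k + 1) 2 =
      pDown lam a * S.series (k + 2) 1 + pDown lam a * S.series (k + 1) 3 +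
        pUp lam a * S.series k 3 + pSwap lam a * S.series k 4 +
          pSwap lam a * S.series (k + 2) 0 := by
  have h0 := h.hasSum_add_two (k + 1) 0
  have h1 := h.hasSum_succ_one (k + 1)
  have h2 := h.hasSum_add_two (k + 1) 1
  have h3 := h.hasSum_add_two k 1
  have h4 := h.hasSum_add_two k 2
  have h5 := h.hasSum_succ_zero (k + 1)
  refine hasSum_eq_of_forall (h0.mul_left _) (((((h1.mul_left (pDown lam a)).add
    (h2.mul_left (pDown lam a))).add (h3.mul_left (pUp lam a))).add
      (h4.mul_left (pSwap lam a))).add (h5.mul_left (pSwap lam a))) fun i => ?_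
  have e1 := h.amp_kernel_two i
  have e2 := (h.amp_rows i).2.2
  linear_combination S.γ i ^ k * e1 - S.γ i ^ (k + 2) * e2

theorem balance_one (h : IsStable lam a S) (k : ℕ) :
    (pUp lam a + 2 * pDown lam a) * S.series (k + 1) 1 =
      pDown lam a * S.series (k + 1) 2 + 2 * pDown lam a * S.series (k + 2) 0 +
        pUp lam a * S.series k 2 + pUp lam a * S.series (k + 1) 0 + pSwap lam a * S.series k 3 := by
  have h0 := h.hasSum_succ_one k
  have h1 := h.hasSum_add_two (k + 1) 0
  have h2 := h.hasSum_succ_zero (k + 1)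
  have h3 := h.hasSum_add_two k 0
  have h4 := h.hasSum_succ_zero k
  have h5 := h.hasSum_add_two k 1
  refine hasSum_eq_of_forall (h0.mul_left _) (((((h1.mul_left (pDown lam a)).add
    (h2.mul_left (2 * pDown lam a))).add (h3.mul_left (pUp lam a))).add
      (h4.mul_left (pUp lam a))).add (h5.mul_left (pSwap lam a))) fun i => ?_
  have e := (h.amp_rows i).2.1
  linear_combination S.γ i ^ k * e

theorem balance_zero (h : IsStable lam a S) (k : ℕ) :
    (pUp lam a + pSwap lam a + 2 * pDown lam a) * S.series (k + 2) 0 =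
      pDown lam a * S.series (k + 2) 1 + pUp lam a * S.series (k + 1) 1 +
        pSwap lam a * S.series (k + 1) 2 := by
  have h0 := h.hasSum_succ_zero (k + 1)
  have h1 := h.hasSum_succ_one (k + 1)
  have h2 := h.hasSum_succ_one k
  have h3 := h.hasSum_add_two (k + 1) 0
  refine hasSum_eq_of_forall (h0.mul_left _) (((h1.mul_left (pDown lam a)).add
    (h2.mul_left (pUp lam a))).add (h3.mul_left (pSwap lam a))) fun i => ?_
  have e := (h.amp_rows i).1
  linear_combination S.γ i ^ (k + 1) * e

/-- The cancellation is between terms with the same `δ i`, so the series are used in the regrouped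
form of `hasSum_pair`. -/
theorem balance_vertical (h : IsStable lam a S) (l : ℕ) :
    (1 - ((1 - lam) * (1 - a) + pSwap lam a)) * S.series 0 (l + 3) =
      (1 - lam) * a * S.series 0 (l + 4) + pDown lam a * S.series 1 (l + 2) := by
  have h0 := h.hasSum_pair_add_two 0 (l + 1)
  have h1 := h.hasSum_pair_add_two 0 (l + 2)
  have h2 := h.hasSum_pair_add_two 1 l
  refine hasSum_eq_of_forall (h0.mul_left _) ((h1.mul_left ((1 - lam) * a)).add
    (h2.mul_left (pDown lam a))) fun i => ?_
  have e := h.vertErr_add i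
  simp only [vertErr, pDown, pSwap] at e ⊢
  linear_combination S.δ i ^ (l + 2) * e

/-- Combines both compensations: vertical cancellation uses the sum of `layer 1`, and the horizontal
third row expresses it by the true values in `(1, 0)` and `(1, 1)`. -/
theorem balance_vertical_two (h : IsStable lam a S) :
    (1 - ((1 - lam) * (1 - a) + pSwap lam a)) * S.series 0 2 =
      (1 - lam) * a * S.series 0 3 + pDown lam a * S.series 1 1 + pSwap lam a * S.series 1 0 := by
  have h0 := h.hasSum_pair_add_two 0 0
  have h1 := h.hasSum_pair_add_two 0 1
  have h2 := h.hasSum_pair_one_one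
  have h3 : pSwap lam a * S.series 1 0 + pDown lam a * S.series 1 1 =
      pDown lam a * ∑' i, S.layer 1 i * S.γ i ^ 1 := by
    refine hasSum_eq_of_forall (((h.hasSum_succ_zero 0).mul_left (pSwap lam a)).add
      ((h.hasSum_succ_one 0).mul_left (pDown lam a)))
      (h.summable_layer_one.hasSum.mul_left (pDown lam a)) fun i => ?_
    have e := (h.amp_rows i).2.2
    linear_combination S.γ i * e
  have h4 : (1 - ((1 - lam) * (1 - a) + pSwap lam a)) * S.series 0 2 =
      (1 - lam) * a * S.series 0 3 + pDown lam a * ∑' i, S.layer 1 i * S.γ i ^ 1 := by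
    refine hasSum_eq_of_forall (h0.mul_left _) ((h1.mul_left ((1 - lam) * a)).add
      (h2.mul_left (pDown lam a))) fun i => ?_
    have e := h.vertErr_add i
    simp only [vertErr, pDown, pSwap] at e ⊢
    linear_combination S.δ i * e
  linear_combination h4 - h3

theorem isBalanced (h : IsStable lam a S) : IsBalanced lam a (S.solution lam a) where
  interior k l := by
    rw [show S.solution lam a k (l + 4) = S.series k (l + 4) from S.solution_add_two k (l + 2),
      show S.solution lam a k (l + 5) = S.series k (l + 5) from S.solution_add_two k (l + 3)]
    simp only [solution]
    linear_combination h.balance_interior k l +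
      S.series (k + 1) (l + 3) * one_sub_pIdle_add_pSwap lam a
  two k := by
    rw [show S.solution lam a k 3 = S.series k 3 from S.solution_add_two k 1,
      show S.solution lam a k 4 = S.series k 4 from S.solution_add_two k 2]
    simp only [solution]
    linear_combination h.balance_two k + S.series (k + 1) 2 * one_sub_pIdle_add_pSwap lam a
  one k := by
    rw [show S.solution lam a k 2 = S.series k 2 from S.solution_add_two k 0,
      show S.solution lam a k 3 = S.series k 3 from S.solution_add_two k 1]
    simp only [solution]
    linear_combination h.balance_one k + S.series (k + 1) 1 * one_sub_pIdle_add_pSwap lam a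
  zero k := by
    simp only [solution]
    linear_combination h.balance_zero k + S.series (k + 2) 0 * one_sub_pIdle_add_pSwap lam a
  vertical l := by
    rw [show S.solution lam a 0 (l + 3) = S.series 0 (l + 3) from rfl,
      show S.solution lam a 0 (l + 4) = S.series 0 (l + 4) from rfl,
      show S.solution lam a 1 (l + 2) = S.series 1 (l + 2) from rfl]
    linear_combination h.balance_vertical l
  origin := by
    have hp := h.up
    have hl := h.lam_pos
    have ha := sub_pos.2 h.a_lt
    have e1 : S.solution lam a 0 1 * pUp lam a =
        S.series 0 2 * ((1 - lam) * a) + 2 * pDown lam a * S.series 1 0 :=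
      div_mul_cancel₀ _ hp.ne'
    have e0 : S.solution lam a 0 0 * (lam * (1 - a)) = S.solution lam a 0 1 * ((1 - lam) * a) :=
      div_mul_cancel₀ _ (by positivity)
    have e2 := h.balance_vertical_two
    unfold OriginEquations
    rw [show S.solution lam a 0 2 = S.series 0 2 from rfl,
      show S.solution lam a 0 3 = S.series 0 3 from rfl,
      show S.solution lam a 1 0 = S.series 1 0 from rfl,
      show S.solution lam a 1 1 = S.series 1 1 from rfl]
    unfold pUp pDown at e1
    unfold pSwap pDown at e2
    exact ⟨by linear_combination e2, by linear_combination e1 - e0, by linear_combination e0⟩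

/-! ### Summability and sign of the candidate solution. -/

/-- The solution is summable over all states. -/
theorem summable_solution (h : IsStable lam a S) :
    Summable fun s : ℕ × ℕ => |S.solution lam a s.1 s.2| := by
  have hg := h.γ_zero_pos
  have hg1 := h.γ_zero_lt
  set g := S.γ 0 with hg'
  set W := ∑' i, S.weight i with hW
  have hW0 : 0 ≤ W := tsum_nonneg S.weight_nonneg
  have hC0 : 0 ≤ ampBound lam a := by
    have := h.up; have := h.down; have := h.swap
    unfold ampBound; positivity
  have b2 : ∀ k l, |S.series k (l + 2)| ≤ g ^ k * g ^ l * W := fun k l =>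
    tsum_of_norm_bounded (f := fun i => S.amp (l + 2) i * S.γ i ^ k)
      (h.summable_weight.hasSum.mul_left _) fun i => abs_layer_le h.isRootSeq h.down h.swap k l i
  have b1 : ∀ k, ∀ l : Fin 2, |S.series (k + 1) l| ≤ g ^ k * (ampBound lam a * W) := fun k l =>
    tsum_of_norm_bounded (f := fun i => S.amp l i * S.γ i ^ (k + 1))
      ((h.summable_weight.hasSum.mul_left _).mul_left _) fun i => h.abs_amp_le k l i
  set K := W + ampBound lam a * W + |S.solution lam a 0 0| + |S.solution lam a 0 1| with hK
  have hCW : 0 ≤ ampBound lam a * W := mul_nonneg hC0 hW0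
  have a0 := abs_nonneg (S.solution lam a 0 0)
  have a1 := abs_nonneg (S.solution lam a 0 1)
  have hK0 : 0 ≤ K := by positivity
  -- The natural bound is a multiple of `g ^ (k + l - 2)`; the factor `g ^ 2` is kept on the left to
  -- avoid negative exponents.
  have key : ∀ k l, |S.solution lam a k l| * g ^ 2 ≤ K * (g ^ k * g ^ l) := by
    intro k l
    have hgl : g ^ 2 ≤ g := by nlinarith
    have hg2 : g ^ 2 ≤ 1 := by nlinarith
    rcases l with _ | _ | l
    · rcases k with _ | k
      · rw [pow_zero, mul_one, mul_one]
        exact (mul_le_mul (by linarith) hg2 (by positivity) hK0).trans (mul_one K).le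
      · have := b1 k 0
        calc |S.solution lam a (k + 1) 0| * g ^ 2 ≤ g ^ k * (ampBound lam a * W) * g :=
              mul_le_mul this hgl (by positivity) (by positivity)
          _ ≤ g ^ k * K * g := by gcongr; linarith
          _ = _ := by ring
    · rcases k with _ | k
      · rw [pow_zero, zero_add, pow_one, one_mul]
        exact mul_le_mul (by linarith) hgl (by positivity) hK0
      · have := b1 k 1
        calc |S.solution lam a (k + 1) 1| * g ^ 2 ≤ g ^ k * (ampBound lam a * W) * g ^ 2 :=
              mul_le_mul_of_nonneg_right this (by positivity)
          _ ≤ g ^ k * K * g ^ 2 := by gcongr; linarith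
          _ = _ := by ring
    · rw [solution_add_two]
      calc |S.series k (l + 2)| * g ^ 2 ≤ g ^ k * g ^ l * W * g ^ 2 :=
            mul_le_mul_of_nonneg_right (b2 k l) (by positivity)
        _ ≤ g ^ k * g ^ l * K * g ^ 2 := by gcongr; linarith
        _ = _ := by ring
  have hgeo := summable_geometric_of_lt_one hg.le hg1
  refine Summable.of_nonneg_of_le (fun _ => abs_nonneg _) (fun s => ?_)
    ((hgeo.mul_of_nonneg hgeo (fun n => by positivity) fun n => by positivity).mul_left (K / g ^ 2))
  rw [div_mul_eq_mul_div, le_div_iff₀ (by positivity)]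
  exact key s.1 s.2

/-- For large `k` the initial term `δ 0 ^ 2 * γ 0 ^ k` outweighs the tail, which is at most `γ 1 ^ k
* W`. This fixes the sign of the solution. -/
theorem exists_solution_pos (h : IsStable lam a S) : ∃ k, 0 < S.solution lam a k 2 := by
  have hR := h.isRootSeq
  have hanti := hR.γ_strictAnti h.down h.swap
  have hg0 := h.γ_zero_pos
  have hg1 := hR.γ_pos h.down h.swap 1
  have hδ := hR.δ_pos 0
  set W := ∑' i, S.weight (i + 1) with hW
  have hW0 : 0 ≤ W := tsum_nonneg fun i => S.weight_nonneg _
  have hws := (summable_nat_add_iff 1).2 h.summable_weight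
  -- `W + 1` replaces `W` to keep the denominator positive.
  obtain ⟨k, hk⟩ := exists_pow_lt_of_lt_one (show 0 < S.δ 0 ^ 2 / (W + 1) by positivity)
    (show S.γ 1 / S.γ 0 < 1 from (div_lt_one hg0).2 (hanti Nat.zero_lt_one))
  refine ⟨k, ?_⟩
  rw [div_pow, div_lt_div_iff₀ (by positivity) (by positivity)] at hk
  have hs := h.summable_amp_add_two k 0
  rw [show S.solution lam a k 2 = S.series k 2 from S.solution_add_two k 0, series,
    hs.tsum_eq_zero_add]
  have htail : |∑' i, S.amp 2 (i + 1) * S.γ (i + 1) ^ k| ≤ S.γ 1 ^ k * W := by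
    refine tsum_of_norm_bounded (f := fun i => S.amp 2 (i + 1) * S.γ (i + 1) ^ k)
      (hws.hasSum.mul_left _) fun i => ?_
    have e1 := abs_layer_le hR h.down h.swap 0 0 (i + 1)
    simp only [pow_zero, mul_one, one_mul] at e1
    have e2 := hanti.antitone (Nat.succ_le_succ (Nat.zero_le i))
    have e3 := hR.γ_pos h.down h.swap (i + 1)
    rw [Real.norm_eq_abs, abs_mul, abs_of_pos (pow_pos e3 k), mul_comm]
    exact mul_le_mul (pow_le_pow_left₀ e3.le e2 k) e1 (abs_nonneg _) (by positivity)
  have hfirst : S.amp 2 0 = S.δ 0 ^ 2 := by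
    simp [amp, layer, h.explicit.c_zero, h.explicit.d_zero]
  rw [hfirst]
  have h1 := (abs_le.1 htail).1
  have h2 : 0 < S.γ 1 ^ k := by positivity
  linarith

end IsStable

end CompSeq

end RelayNetwork

end

theorem theorem3p3 (lam a : ℝ) (hlam₀ : 0 < lam) (hlam₁ : lam < 1) (ha₀ : 0 < a) (ha₁ : a < 1)
    (hload : RelayNetwork.load lam a < 1) :
    (∃! S : RelayNetwork.CompSeq, S.IsGenerated lam a) ∧
    ∀ S : RelayNetwork.CompSeq, S.IsGenerated lam a →
      ∃ (π : ℕ → ℕ → ℝ) (c : ℝ), RelayNetwork.IsEquilibrium lam a π ∧ 0 < c ∧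
        (∀ k l : ℕ, 2 ≤ l →
          Summable (fun i => |S.d i * S.γ i ^ k * S.δ i ^ l|) ∧
          Summable (fun i => |S.c (i + 1) * S.γ (i + 1) ^ k * S.δ i ^ l|) ∧
          π k l = c * ∑' i, (S.d i * S.γ i ^ k + S.c (i + 1) * S.γ (i + 1) ^ k) * S.δ i ^ l ∧
          π k l = c * (S.d 0 * S.γ 0 ^ k * S.δ 0 ^ l +
            ∑' i, (S.c (i + 1) * S.δ i ^ l + S.d (i + 1) * S.δ (i + 1) ^ l) *
              S.γ (i + 1) ^ k)) ∧
        (∀ k : ℕ, 0 < k → ∀ l : Fin 2,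
          Summable (fun i => |S.e l i * S.γ i ^ k * S.δ i ^ (l : ℕ)|) ∧
          π k l = c * ∑' i, S.e l i * S.γ i ^ k * S.δ i ^ (l : ℕ)) ∧
        (∀ x₀ x₁ x₂ : ℝ, RelayNetwork.OriginEquations lam a π x₀ x₁ x₂ ↔
          x₀ = π 0 0 ∧ x₁ = π 0 1 ∧ x₂ = π 0 2) := by
  have hiff := RelayNetwork.CompSeq.isGenerated_iff hlam₀ hlam₁ ha₀ ha₁ hload
  refine ⟨by simpa only [hiff] using RelayNetwork.CompSeq.existsUnique_isExplicit lam a,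
    fun S hS => ?_⟩
  have h : RelayNetwork.CompSeq.IsStable lam a S :=
    ⟨hlam₀, hlam₁, ha₀, ha₁, hload, (hiff S).1 hS⟩
  obtain ⟨k₀, hk₀⟩ := h.exists_solution_pos
  obtain ⟨c, hc, heq⟩ := h.isBalanced.exists_isEquilibrium hlam₀ hlam₁ ha₀ ha₁
    h.summable_solution hk₀
  refine ⟨fun k l => c * S.solution lam a k l, c, heq, hc, ?_, ?_, ?_⟩
  · intro k l hl
    obtain ⟨l, rfl⟩ := Nat.exists_eq_add_of_le' hl
    refine ⟨h.summable_d k l, ?_, ?_, ?_⟩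
    · simpa only [Nat.add_sub_cancel] using (summable_nat_add_iff 1).2 (h.summable_c k l)
    · beta_reduce
      rw [RelayNetwork.CompSeq.solution_add_two, (h.hasSum_pair_add_two k l).tsum_eq]
    -- The grouping by common `γ` is the defining series with its first term split off.
    · beta_reduce
      rw [RelayNetwork.CompSeq.solution_add_two, RelayNetwork.CompSeq.series,
        (h.summable_amp_add_two k l).tsum_eq_zero_add]
      simp only [RelayNetwork.CompSeq.amp, RelayNetwork.CompSeq.layer, h.explicit.c_zero,
        Nat.add_sub_cancel]
      congr 2
      · ring
      · exact tsum_congr fun i => by ring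
  · intro k hk l
    obtain ⟨k, rfl⟩ := Nat.exists_eq_add_of_le' hk
    have e : ∀ i, S.amp l i * S.γ i ^ (k + 1) = S.e l i * S.γ i ^ (k + 1) * S.δ i ^ (l : ℕ) := by
      intro i
      fin_cases l <;> simp [RelayNetwork.CompSeq.amp]
      ring
    have hs := h.summable_amp_succ k l
    simp only [e] at hs
    refine ⟨hs.abs, ?_⟩
    simp only [RelayNetwork.CompSeq.solution, RelayNetwork.CompSeq.series, e]
  · intro x₀ x₁ x₂
    -- The equations are homogeneous, so they survive the normalisation.
    have h0 : RelayNetwork.OriginEquations lam a (fun k l => c * S.solution lam a k l)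
        (c * S.solution lam a 0 0) (c * S.solution lam a 0 1) (c * S.solution lam a 0 2) := by
      obtain ⟨e2, e1, e0⟩ := h.isBalanced.origin
      exact ⟨by linear_combination c * e2, by linear_combination c * e1,
        by linear_combination c * e0⟩
    constructor
    · exact fun hx => hx.unique hlam₀ hlam₁ ha₀ ha₁ h0
    · rintro ⟨rfl, rfl, rfl⟩
      exact h0
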